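/- Let $G$ be a group with a Garside structure $(G,\mathcal P,\delta)$: $\mathcal P$ is a submonoid of $G$ with $\mathcal P\cap\mathcal P^{-1}=\{1\}$ and $\delta\in\mathcal P$, such that $a\preccurlyeq b\Leftrightarrow a^{-1}b\in\mathcal P$ is a lattice order on $G$ (with gcd $\wedge$), the set $[1,\delta]=\{a\mid 1\preccurlyeq a\preccurlyeq\delta\}$ of simple elements generates $G$, $\delta^{-1}\mathcal P\delta\subset\mathcal P$, and for each $Z\in\mathcal P\setminus\{1\}$ the maximal number $\|Z\|$ of factors in a decomposition of $Z$ into elements of $\mathcal P\setminus\{1\}$ is finite ($\|1\|=0$). Let $\mathcal A$ be the set of atoms (elements of $\mathcal P\setminus\{1\}$ that are not products of two elements of $\mathcal P\setminus\{1\}$). Assume that the structure is of finite type ($[1,\delta]$ is finite), symmetric (for simple $u,v$: $u^{-1}v\in\mathcal P\Leftrightarrow vu^{-1}\in\mathcal P$) and homogeneous ($\|YZ\|=\|Y\|+\|Z\|$ for $Y,Z\in\mathcal P$). It is called square free if no simple element has the form $Ux^2V$ with $U,V\in\mathcal P$, $x\in\mathcal A$. The left normal form of $X\in G$ is the decomposition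 $X=\delta^p\cdot A_1\cdot\ldots\cdot A_r$ with $p\in\mathbb Z$, $A_i\in[1,\delta]\setminus\{1,\delta\}$ and $A_i=(A_iA_{i+1})\wedge\delta$ for $1\le i<r$; in a left normal form, $x^k$ for an atom $x$ stands for $k$ factors $x\cdot\ldots\cdot x$. Put $\iota(X)=\delta^{p}A_1\delta^{-p}$, $\varphi(X)=A_r$ if $r\ge1$, and $\iota(X)=1$, $\varphi(X)=\delta$ if $r=0$. Write $X^u=u^{-1}Xu$ and $X^G=\{X^u\mid u\in G\}$. The cycling, decycling and cyclic sliding of $X$ are $\mathbf c(X)=X^{\iota(X)}$, $\mathbf d(X)=X^{\varphi(X)^{-1}}$ and $\mathfrak s(X)=X^{\mathfrak p(X)}$, where $\mathfrak p(X)=\iota(X)\wedge(\varphi(X)^{-1}\delta)$. The set of sliding circuits is $\mathrm{SC}(X)=\{Y\in X^G\mid \mathfrak s^m(Y)=Y\text{ for some }m>0\}$, and the cycling (decycling) orbits in it are the sets $\{\mathbf c^m(Y)\mid m\ge0\}$ (respectively $\{\mathbf d^m(Y)\mid m\ge0\}$) with $Y\in\mathrm{SC}(X)$. **Theorem 1.**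 Let $k,l\ge1$ be integers, $X\in G$ and $x,y\in\mathcal A$. (a) If $k\ge2$, suppose that the structure is square free. Suppose also that $x\ne\delta$ (which excludes only the case that $G=\langle\delta\rangle$ and $\delta$ is the only atom). Then $X\in(x^k)^G$ if and only if the left normal form of $X$ is $$\delta^{-n}\cdot A_n\cdot\ldots\cdot A_1\cdot x_1^k\cdot B_1\cdot\ldots\cdot B_n\qquad(1)$$ for some $n\ge0$, some $x_1\in x^G\cap\mathcal A$ and some simple elements $A_i,B_i$ with $$A_i\delta^{i-1}B_i=\delta^i,\qquad i=1,\dots,n.\qquad(2)$$ (b) If $\max(k,l)\ge2$, suppose that the structure is square free. Then $X\in(x^k)^G(y^l)^G$ if and only if either $X\in(x_1^ky_1^l)^G$ for some $x_1\in x^G\cap\mathcal A$, $y_1\in y^G\cap\mathcal A$, or every cycling orbit and every decycling orbit in $\mathrm{SC}(X)$ contains an element whose left normal form is $$\delta^{-n}\cdot A_n\cdot\ldots\cdot A_1\cdot x_1^k\cdot B_1\cdot\ldots\cdot B_n\cdot y_1^l\qquad(3)$$ for some $n\ge1$, $x_1\in x^G\cap\mathcal A$, $y_1\in y^G\cap\mathcal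 A$ and simple elements $A_i,B_i$ satisfying (2). -/

import Mathlib

open scoped Pointwise

/-- A Garside structure `(G, P, δ)` on a group `G`: a submonoid `pos` of positive elements with
`P ∩ P⁻¹ = {1}` and a Garside element `delta`. The prefix order `a ≼ b ↔ a⁻¹ b ∈ P` is a lattice
order, the simple elements `1 ≼ a ≼ δ` generate `G`, conjugation by `δ` preserves `P`, and the
number of factors in decompositions of a given positive element into non-trivial positive elements
is bounded. -/
structure GarsideStructure (G : Type*) [Group G] where
  /-- The submonoid of positive elements. -/
  pos : Submonoid G
  /-- The Garside element. -/
  delta : G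
  delta_mem : delta ∈ pos
  eq_one_of_inv_mem : ∀ a ∈ pos, a⁻¹ ∈ pos → a = 1
  exists_lcm : ∀ a b : G, ∃ c : G, a⁻¹ * c ∈ pos ∧ b⁻¹ * c ∈ pos ∧
    ∀ d : G, a⁻¹ * d ∈ pos → b⁻¹ * d ∈ pos → c⁻¹ * d ∈ pos
  exists_gcd : ∀ a b : G, ∃ c : G, c⁻¹ * a ∈ pos ∧ c⁻¹ * b ∈ pos ∧
    ∀ d : G, d⁻¹ * a ∈ pos → d⁻¹ * b ∈ pos → d⁻¹ * c ∈ pos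
  closure_simple : Subgroup.closure {a : G | a ∈ pos ∧ a⁻¹ * delta ∈ pos} = ⊤
  conj_delta_mem : ∀ a ∈ pos, delta⁻¹ * a * delta ∈ pos
  bddAbove_length : ∀ a ∈ pos, a ≠ 1 →
    BddAbove {m : ℕ | ∃ L : List G, L.length = m ∧ (∀ b ∈ L, b ∈ pos ∧ b ≠ 1) ∧ L.prod = a}

namespace GarsideStructure

variable {G : Type*} [Group G] (Γ : GarsideStructure G)

/-- The prefix order `a ≼ b`. -/
def Prefix (a b : G) : Prop := a⁻¹ * b ∈ Γ.pos

/-- The suffix order: `Γ.Suffix a b` means `a ≽ b`. -/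
def Suffix (a b : G) : Prop := a * b⁻¹ ∈ Γ.pos

/-- The set `[1, δ]` of simple elements. -/
def simples : Set G := {a | Γ.Prefix 1 a ∧ Γ.Prefix a Γ.delta}

/-- The set of atoms. -/
def atoms : Set G := {a | a ∈ Γ.pos ∧ a ≠ 1 ∧
  ∀ b ∈ Γ.pos, ∀ c ∈ Γ.pos, a = b * c → b = 1 ∨ c = 1}

/-- The letter length `‖a‖` of a positive element `a`: the maximal number of factors in a
decomposition of `a` into non-trivial positive elements. -/
noncomputable def norm (a : G) : ℕ :=
  sSup {m : ℕ | ∃ L : List G, L.length = m ∧ (∀ b ∈ L, b ∈ Γ.pos ∧ b ≠ 1) ∧ L.prod = a}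

/-- The greatest common divisor `a ∧ b` with respect to the prefix order. -/
noncomputable def gcd (a b : G) : G := (Γ.exists_gcd a b).choose

/-- The Garside structure is of finite type. -/
def IsFiniteType : Prop := Γ.simples.Finite

/-- The Garside structure is homogeneous. -/
def IsHomogeneous : Prop :=
  ∀ a ∈ Γ.pos, ∀ b ∈ Γ.pos, Γ.norm (a * b) = Γ.norm a + Γ.norm b

/-- The Garside structure is symmetric. -/
def IsSymmetric : Prop :=
  ∀ u ∈ Γ.simples, ∀ v ∈ Γ.simples, Γ.Prefix u v ↔ Γ.Suffix v u

/-- The Garside structure is square free: no simple element is of the form `U x² V` with `U`, `V`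
positive and `x` an atom. -/
def IsSquareFree : Prop :=
  ∀ a ∈ Γ.simples, ¬ ∃ U ∈ Γ.pos, ∃ V ∈ Γ.pos, ∃ x ∈ Γ.atoms, a = U * x ^ 2 * V

/-- For simple `A`, `B`: the decomposition `A · B` is left weighted. -/
def LeftWeighted (A B : G) : Prop := A = Γ.gcd (A * B) Γ.delta

/-- `δ ^ p · A₁ · … · Aᵣ`, where `L = [A₁, …, Aᵣ]`, is the left normal form of `X`. -/
def IsLeftNormalForm (X : G) (p : ℤ) (L : List G) : Prop :=
  X = Γ.delta ^ p * L.prod ∧ (∀ A ∈ L, A ∈ Γ.simples ∧ A ≠ 1 ∧ A ≠ Γ.delta) ∧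
    L.IsChain Γ.LeftWeighted

open Classical in
/-- The left normal form of `X`, as a pair: exponent of `δ`, list of the other factors. -/
noncomputable def leftNormalForm (X : G) : ℤ × List G :=
  if h : ∃ q : ℤ × List G, Γ.IsLeftNormalForm X q.1 q.2 then h.choose else (0, [])

/-- The initial factor `ι(X) = τ⁻ᵖ(A₁)`; it is `1` when `X` is a power of `δ`. -/
noncomputable def initialFactor (X : G) : G :=
  Γ.delta ^ (Γ.leftNormalForm X).1 * (Γ.leftNormalForm X).2.headD 1 *
    Γ.delta ^ (-(Γ.leftNormalForm X).1)

/-- The final factor `φ(X) = Aᵣ`; it is `δ` when `X` is a power of `δ`. -/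
noncomputable def finalFactor (X : G) : G := (Γ.leftNormalForm X).2.getLastD Γ.delta

/-- The cycling of `X`. -/
noncomputable def cycling (X : G) : G :=
  (Γ.initialFactor X)⁻¹ * X * Γ.initialFactor X

/-- The decycling of `X`. -/
noncomputable def decycling (X : G) : G :=
  Γ.finalFactor X * X * (Γ.finalFactor X)⁻¹

/-- The preferred prefix `ι(X) ∧ ∂(φ(X))`, where `∂A = A⁻¹ δ`. -/
noncomputable def preferredPrefix (X : G) : G :=
  Γ.gcd (Γ.initialFactor X) ((Γ.finalFactor X)⁻¹ * Γ.delta)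

/-- The cyclic sliding of `X`. -/
noncomputable def cyclicSliding (X : G) : G :=
  (Γ.preferredPrefix X)⁻¹ * X * Γ.preferredPrefix X

/-- The set of sliding circuits `SC(X)`. -/
def slidingCircuits (X : G) : Set G :=
  {Y | Y ∈ conjugatesOf X ∧ ∃ m : ℕ, 0 < m ∧ Γ.cyclicSliding^[m] Y = Y}

/-- The cycling orbit of `Y`. -/
def cyclingOrbit (Y : G) : Set G := {Z | ∃ m : ℕ, Z = Γ.cycling^[m] Y}

/-- The decycling orbit of `Y`. -/
def decyclingOrbit (Y : G) : Set G := {Z | ∃ m : ℕ, Z = Γ.decycling^[m] Y}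

/-- `A₁, …, Aₙ` and `B₁, …, Bₙ` are simple elements with `Aᵢ δⁱ⁻¹ Bᵢ = δⁱ`
(here the indices start at `0`). -/
def Complementary {n : ℕ} (A B : Fin n → G) : Prop :=
  ∀ i : Fin n, A i ∈ Γ.simples ∧ B i ∈ Γ.simples ∧
    A i * Γ.delta ^ (i : ℕ) * B i = Γ.delta ^ ((i : ℕ) + 1)

/-- The left normal form of `X` is `δ⁻ⁿ · Aₙ ⋯ A₁ · x₁ᵏ · B₁ ⋯ Bₙ` with `n ≥ 0`, an atom `x₁`
conjugate to `x`, and complementary `Aᵢ`, `Bᵢ`. -/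
def HasConjugateForm (x : G) (k : ℕ) (X : G) : Prop :=
  ∃ (n : ℕ) (A B : Fin n → G) (x₁ : G),
    x₁ ∈ conjugatesOf x ∩ Γ.atoms ∧ Γ.Complementary A B ∧
    Γ.IsLeftNormalForm X (-(n : ℤ))
      ((List.ofFn A).reverse ++ List.replicate k x₁ ++ List.ofFn B)

/-- The left normal form of `X` is `δ⁻ⁿ · Aₙ ⋯ A₁ · x₁ᵏ · B₁ ⋯ Bₙ · y₁ˡ` with `n ≥ 1`, atoms `x₁`
and `y₁` conjugate to `x` and `y`, and complementary `Aᵢ`, `Bᵢ`. -/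
def HasProductForm (x : G) (k : ℕ) (y : G) (l : ℕ) (X : G) : Prop :=
  ∃ (n : ℕ) (A B : Fin n → G) (x₁ y₁ : G), 1 ≤ n ∧
    x₁ ∈ conjugatesOf x ∩ Γ.atoms ∧ y₁ ∈ conjugatesOf y ∩ Γ.atoms ∧ Γ.Complementary A B ∧
    Γ.IsLeftNormalForm X (-(n : ℤ))
      ((List.ofFn A).reverse ++ List.replicate k x₁ ++ List.ofFn B ++ List.replicate l y₁)

end GarsideStructure

/-!
For part (a), write an element of `(xᵏ)^G` as `(R⁻¹ x R)ᵏ`, where `R` may be taken positive because a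
power of `δ` is central. If `R` begins with `x`, or with some `z` such that `x z` is simple, then by
symmetry and homogeneity conjugation by this prefix turns `x` into another atom, and the prefix can
be removed from `R`. When nothing more can be removed (`IsReduced`), the left normal form
`B₁ ⋯ Bₙ` of `R` and the complements `Aᵢ` of the `Bᵢ` give the required left normal form
(`IsReduced.isLeftNormalForm`); square freeness makes `x · x` left weighted.

For part (b), consider the conjugates `aᵏ vˡ` of `X` with `v` an atom and `a = R⁻¹ x₁ R`, `1 ≼ R ≼ δᴺ`,
where `N` (the level) is as small as possible. Level `0` is the first alternative. For `N ≥ 1`, call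
these elements good. Minimality of `N` forces the product of the last factor `B` of `R` with `v` not
to be simple, so good elements have the product form (`HasProductForm`) with `n = N`. The proof that every
cycling and every decycling orbit of sliding circuits contains a good element has these ingredients.

* With infimum `p` and supremum `q` fixed, the conjugating elements of cycling, decycling and sliding
  are meets of monomials `Yᵉ δᵐ` (`IsMeet`). Hence these operations commute, cycling followed by
  decycling is sliding if `p + 2 ≤ q`, and the transport of conjugating elements along them respects
  meets.
* Sliding preserves goodness (`IsLeastLevel.mapsTo_slide`). Since iterated cycling attains the maximal
  infimum in the conjugacy class (`IsTame.exists_iterate_cycling`), good elements realize the summit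
  infimum `-N` and supremum `N + k + l`, and some of them are sliding circuits.
* On the finite set of sliding circuits, the operations are injective and their transports are
  periodic, so they preserve minimality of conjugating elements, and conjugating elements between
  circuits are closed under meets. Any two circuits are connected by minimal conjugating elements, so
  it suffices to show that if `Z` is good and `s` is minimal, then some iterated cycling of `Z ^ s` is
  good (`IsLeastLevel.exists_iterate_of_isMinimalStep`).
* For `Z = aᵏ vˡ` the initial factor is `∂B = B⁻¹ δ`, and the complement of the final factor is
  `∂v = v⁻¹ δ`. By minimality, `s` is a prefix of `∂B` or coprime to it, and likewise for `∂v`. It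
  cannot be coprime to both, and if it is a prefix of both, `Z ^ s` is good. In the two mixed cases,
  the transports of `s` along the decyclings `vⁱ aᵏ vˡ⁻ⁱ` of `Z` are compared with `s`, using that
  `v s = s v'` with an atom `v'` covers `s` and that `v²` does not occur in simple elements. It follows
  that, up to decycling, sliding and conjugation by `δ`, the element `Z ^ s` arises from `Z` by
  exchanging the factor `B` of `R` for another simple element and `v` for another atom
  (`IsPresentation.next_iota_mem_good`, `IsPresentation.iterate_slide_mem_good`).
-/

namespace GarsideStructure

variable {G : Type*} [Group G] {Γ : GarsideStructure G}

/-! ### The prefix order -/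

theorem prefix_refl (a : G) : Γ.Prefix a a := by
  simp [Prefix, Γ.pos.one_mem]

theorem Prefix.trans {a b c : G} (h₁ : Γ.Prefix a b) (h₂ : Γ.Prefix b c) : Γ.Prefix a c := by
  have := Γ.pos.mul_mem h₁ h₂
  simpa [Prefix, mul_assoc] using this

theorem Prefix.antisymm {a b : G} (h₁ : Γ.Prefix a b) (h₂ : Γ.Prefix b a) : a = b := by
  have := Γ.eq_one_of_inv_mem _ h₁ (by simpa [Prefix] using h₂)
  exact inv_mul_eq_one.mp this

theorem prefix_mul_left_iff {g a b : G} : Γ.Prefix (g * a) (g * b) ↔ Γ.Prefix a b := by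
  simp [Prefix, mul_assoc]

theorem Prefix.mul_left {a b : G} (h : Γ.Prefix a b) (g : G) : Γ.Prefix (g * a) (g * b) :=
  prefix_mul_left_iff.mpr h

theorem prefix_iff_mul {a b c : G} : Γ.Prefix (a * b) c ↔ Γ.Prefix b (a⁻¹ * c) := by
  simp [Prefix, mul_assoc]

theorem prefix_inv_mul_iff {a b c : G} : Γ.Prefix (a⁻¹ * b) c ↔ Γ.Prefix b (a * c) := by
  simp [Prefix, mul_assoc]

theorem one_prefix {a : G} : Γ.Prefix 1 a ↔ a ∈ Γ.pos := by
  simp [Prefix]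

theorem prefix_mul_right {a b : G} (hb : b ∈ Γ.pos) : Γ.Prefix a (a * b) := by
  simpa [Prefix] using hb

theorem Prefix.exists_mul {a b : G} (h : Γ.Prefix a b) : ∃ c ∈ Γ.pos, b = a * c :=
  ⟨a⁻¹ * b, h, by simp⟩

theorem eq_one_of_prefix_one {a : G} (ha : a ∈ Γ.pos) (h : Γ.Prefix a 1) : a = 1 :=
  h.antisymm (one_prefix.mpr ha)

theorem eq_one_of_mul_eq_one {a b : G} (ha : a ∈ Γ.pos) (hb : b ∈ Γ.pos) (h : a * b = 1) :
    a = 1 :=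
  eq_one_of_prefix_one ha (h ▸ prefix_mul_right hb)

theorem one_prefix_delta : Γ.Prefix 1 Γ.delta := one_prefix.mpr Γ.delta_mem

/-! ### Greatest common divisors -/

theorem prefix_gcd_iff {t a b : G} : Γ.Prefix t (Γ.gcd a b) ↔ Γ.Prefix t a ∧ Γ.Prefix t b := by
  obtain ⟨h₁, h₂, h₃⟩ := (Γ.exists_gcd a b).choose_spec
  exact ⟨fun h => ⟨h.trans h₁, h.trans h₂⟩, fun h => h₃ t h.1 h.2⟩

theorem gcd_prefix_left (a b : G) : Γ.Prefix (Γ.gcd a b) a :=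
  (prefix_gcd_iff.mp (prefix_refl _)).1

theorem gcd_prefix_right (a b : G) : Γ.Prefix (Γ.gcd a b) b :=
  (prefix_gcd_iff.mp (prefix_refl _)).2

theorem eq_of_prefix_iff {a b : G} (h : ∀ t, Γ.Prefix t a ↔ Γ.Prefix t b) : a = b :=
  ((h a).mp (prefix_refl a)).antisymm ((h b).mpr (prefix_refl b))

theorem eq_gcd_of_forall {a b c : G} (h : ∀ t, Γ.Prefix t c ↔ Γ.Prefix t a ∧ Γ.Prefix t b) :
    c = Γ.gcd a b :=
  eq_of_prefix_iff fun t => (h t).trans prefix_gcd_iff.symm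

theorem gcd_mem_pos {a b : G} (ha : a ∈ Γ.pos) (hb : b ∈ Γ.pos) : Γ.gcd a b ∈ Γ.pos :=
  one_prefix.mp (prefix_gcd_iff.mpr ⟨one_prefix.mpr ha, one_prefix.mpr hb⟩)

theorem mul_gcd (g a b : G) : g * Γ.gcd a b = Γ.gcd (g * a) (g * b) :=
  eq_gcd_of_forall fun t => by
    have e : ∀ c : G, Γ.Prefix t (g * c) ↔ Γ.Prefix (g⁻¹ * t) c := fun c =>
      prefix_inv_mul_iff.symm
    rw [e, e, e, prefix_gcd_iff]

theorem gcd_comm (a b : G) : Γ.gcd a b = Γ.gcd b a :=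
  eq_gcd_of_forall fun t => by rw [prefix_gcd_iff, and_comm]

theorem gcd_eq_left_iff {a b : G} : Γ.gcd a b = a ↔ Γ.Prefix a b :=
  ⟨fun h => h ▸ gcd_prefix_right a b, fun h =>
    (gcd_prefix_left a b).antisymm (prefix_gcd_iff.mpr ⟨prefix_refl a, h⟩)⟩

/-- Multiplying by a positive element on the left, only the simple part of the right factor
matters for divisibility by elements below `c`, if `c ≼ D c`. -/
theorem gcd_mul_gcd {D Q c : G} (hD : Γ.Prefix c (D * c)) :
    Γ.gcd (D * Γ.gcd Q c) c = Γ.gcd (D * Q) c := by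
  refine eq_gcd_of_forall fun t => ?_
  rw [mul_gcd, prefix_gcd_iff, prefix_gcd_iff]
  exact ⟨fun h => ⟨h.1.1, h.2⟩, fun h => ⟨⟨h.1, h.2.trans hD⟩, h.2⟩⟩

/-! ### Letter length -/

/-- The hypotheses on the Garside structure under which the conjugacy results hold: it is of
finite type, symmetric and homogeneous. -/
structure IsTame (Γ : GarsideStructure G) : Prop where
  finite : Γ.IsFiniteType
  symm : Γ.IsSymmetric
  homog : Γ.IsHomogeneous

theorem IsTame.norm_one (h : Γ.IsTame) : Γ.norm 1 = 0 := by
  have := h.homog 1 Γ.pos.one_mem 1 Γ.pos.one_mem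
  simp only [mul_one] at this
  omega

theorem norm_pos_of_ne_one {a : G} (ha : a ∈ Γ.pos) (h1 : a ≠ 1) : 0 < Γ.norm a := by
  have : 1 ≤ Γ.norm a := le_csSup (Γ.bddAbove_length a ha h1)
    ⟨[a], by simp, by simpa using ⟨ha, h1⟩, by simp⟩
  exact this

theorem eq_one_of_norm {a : G} (ha : a ∈ Γ.pos) (h0 : Γ.norm a = 0) :
    a = 1 := by
  by_contra h1
  have := norm_pos_of_ne_one ha h1
  omega

theorem list_prod_mem_pos {L : List G} (hL : ∀ b ∈ L, b ∈ Γ.pos) : L.prod ∈ Γ.pos :=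
  Submonoid.list_prod_mem _ hL

theorem norm_atom {a : G} (ha : a ∈ Γ.atoms) : Γ.norm a = 1 := by
  refine le_antisymm ?_ (norm_pos_of_ne_one ha.1 ha.2.1)
  refine csSup_le ⟨1, [a], by simp, by simpa using ⟨ha.1, ha.2.1⟩, by simp⟩ ?_
  rintro m ⟨L, rfl, hL, hp⟩
  match L, hL, hp with
  | [], _, _ => simp
  | [b], _, _ => simp
  | b :: c :: L, hL, hp =>
    exfalso
    have hb := hL b (by simp)
    have hc := hL c (by simp)
    have hr : L.prod ∈ Γ.pos := list_prod_mem_pos fun d hd => (hL d (by simp [hd])).1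
    rcases ha.2.2 b hb.1 (c * L.prod) (Γ.pos.mul_mem hc.1 hr) (by simp [← hp]) with h | h
    · exact hb.2 h
    · exact hc.2 (eq_one_of_mul_eq_one hc.1 hr h)

theorem IsTame.mem_atoms_iff (h : Γ.IsTame) {a : G} (ha : a ∈ Γ.pos) :
    a ∈ Γ.atoms ↔ Γ.norm a = 1 := by
  refine ⟨norm_atom, fun h1 => ⟨ha, fun h0 => ?_, fun b hb c hc hbc => ?_⟩⟩
  · rw [h0, h.norm_one] at h1
    omega
  · have := h.homog b hb c hc
    rw [← hbc, h1] at this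
    rcases Nat.eq_zero_or_pos (Γ.norm b) with h0 | h0
    · exact Or.inl (eq_one_of_norm hb h0)
    · exact Or.inr (eq_one_of_norm hc (by omega))

theorem prefix_atom {t a : G} (ha : a ∈ Γ.atoms) (ht : t ∈ Γ.pos) (h : Γ.Prefix t a) :
    t = 1 ∨ t = a := by
  obtain ⟨c, hc, rfl⟩ := h.exists_mul
  rcases ha.2.2 t ht c hc rfl with h | h
  · exact Or.inl h
  · exact Or.inr (by simp [h])

theorem gcd_atom_eq_one {a b : G} (ha : a ∈ Γ.atoms) (hb : b ∈ Γ.pos) (h : ¬ Γ.Prefix a b) :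
    Γ.gcd b a = 1 := by
  rcases prefix_atom ha (gcd_mem_pos hb ha.1) (gcd_prefix_right b a) with h1 | h1
  · exact h1
  · exact absurd (h1 ▸ gcd_prefix_left b a) h

theorem IsTame.eq_of_prefix_of_norm (h : Γ.IsTame) {a b : G} (ha : a ∈ Γ.pos)
    (hab : Γ.Prefix a b) (hn : Γ.norm b ≤ Γ.norm a) : a = b := by
  obtain ⟨c, hc, rfl⟩ := hab.exists_mul
  have := h.homog a ha c hc
  rw [eq_one_of_norm hc (by omega), mul_one]

theorem IsTame.norm_lt (h : Γ.IsTame) {a b : G} (ha : a ∈ Γ.pos) (hab : Γ.Prefix a b)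
    (hne : a ≠ b) : Γ.norm a < Γ.norm b := by
  by_contra hn
  exact hne (h.eq_of_prefix_of_norm ha hab (by omega))

/-! ### Conjugation by powers of the Garside element -/

theorem mem_simples_iff {a : G} : a ∈ Γ.simples ↔ a ∈ Γ.pos ∧ Γ.Prefix a Γ.delta := by
  simp [simples, one_prefix]

theorem conj_delta_mem_simples {a : G} (ha : a ∈ Γ.simples) :
    Γ.delta⁻¹ * a * Γ.delta ∈ Γ.simples := by
  rw [mem_simples_iff] at ha ⊢
  refine ⟨Γ.conj_delta_mem a ha.1, ?_⟩
  have := Γ.conj_delta_mem _ ha.2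
  simpa [Prefix, mul_assoc] using this

/-- Conjugation by `δ` permutes the finitely many simple elements, which generate `G`; so some
power of `δ` is central. -/
theorem IsTame.exists_central_pow (h : Γ.IsTame) :
    ∃ n : ℕ, 0 < n ∧ ∀ g : G, g * Γ.delta ^ n = Γ.delta ^ n * g := by
  have : Finite Γ.simples := h.finite
  let f : Γ.simples → Γ.simples := fun a => ⟨_, conj_delta_mem_simples a.2⟩
  have hf : Function.Injective f := by
    intro a b hab
    have := congrArg Subtype.val hab
    simp only [f, mul_left_inj, mul_right_inj] at this
    exact Subtype.ext this
  obtain ⟨n, hn, he⟩ := (isOfFinOrder_iff_pow_eq_one.mp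
    (isOfFinOrder_of_finite (Equiv.ofBijective f (Finite.injective_iff_bijective.mp hf))))
  have key : ∀ (m : ℕ) (a : Γ.simples),
      (((Equiv.ofBijective f (Finite.injective_iff_bijective.mp hf)) ^ m) a : G) =
        (Γ.delta ^ m)⁻¹ * a * Γ.delta ^ m := by
    intro m
    induction m with
    | zero => simp
    | succ m ih =>
      intro a
      rw [pow_succ', Equiv.Perm.mul_apply]
      change Γ.delta⁻¹ * _ * Γ.delta = _
      rw [ih, pow_succ]
      group
  refine ⟨n, hn, ?_⟩
  have hc : Subgroup.closure {a : G | a ∈ Γ.pos ∧ a⁻¹ * Γ.delta ∈ Γ.pos} ≤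
      Subgroup.centralizer {Γ.delta ^ n} := by
    rw [Subgroup.closure_le]
    intro a ha
    have hs : a ∈ Γ.simples := mem_simples_iff.mpr ha
    have := key n ⟨a, hs⟩
    rw [he] at this
    rw [SetLike.mem_coe, Subgroup.mem_centralizer_singleton_iff]
    simp only [Equiv.Perm.coe_one, id_eq] at this
    calc a * Γ.delta ^ n = Γ.delta ^ n * ((Γ.delta ^ n)⁻¹ * a * Γ.delta ^ n) := by group
      _ = Γ.delta ^ n * a := by rw [← this]
  intro g
  have hg : g ∈ Subgroup.centralizer {Γ.delta ^ n} := hc (Γ.closure_simple ▸ Subgroup.mem_top g)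
  exact Subgroup.mem_centralizer_singleton_iff.mp hg

theorem conj_pow_mem (m : ℕ) {a : G} (ha : a ∈ Γ.pos) :
    (Γ.delta ^ m)⁻¹ * a * Γ.delta ^ m ∈ Γ.pos := by
  induction m with
  | zero => simpa using ha
  | succ m ih =>
    have := Γ.conj_delta_mem _ ih
    rw [pow_succ]
    simpa [mul_assoc] using this

/-- Conjugation by every power of `δ`, also a negative one, preserves positivity: a negative power
can be made positive by a central power of `δ`. -/
theorem IsTame.conj_zpow_mem (h : Γ.IsTame) (m : ℤ) {a : G} (ha : a ∈ Γ.pos) :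
    (Γ.delta ^ m)⁻¹ * a * Γ.delta ^ m ∈ Γ.pos := by
  obtain ⟨n, hn, hc⟩ := h.exists_central_pow
  have hcm : ∀ (j : ℤ) (g : G), g * (Γ.delta ^ n) ^ j = (Γ.delta ^ n) ^ j * g :=
    fun j g => ((show Commute g (Γ.delta ^ n) from hc g).zpow_right j).eq
  have hm : m + n * |m| = ((m + n * |m|).toNat : ℤ) := by
    rw [Int.toNat_of_nonneg]
    have : |m| ≤ n * |m| := by nlinarith [abs_nonneg m]
    linarith [neg_abs_le m]
  have := conj_pow_mem (m + n * |m|).toNat ha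
  rw [← zpow_natCast, ← hm, zpow_add, zpow_mul, zpow_natCast] at this
  convert this using 1
  have e := hcm |m| ((Γ.delta ^ m)⁻¹ * a * Γ.delta ^ m)
  calc (Γ.delta ^ m)⁻¹ * a * Γ.delta ^ m
      = ((Γ.delta ^ n) ^ |m|)⁻¹ * ((Γ.delta ^ n) ^ |m| * ((Γ.delta ^ m)⁻¹ * a * Γ.delta ^ m)) := by
        group
    _ = _ := by rw [← e]; group

theorem IsTame.conj_zpow_mem_iff (h : Γ.IsTame) (m : ℤ) {a : G} :
    (Γ.delta ^ m)⁻¹ * a * Γ.delta ^ m ∈ Γ.pos ↔ a ∈ Γ.pos := by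
  refine ⟨fun ha => ?_, h.conj_zpow_mem m⟩
  have := h.conj_zpow_mem (-m) ha
  simpa [mul_assoc] using this

/-- Multiplication by `δᵐ` on the right preserves the prefix order, which is a priori only invariant
on the left. -/
theorem IsTame.prefix_mul_zpow_iff (h : Γ.IsTame) (m : ℤ) {a b : G} :
    Γ.Prefix (a * Γ.delta ^ m) (b * Γ.delta ^ m) ↔ Γ.Prefix a b := by
  rw [Prefix, Prefix, ← h.conj_zpow_mem_iff m (a := a⁻¹ * b)]
  simp [mul_assoc]

theorem IsTame.prefix_mul_delta_iff (h : Γ.IsTame) {a b : G} :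
    Γ.Prefix (a * Γ.delta) (b * Γ.delta) ↔ Γ.Prefix a b := by
  simpa using h.prefix_mul_zpow_iff 1 (a := a) (b := b)

theorem IsTame.gcd_mul_zpow (h : Γ.IsTame) (m : ℤ) (a b : G) :
    Γ.gcd a b * Γ.delta ^ m = Γ.gcd (a * Γ.delta ^ m) (b * Γ.delta ^ m) :=
  eq_gcd_of_forall fun t => by
    have e : ∀ c : G, Γ.Prefix t (c * Γ.delta ^ m) ↔ Γ.Prefix (t * Γ.delta ^ (-m)) c :=
      fun c => by
        rw [← h.prefix_mul_zpow_iff m (b := c)]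
        simp
    rw [e, e, e, prefix_gcd_iff]

theorem IsTame.gcd_mul_delta (h : Γ.IsTame) (a b : G) :
    Γ.gcd a b * Γ.delta = Γ.gcd (a * Γ.delta) (b * Γ.delta) := by
  simpa using h.gcd_mul_zpow 1 a b

theorem zpow_mem_pos {n : ℤ} (hn : 0 ≤ n) : Γ.delta ^ n ∈ Γ.pos := by
  lift n to ℕ using hn
  rw [zpow_natCast]
  exact Γ.pos.pow_mem Γ.delta_mem n

theorem zpow_prefix_zpow {m n : ℤ} (hmn : m ≤ n) : Γ.Prefix (Γ.delta ^ m) (Γ.delta ^ n) := by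
  rw [Prefix, ← zpow_neg, ← zpow_add]
  exact zpow_mem_pos (by omega)

/-- `δᵐ` divides `a` on the left if and only if it does so on the right. -/
theorem IsTame.zpow_prefix_iff (h : Γ.IsTame) {m : ℤ} {a : G} :
    Γ.Prefix (Γ.delta ^ m) a ↔ a * Γ.delta ^ (-m) ∈ Γ.pos := by
  rw [← h.conj_zpow_mem_iff m, Prefix]
  simp [mul_assoc]

theorem IsTame.zpow_prefix_iff_prefix (h : Γ.IsTame) {m : ℤ} {a b : G} :
    Γ.Prefix (b * Γ.delta ^ m) a ↔ Γ.Prefix b (a * Γ.delta ^ (-m)) := by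
  rw [← h.prefix_mul_zpow_iff m (a := b)]
  simp

theorem IsTame.prefix_zpow_iff (h : Γ.IsTame) {m : ℤ} {a : G} :
    Γ.Prefix a (Γ.delta ^ m) ↔ Γ.Prefix (Γ.delta ^ (-m)) a⁻¹ := by
  rw [h.zpow_prefix_iff, Prefix, neg_neg]

theorem IsTame.delta_prefix_mul_delta (h : Γ.IsTame) {D : G} (hD : D ∈ Γ.pos) (m : ℤ) :
    Γ.Prefix (Γ.delta ^ m) (D * Γ.delta ^ m) := by
  simpa using (h.prefix_mul_zpow_iff m (a := 1) (b := D)).mpr (one_prefix.mpr hD)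

theorem IsTame.gcd_mul_gcd_delta (h : Γ.IsTame) {D : G} (hD : D ∈ Γ.pos) (Q : G) :
    Γ.gcd (D * Γ.gcd Q Γ.delta) Γ.delta = Γ.gcd (D * Q) Γ.delta :=
  gcd_mul_gcd (by simpa using h.delta_prefix_mul_delta hD 1)

/-- Every element lies between two powers of `δ`. -/
theorem IsTame.exists_bounds (h : Γ.IsTame) (g : G) :
    ∃ m : ℕ, Γ.Prefix (Γ.delta ^ (-(m : ℤ))) g ∧ Γ.Prefix g (Γ.delta ^ (m : ℤ)) := by
  have hg : g ∈ Subgroup.closure {a : G | a ∈ Γ.pos ∧ a⁻¹ * Γ.delta ∈ Γ.pos} :=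
    Γ.closure_simple ▸ Subgroup.mem_top g
  induction hg using Subgroup.closure_induction with
  | mem a ha =>
    refine ⟨1, ?_, by simpa [Prefix] using ha.2⟩
    rw [h.zpow_prefix_iff]
    simpa using Γ.pos.mul_mem ha.1 Γ.delta_mem
  | one => exact ⟨0, by simp [prefix_refl], by simp [prefix_refl]⟩
  | mul a b _ _ iha ihb =>
    obtain ⟨m, hm₁, hm₂⟩ := iha
    obtain ⟨n, hn₁, hn₂⟩ := ihb
    refine ⟨m + n, ?_, ?_⟩
    · have h1 := (h.prefix_mul_zpow_iff (-n)).mpr hm₁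
      rw [← zpow_add] at h1
      have := h1.trans (hn₁.mul_left a)
      convert this using 2
      push_cast
      ring
    · have h1 := (h.prefix_mul_zpow_iff n).mpr hm₂
      rw [← zpow_add] at h1
      exact_mod_cast (hn₂.mul_left a).trans h1
  | inv a _ iha =>
    obtain ⟨m, hm₁, hm₂⟩ := iha
    refine ⟨m, h.prefix_zpow_iff.mp hm₂, ?_⟩
    rw [h.prefix_zpow_iff]
    simpa using hm₁

/-! ### Simple elements -/

/-- Removing the simple part of a prefix of `δᵐ` leaves a prefix of `δᵐ⁻¹`. -/
theorem IsTame.gcd_inv_mul_prefix (h : Γ.IsTame) {a : G} {m : ℤ} (hm : 1 ≤ m)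
    (ha : Γ.Prefix a (Γ.delta ^ m)) :
    Γ.Prefix ((Γ.gcd a Γ.delta)⁻¹ * a) (Γ.delta ^ (m - 1)) := by
  rw [prefix_inv_mul_iff, h.gcd_mul_zpow, prefix_gcd_iff]
  refine ⟨?_, ?_⟩
  · simpa using (zpow_mem_pos (Γ := Γ) (n := m - 1) (by omega)) |> prefix_mul_right (a := a)
  · rwa [← zpow_one_add, add_sub_cancel]

theorem IsTame.gcd_delta_ne_one (h : Γ.IsTame) {a : G} (ha : a ∈ Γ.pos) (h1 : a ≠ 1) :
    Γ.gcd a Γ.delta ≠ 1 := by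
  intro hg
  have : ∀ m : ℕ, ¬ Γ.Prefix a (Γ.delta ^ (m : ℤ)) := by
    intro m
    induction m with
    | zero => exact fun h0 => h1 (eq_one_of_prefix_one ha (by simpa using h0))
    | succ m ih =>
      intro h2
      apply ih
      have := h.gcd_inv_mul_prefix (by omega) h2
      simpa [hg] using this
  obtain ⟨m, -, hm⟩ := h.exists_bounds a
  exact this m hm

theorem IsTame.atom_mem_simples (h : Γ.IsTame) {a : G} (ha : a ∈ Γ.atoms) : a ∈ Γ.simples := by
  rw [mem_simples_iff]
  refine ⟨ha.1, ?_⟩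
  rcases prefix_atom ha (gcd_mem_pos ha.1 Γ.delta_mem) (gcd_prefix_left _ _) with h1 | h1
  · exact absurd h1 (h.gcd_delta_ne_one ha.1 ha.2.1)
  · exact h1 ▸ gcd_prefix_right a Γ.delta

theorem IsTame.suffix_simple (h : Γ.IsTame) {a s : G} (ha : a ∈ Γ.pos)
    (has : Γ.Prefix (a * s) Γ.delta) : Γ.Prefix s Γ.delta := by
  rw [prefix_iff_mul] at has
  refine has.trans ?_
  rw [prefix_inv_mul_iff]
  simpa using h.delta_prefix_mul_delta ha 1

theorem prefix_delta_of_mul {a s : G} (hs : s ∈ Γ.pos) (has : Γ.Prefix (a * s) Γ.delta) :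
    Γ.Prefix a Γ.delta :=
  (prefix_mul_right hs).trans has

/-- In a symmetric structure a suffix of a simple element is also a prefix of it. -/
theorem IsTame.exists_swap (h : Γ.IsTame) {a s : G} (ha : a ∈ Γ.pos) (hs : s ∈ Γ.pos)
    (has : Γ.Prefix (a * s) Γ.delta) : ∃ a' ∈ Γ.pos, a * s = s * a' := by
  have h1 : s ∈ Γ.simples := mem_simples_iff.mpr ⟨hs, h.suffix_simple ha has⟩
  have h2 : a * s ∈ Γ.simples := mem_simples_iff.mpr ⟨Γ.pos.mul_mem ha hs, has⟩
  have h3 : Γ.Prefix s (a * s) := (h.symm s h1 _ h2).mpr (by simpa [Suffix] using ha)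
  exact h3.exists_mul

theorem IsTame.exists_swap_left (h : Γ.IsTame) {a s : G} (ha : a ∈ Γ.pos) (hs : s ∈ Γ.pos)
    (has : Γ.Prefix (a * s) Γ.delta) : ∃ s' ∈ Γ.pos, a * s = s' * a := by
  have h1 : a ∈ Γ.simples := mem_simples_iff.mpr ⟨ha, prefix_delta_of_mul hs has⟩
  have h2 : a * s ∈ Γ.simples := mem_simples_iff.mpr ⟨Γ.pos.mul_mem ha hs, has⟩
  have h3 : Γ.Suffix (a * s) a := (h.symm a h1 _ h2).mp (prefix_mul_right hs)
  exact ⟨_, h3, by simp⟩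

/-- If `a s` is simple for an atom `a`, then `s⁻¹ a s` is an atom. -/
theorem IsTame.conj_atom (h : Γ.IsTame) {a s : G} (ha : a ∈ Γ.atoms) (hs : s ∈ Γ.pos)
    (has : Γ.Prefix (a * s) Γ.delta) : s⁻¹ * a * s ∈ Γ.atoms := by
  obtain ⟨a', ha', he⟩ := h.exists_swap ha.1 hs has
  have h1 : s⁻¹ * a * s = a' := by rw [mul_assoc, he]; simp
  rw [h1, h.mem_atoms_iff ha']
  have h2 := h.homog a ha.1 s hs
  rw [he, h.homog s hs a' ha', norm_atom ha] at h2
  omega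

/-- If `s a` is simple for an atom `a`, then `s a s⁻¹` is an atom. -/
theorem IsTame.conj_atom_left (h : Γ.IsTame) {a s : G} (ha : a ∈ Γ.atoms) (hs : s ∈ Γ.pos)
    (has : Γ.Prefix (s * a) Γ.delta) : s * a * s⁻¹ ∈ Γ.atoms := by
  obtain ⟨a', ha', he⟩ := h.exists_swap_left hs ha.1 has
  have h1 : s * a * s⁻¹ = a' := by rw [he]; simp
  rw [h1, h.mem_atoms_iff ha']
  have h2 := h.homog s hs a ha.1
  rw [he, h.homog a' ha' s hs, norm_atom ha] at h2
  omega

theorem IsTame.conj_atom_zpow (h : Γ.IsTame) {a : G} (ha : a ∈ Γ.atoms) (m : ℤ) :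
    (Γ.delta ^ m)⁻¹ * a * Γ.delta ^ m ∈ Γ.atoms := by
  have key : ∀ (m : ℤ) (b : G), (Γ.delta ^ m)⁻¹ * b * Γ.delta ^ m = 1 → b = 1 := by
    intro m b hb
    have : b = Γ.delta ^ m * ((Γ.delta ^ m)⁻¹ * b * Γ.delta ^ m) * (Γ.delta ^ m)⁻¹ := by group
    rw [this, hb]
    simp
  refine ⟨h.conj_zpow_mem m ha.1, fun h1 => ha.2.1 (key m a h1), fun b hb c hc hbc => ?_⟩
  have hb' := h.conj_zpow_mem (-m) hb
  have hc' := h.conj_zpow_mem (-m) hc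
  have : a = ((Γ.delta ^ (-m))⁻¹ * b * Γ.delta ^ (-m)) * ((Γ.delta ^ (-m))⁻¹ * c * Γ.delta ^ (-m))
      := by
    calc a = Γ.delta ^ m * ((Γ.delta ^ m)⁻¹ * a * Γ.delta ^ m) * (Γ.delta ^ m)⁻¹ := by group
      _ = _ := by rw [hbc]; group
  rcases ha.2.2 _ hb' _ hc' this with h1 | h1
  · exact Or.inl (key _ _ h1)
  · exact Or.inr (key _ _ h1)

/-- If `y s = s z` with `z` an atom, then `s` is covered by `y s`. Hence any upper bound of `s`
and of another element `q ≼ y s`, `q ⋠ s`, is an upper bound of `y s`. -/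
theorem prefix_of_cover {s z q c : G} (hz : z ∈ Γ.atoms) (hq : Γ.Prefix q (s * z))
    (hqs : ¬ Γ.Prefix q s) (hsc : Γ.Prefix s c) (hqc : Γ.Prefix q c) :
    Γ.Prefix (s * z) c := by
  have h1 : Γ.Prefix s (Γ.gcd (s * z) c) := prefix_gcd_iff.mpr ⟨prefix_mul_right hz.1, hsc⟩
  obtain ⟨e, he, heq⟩ := h1.exists_mul
  have h2 : Γ.Prefix e z := by
    rw [← prefix_mul_left_iff (g := s), ← heq]
    exact gcd_prefix_left _ _
  rcases prefix_atom hz he h2 with rfl | rfl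
  · exact absurd (by simpa [heq] using prefix_gcd_iff.mpr ⟨hq, hqc⟩) hqs
  · exact heq ▸ gcd_prefix_right _ _

/-- The interval `[1, δⁿ]` is finite. -/
theorem IsTame.finite_interval (h : Γ.IsTame) (n : ℕ) :
    {a : G | a ∈ Γ.pos ∧ Γ.Prefix a (Γ.delta ^ (n : ℤ))}.Finite := by
  induction n with
  | zero =>
    refine (Set.finite_singleton (1 : G)).subset fun a ha => ?_
    exact eq_one_of_prefix_one ha.1 (by simpa using ha.2)
  | succ n ih =>
    refine (h.finite.mul ih).subset fun a ha => ?_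
    refine ⟨Γ.gcd a Γ.delta, ?_, (Γ.gcd a Γ.delta)⁻¹ * a, ⟨gcd_prefix_left _ _, ?_⟩, by simp⟩
    · exact mem_simples_iff.mpr ⟨gcd_mem_pos ha.1 Γ.delta_mem, gcd_prefix_right _ _⟩
    · simpa using h.gcd_inv_mul_prefix (by omega) ha.2

/-! ### Left normal forms -/

theorem leftWeighted_iff {A B : G} :
    Γ.LeftWeighted A B ↔ Γ.gcd B (A⁻¹ * Γ.delta) = 1 := by
  have : Γ.gcd (A * B) Γ.delta = A * Γ.gcd B (A⁻¹ * Γ.delta) := by simp [mul_gcd]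
  rw [LeftWeighted, this, eq_comm, mul_eq_left]

theorem gcd_eq_one_iff {a b : G} (ha : a ∈ Γ.pos) (hb : b ∈ Γ.pos) :
    Γ.gcd a b = 1 ↔ ∀ t ∈ Γ.pos, Γ.Prefix t a → Γ.Prefix t b → t = 1 := by
  refine ⟨fun h t ht h1 h2 => eq_one_of_prefix_one ht (h ▸ prefix_gcd_iff.mpr ⟨h1, h2⟩),
    fun h => h _ (gcd_mem_pos ha hb) (gcd_prefix_left _ _) (gcd_prefix_right _ _)⟩

/-- The first factor of a left weighted product of simple elements is its greatest simple
prefix. -/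
theorem IsTame.gcd_prod_delta (h : Γ.IsTame) (A : G) (L : List G)
    (hs : ∀ B ∈ A :: L, B ∈ Γ.simples) (hc : (A :: L).IsChain Γ.LeftWeighted) :
    Γ.gcd (A :: L).prod Γ.delta = A := by
  induction L generalizing A with
  | nil =>
    have := mem_simples_iff.mp (hs A (by simp))
    simpa using gcd_eq_left_iff.mpr this.2
  | cons B L ih =>
    rw [List.prod_cons, ← h.gcd_mul_gcd_delta (mem_simples_iff.mp (hs A (by simp))).1,
      ih B (fun C hC => hs C (by simp [hC])) (List.isChain_cons_cons.mp hc).2]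
    exact (List.isChain_cons_cons.mp hc).1.symm

/-- The complement of a left weighted product `A₁ ⋯ Aᵣ`, multiplied by a positive `T` with
`A₁ ∧ T = 1`, begins with the complement of the last factor. -/
theorem IsTame.gcd_complement (h : Γ.IsTame) (A : G) (L : List G)
    (hs : ∀ B ∈ A :: L, B ∈ Γ.simples) (hc : (A :: L).IsChain Γ.LeftWeighted)
    {T : G} (hT : T ∈ Γ.pos) (hTA : Γ.gcd T A = 1) :
    Γ.gcd ((A :: L).prod⁻¹ * T * Γ.delta ^ ((A :: L).length : ℤ)) Γ.delta =
      ((A :: L).getLast (by simp))⁻¹ * Γ.delta := by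
  have step : ∀ {A T : G}, Γ.gcd T A = 1 →
      Γ.gcd (A⁻¹ * T * Γ.delta) Γ.delta = A⁻¹ * Γ.delta := by
    intro A T hTA
    have : Γ.delta = A⁻¹ * (A * Γ.delta) := by simp
    conv_lhs => rw [this, ← this, mul_assoc]
    conv_lhs => arg 3; rw [this]
    rw [← mul_gcd, ← h.gcd_mul_delta, hTA, one_mul]
  induction L generalizing A T with
  | nil => simpa using step hTA
  | cons B L ih =>
    have hA := mem_simples_iff.mp (hs A (by simp))
    have hB := mem_simples_iff.mp (hs B (by simp))
    have hT' : A⁻¹ * T * Γ.delta ∈ Γ.pos := by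
      have := Γ.pos.mul_mem hA.2 (Γ.conj_delta_mem T hT)
      simpa [mul_assoc] using this
    have hw := leftWeighted_iff.mp (List.isChain_cons_cons.mp hc).1
    have h1 := ih B (fun C hC => hs C (by simp [hC])) (List.isChain_cons_cons.mp hc).2 hT' (by
      rw [gcd_eq_one_iff hT' hB.1]
      intro t ht h1 h2
      refine eq_one_of_prefix_one ht (hw ▸ prefix_gcd_iff.mpr ⟨h2, ?_⟩)
      rw [← step hTA]
      exact prefix_gcd_iff.mpr ⟨h1, h2.trans hB.2⟩)
    rw [List.getLast_cons (by simp), ← h1, List.prod_cons, List.length_cons]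
    congr 1
    push_cast
    rw [zpow_add_one, mul_inv_rev]
    have : Γ.delta ^ ((B :: L).length : ℤ) * Γ.delta = Γ.delta * Γ.delta ^ ((B :: L).length : ℤ) :=
      ((Commute.refl Γ.delta).zpow_left _).eq
    rw [this]
    simp only [mul_assoc]

/-! ### Cycling, decycling and sliding as lattice operations -/

/-- The initial factor of an element with infimum `p`, as the meet `Y δ⁻ᵖ ∧ δ`. The exponent `p` is
a parameter, not read off from `Y`, so that the operator is uniform in `Y`. -/
noncomputable def iota (Γ : GarsideStructure G) (p : ℤ) (Y : G) : G :=
  Γ.gcd (Y * Γ.delta ^ (-p)) Γ.delta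

/-- The inverse of the final factor of an element with supremum `q`, as the meet `Y⁻¹ δ^(q-1) ∧ 1`. -/
noncomputable def dec (Γ : GarsideStructure G) (q : ℤ) (Y : G) : G :=
  Γ.gcd (Y⁻¹ * Γ.delta ^ (q - 1)) 1

/-- The complement `∂φ(Y) = φ(Y)⁻¹ δ` of the final factor of an element with supremum `q`, as the
meet `Y⁻¹ δ^q ∧ δ`. -/
noncomputable def kappa (Γ : GarsideStructure G) (q : ℤ) (Y : G) : G :=
  Γ.gcd (Y⁻¹ * Γ.delta ^ q) Γ.delta

/-- The preferred prefix of an element with infimum `p` and supremum `q`, as a meet. -/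
noncomputable def slide (Γ : GarsideStructure G) (p q : ℤ) (Y : G) : G :=
  Γ.gcd (Γ.iota p Y) (Γ.kappa q Y)

theorem IsTame.dec_mul_delta (h : Γ.IsTame) (q : ℤ) (Y : G) :
    Γ.dec q Y * Γ.delta = Γ.kappa q Y := by
  rw [dec, kappa, h.gcd_mul_delta, one_mul, mul_assoc, zpow_sub_one]
  simp

theorem IsTame.iota_of_isLeftNormalForm (h : Γ.IsTame) {X : G} {p : ℤ} {L : List G}
    (hX : Γ.IsLeftNormalForm X p L) :
    Γ.iota p X = Γ.delta ^ p * L.headD 1 * Γ.delta ^ (-p) := by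
  obtain ⟨rfl, hs, hc⟩ := hX
  have e : Γ.iota p (Γ.delta ^ p * L.prod) =
      Γ.delta ^ p * Γ.gcd L.prod Γ.delta * Γ.delta ^ (-p) := by
    rw [mul_gcd, h.gcd_mul_zpow, iota]
    congr 1
    group
  rw [e]
  match L, hs, hc with
  | [], _, _ => simp [gcd_eq_left_iff.mpr one_prefix_delta]
  | A :: L, hs, hc => rw [h.gcd_prod_delta A L (fun B hB => (hs B hB).1) hc]; simp

theorem IsTame.dec_of_isLeftNormalForm (h : Γ.IsTame) {X : G} {p : ℤ} {L : List G}
    (hX : Γ.IsLeftNormalForm X p L) :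
    Γ.dec (p + L.length) X = (L.getLastD Γ.delta)⁻¹ := by
  rw [eq_comm, inv_eq_iff_mul_eq_one, ← mul_left_inj Γ.delta, mul_assoc, h.dec_mul_delta]
  obtain ⟨rfl, hs, hc⟩ := hX
  rw [kappa]
  have e : (Γ.delta ^ p * L.prod)⁻¹ * Γ.delta ^ (p + (L.length : ℤ)) =
      L.prod⁻¹ * 1 * Γ.delta ^ (L.length : ℤ) := by
    rw [zpow_add]; group
  rw [e]
  match L, hs, hc with
  | [], _, _ => simp [gcd_eq_left_iff.mpr one_prefix_delta]
  | A :: L, hs, hc =>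
    have hA := mem_simples_iff.mp (hs A (by simp)).1
    rw [h.gcd_complement A L (fun B hB => (hs B hB).1) hc Γ.pos.one_mem
      (gcd_eq_left_iff.mpr (one_prefix.mpr hA.1))]
    rw [List.getLastD_eq_getLast?, List.getLast?_eq_getLast_of_ne_nil (by simp)]
    simp

theorem IsTame.prefix_lnf_iff (h : Γ.IsTame) (hδ : Γ.delta ≠ 1) {X : G} {p : ℤ} {L : List G}
    (hX : Γ.IsLeftNormalForm X p L) {m : ℤ} : Γ.Prefix (Γ.delta ^ m) X ↔ m ≤ p := by
  constructor
  · intro hm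
    by_contra hlt
    have h1 : Γ.Prefix (Γ.delta ^ (p + 1)) X :=
      (zpow_prefix_zpow (by omega)).trans hm
    have h2 : Γ.iota p X = Γ.delta := by
      rw [iota, gcd_comm, gcd_eq_left_iff, ← h.zpow_prefix_iff_prefix, ← zpow_one_add, add_comm]
      exact h1
    rw [h.iota_of_isLeftNormalForm hX] at h2
    have h3 : L.headD 1 = Γ.delta := by
      have : L.headD 1 = Γ.delta ^ (-p) * (Γ.delta ^ p * L.headD 1 * Γ.delta ^ (-p)) * Γ.delta ^ p := by
        group
      rw [this, h2]
      group
    cases L with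
    | nil => exact hδ h3.symm
    | cons A L => exact (hX.2.1 A (by simp)).2.2 (by simpa using h3)
  · intro hm
    refine (zpow_prefix_zpow hm).trans ?_
    rw [hX.1]
    exact prefix_mul_right (list_prod_mem_pos fun b hb => (mem_simples_iff.mp (hX.2.1 b hb).1).1)

theorem prod_prefix_delta_pow (h : Γ.IsTame) {L : List G} (hL : ∀ B ∈ L, B ∈ Γ.simples) :
    Γ.Prefix L.prod (Γ.delta ^ (L.length : ℤ)) := by
  induction L with
  | nil => simp [prefix_refl]
  | cons A L ih =>
    have h1 := (ih fun B hB => hL B (by simp [hB])).mul_left A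
    have h2 := (h.prefix_mul_zpow_iff (L.length : ℤ)).mpr (mem_simples_iff.mp (hL A (by simp))).2
    rw [← zpow_one_add] at h2
    rw [List.prod_cons, List.length_cons]
    push_cast
    rw [add_comm]
    exact h1.trans h2

theorem IsTame.lnf_prefix_iff (h : Γ.IsTame) {X : G} {p : ℤ} {L : List G}
    (hX : Γ.IsLeftNormalForm X p L) (hδ : Γ.delta ≠ 1) {m : ℤ} :
    Γ.Prefix X (Γ.delta ^ m) ↔ p + L.length ≤ m := by
  constructor
  · intro hm
    by_contra hlt
    have h1 : Γ.Prefix X (Γ.delta ^ (p + L.length - 1)) := hm.trans (zpow_prefix_zpow (by omega))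
    have h2 : Γ.dec (p + L.length) X = 1 := by
      rw [dec, gcd_comm, gcd_eq_left_iff, one_prefix]
      exact h1
    rw [h.dec_of_isLeftNormalForm hX, inv_eq_one] at h2
    rcases List.eq_nil_or_concat L with rfl | ⟨L', A, rfl⟩
    · exact hδ (by simpa using h2)
    · exact (hX.2.1 A (by simp)).2.1 (by simpa using h2)
  · intro hm
    refine Prefix.trans ?_ (zpow_prefix_zpow hm)
    rw [hX.1, zpow_add]
    exact (prod_prefix_delta_pow h fun B hB => (hX.2.1 B hB).1).mul_left _

theorem IsTame.exists_chain (h : Γ.IsTame) {W : G} (hW : W ∈ Γ.pos) :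
    ∃ L : List G, (∀ A ∈ L, A ∈ Γ.simples ∧ A ≠ 1) ∧ L.IsChain Γ.LeftWeighted ∧ L.prod = W := by
  induction hn : Γ.norm W using Nat.strong_induction_on generalizing W with
  | _ n ih =>
  by_cases h1 : W = 1
  · exact ⟨[], by simp, by simp, by simp [h1]⟩
  have hA := gcd_mem_pos hW Γ.delta_mem
  obtain ⟨V, hV, hWV⟩ := (gcd_prefix_left W Γ.delta).exists_mul
  have hAs : Γ.gcd W Γ.delta ∈ Γ.simples := mem_simples_iff.mpr ⟨hA, gcd_prefix_right _ _⟩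
  have hA1 := h.gcd_delta_ne_one hW h1
  have hlt : Γ.norm V < n := by
    have := h.homog _ hA _ hV
    have := norm_pos_of_ne_one hA hA1
    rw [← hWV] at *
    omega
  obtain ⟨L, hL, hc, hp⟩ := ih _ hlt hV rfl
  refine ⟨Γ.gcd W Γ.delta :: L, ?_, ?_, ?_⟩
  · rintro B hB
    rcases List.mem_cons.mp hB with rfl | hB
    · exact ⟨hAs, hA1⟩
    · exact hL B hB
  · match L, hL, hc, hp with
    | [], _, _, _ => simp
    | B :: L, hL, hc, hp =>
      refine List.isChain_cons_cons.mpr ⟨?_, hc⟩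
      have h2 := h.gcd_prod_delta B L (fun C hC => (hL C hC).1) hc
      rw [LeftWeighted, ← h2, hp, h.gcd_mul_gcd_delta hA, ← hWV]
  · rw [List.prod_cons, hp, ← hWV]

theorem IsTame.ne_delta_of_chain (h : Γ.IsTame) {A : G} {L : List G}
    (hs : ∀ B ∈ A :: L, B ∈ Γ.simples) (hc : (A :: L).IsChain Γ.LeftWeighted)
    (hA : A ≠ Γ.delta) : ∀ B ∈ A :: L, B ≠ Γ.delta := by
  induction L generalizing A with
  | nil => simpa using hA
  | cons C L ih =>
    have hC : C ≠ Γ.delta := by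
      rintro rfl
      apply hA
      have h1 := (List.isChain_cons_cons.mp hc).1
      rw [LeftWeighted, gcd_comm, gcd_eq_left_iff.mpr] at h1
      · exact h1
      · simpa using h.delta_prefix_mul_delta (mem_simples_iff.mp (hs A (by simp))).1 1
    intro B hB
    rcases List.mem_cons.mp hB with rfl | hB
    · exact hA
    · exact ih (fun D hD => hs D (by simp [hD])) (List.isChain_cons_cons.mp hc).2 hC B hB

theorem IsTame.exists_chain_ne_delta (h : Γ.IsTame) {W : G} (hW : W ∈ Γ.pos)
    (hδ : ¬ Γ.Prefix Γ.delta W) :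
    ∃ L : List G, (∀ A ∈ L, A ∈ Γ.simples ∧ A ≠ 1 ∧ A ≠ Γ.delta) ∧
      L.IsChain Γ.LeftWeighted ∧ L.prod = W := by
  obtain ⟨L, hL, hc, hp⟩ := h.exists_chain hW
  refine ⟨L, ?_, hc, hp⟩
  match L, hL, hc, hp with
  | [], _, _, _ => simp
  | A :: L, hL, hc, hp =>
    have hA : A ≠ Γ.delta := by
      rintro rfl
      apply hδ
      rw [← hp, List.prod_cons]
      exact prefix_mul_right (list_prod_mem_pos fun b hb =>
        (mem_simples_iff.mp (hL b (by simp [hb])).1).1)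
    intro B hB
    exact ⟨(hL B hB).1, (hL B hB).2, h.ne_delta_of_chain (fun C hC => (hL C hC).1) hc hA B hB⟩

theorem IsTame.exists_leftNormalForm (h : Γ.IsTame) (hδ : Γ.delta ≠ 1) (X : G) :
    ∃ q : ℤ × List G, Γ.IsLeftNormalForm X q.1 q.2 := by
  obtain ⟨m, hm₁, hm₂⟩ := h.exists_bounds X
  -- the largest power of `δ` dividing `X`
  obtain ⟨p, hp, hmax⟩ := Int.exists_greatest_of_bdd (P := fun j => Γ.Prefix (Γ.delta ^ j) X)
    ⟨m, fun j hj => by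
      by_contra hlt
      have h1 : Γ.Prefix (Γ.delta ^ j) (Γ.delta ^ (m : ℤ)) := hj.trans hm₂
      have h2 : Γ.Prefix (Γ.delta ^ ((m : ℤ) + 1)) (Γ.delta ^ (m : ℤ)) :=
        (zpow_prefix_zpow (by omega)).trans h1
      rw [zpow_add_one] at h2
      have h3 : Γ.Prefix Γ.delta 1 := by
        rw [← prefix_mul_left_iff (g := Γ.delta ^ (m : ℤ))]
        simpa using h2
      exact hδ (eq_one_of_prefix_one Γ.delta_mem h3)⟩ ⟨-m, hm₁⟩
  obtain ⟨W, hW, hXW⟩ := hp.exists_mul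
  obtain ⟨L, hL, hc, hLp⟩ := h.exists_chain_ne_delta hW (by
    intro hd
    have := hmax (p + 1) (by
      rw [hXW, zpow_add_one]
      exact hd.mul_left _)
    omega)
  exact ⟨(p, L), by rw [hLp, hXW], hL, hc⟩

theorem IsTame.leftNormalForm_spec (h : Γ.IsTame) (hδ : Γ.delta ≠ 1) (X : G) :
    Γ.IsLeftNormalForm X (Γ.leftNormalForm X).1 (Γ.leftNormalForm X).2 := by
  have := h.exists_leftNormalForm hδ X
  rw [leftNormalForm, dif_pos this]
  exact this.choose_spec

/-- The infimum of `X`: the largest `p` with `δᵖ ≼ X`. -/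
noncomputable def inf (Γ : GarsideStructure G) (X : G) : ℤ := (Γ.leftNormalForm X).1

/-- The supremum of `X`: the least `q` with `X ≼ δ^q`. -/
noncomputable def sup (Γ : GarsideStructure G) (X : G) : ℤ :=
  (Γ.leftNormalForm X).1 + (Γ.leftNormalForm X).2.length

theorem IsTame.le_inf_iff (h : Γ.IsTame) (hδ : Γ.delta ≠ 1) {X : G} {m : ℤ} :
    m ≤ Γ.inf X ↔ Γ.Prefix (Γ.delta ^ m) X :=
  (h.prefix_lnf_iff hδ (h.leftNormalForm_spec hδ X)).symm

theorem IsTame.sup_le_iff (h : Γ.IsTame) (hδ : Γ.delta ≠ 1) {X : G} {m : ℤ} :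
    Γ.sup X ≤ m ↔ Γ.Prefix X (Γ.delta ^ m) :=
  (h.lnf_prefix_iff (h.leftNormalForm_spec hδ X) hδ).symm

theorem inf_le_sup (X : G) : Γ.inf X ≤ Γ.sup X := by
  simp [inf, sup]

theorem IsTame.initialFactor_eq (h : Γ.IsTame) (hδ : Γ.delta ≠ 1) (X : G) :
    Γ.initialFactor X = Γ.iota (Γ.inf X) X :=
  (h.iota_of_isLeftNormalForm (h.leftNormalForm_spec hδ X)).symm

theorem IsTame.finalFactor_eq (h : Γ.IsTame) (hδ : Γ.delta ≠ 1) (X : G) :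
    Γ.finalFactor X = (Γ.dec (Γ.sup X) X)⁻¹ := by
  rw [sup, h.dec_of_isLeftNormalForm (h.leftNormalForm_spec hδ X), inv_inv, finalFactor]

theorem IsTame.preferredPrefix_eq (h : Γ.IsTame) (hδ : Γ.delta ≠ 1) (X : G) :
    Γ.preferredPrefix X = Γ.slide (Γ.inf X) (Γ.sup X) X := by
  rw [preferredPrefix, slide, h.initialFactor_eq hδ, h.finalFactor_eq hδ, inv_inv,
    h.dec_mul_delta]

/-! ### Operators given by meets of monomials, and their transports -/

/-- The conjugate `g⁻¹ Y g`. -/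
def cj (Y g : G) : G := g⁻¹ * Y * g

theorem cj_one (Y : G) : cj Y 1 = Y := by simp [cj]

theorem cj_cj (Y a b : G) : cj (cj Y a) b = cj Y (a * b) := by simp [cj, mul_assoc]

theorem cj_inv (Y a : G) : (cj Y a)⁻¹ = cj Y⁻¹ a := by simp [cj, mul_assoc]

theorem cj_mul (Y Z a : G) : cj (Y * Z) a = cj Y a * cj Z a := by simp [cj, mul_assoc]

theorem cj_pow (Y a : G) (k : ℕ) : cj (Y ^ k) a = cj Y a ^ k := by
  have := conj_pow (a := a⁻¹) (b := Y) (i := k)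
  simpa [cj] using this.symm

theorem mul_cj_zpow (Y a : G) (k : ℤ) : a * cj Y a ^ k = Y ^ k * a := by
  have := conj_zpow (a := a⁻¹) (b := Y) (i := k)
  rw [inv_inv] at this
  rw [cj, this]
  group

theorem mem_conjugatesOf_iff_cj {X Y : G} : Y ∈ conjugatesOf X ↔ ∃ g, Y = cj X g := by
  rw [conjugatesOf, Set.mem_ofPred_eq, isConj_iff]
  constructor
  · rintro ⟨c, rfl⟩
    exact ⟨c⁻¹, by simp [cj]⟩
  · rintro ⟨g, rfl⟩
    exact ⟨g⁻¹, by simp [cj]⟩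

theorem cj_mem_conjugatesOf (X g : G) : cj X g ∈ conjugatesOf X :=
  mem_conjugatesOf_iff_cj.mpr ⟨g, rfl⟩

theorem cj_mem_of_mem {X Y : G} (hY : Y ∈ conjugatesOf X) (g : G) : cj Y g ∈ conjugatesOf X := by
  obtain ⟨a, rfl⟩ := mem_conjugatesOf_iff_cj.mp hY
  rw [cj_cj]
  exact cj_mem_conjugatesOf _ _

theorem IsTame.exists_pos_cj (h : Γ.IsTame) {X Y : G} (hY : Y ∈ conjugatesOf X) :
    ∃ g ∈ Γ.pos, Y = cj X g := by
  obtain ⟨g, rfl⟩ := mem_conjugatesOf_iff_cj.mp hY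
  obtain ⟨n, hn, hc⟩ := h.exists_central_pow
  obtain ⟨m, hm, -⟩ := h.exists_bounds g
  have hcm : ∀ (a : G), a * (Γ.delta ^ n) ^ m = (Γ.delta ^ n) ^ m * a :=
    fun a => ((show Commute a (Γ.delta ^ n) from hc a).pow_right m).eq
  refine ⟨g * (Γ.delta ^ n) ^ m, ?_, ?_⟩
  · have h1 := (h.zpow_prefix_iff (m := -(m : ℤ)) (a := g)).mp hm
    have h2 := Γ.pos.mul_mem h1 (Γ.pos.pow_mem Γ.delta_mem (n * m - m))
    rw [neg_neg, zpow_natCast, mul_assoc, ← pow_add, Nat.add_sub_cancel' (Nat.le_mul_of_pos_left m hn),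
      pow_mul] at h2
    exact h2
  · rw [← cj_cj, cj.eq_1 (cj X g), mul_assoc, hcm, inv_mul_cancel_left]

/-- `θ` is the meet of the monomials `Y ^ e * δ ^ m` for `(e, m)` in `S`. The cycling, decycling
and sliding operators all have this shape once infimum and supremum are fixed, and this is what
makes them commute and makes transport along them compatible with meets. -/
def IsMeet (Γ : GarsideStructure G) (θ : G → G) (S : Set (ℤ × ℤ)) : Prop :=
  ∀ Y t, Γ.Prefix t (θ Y) ↔ ∀ s ∈ S, Γ.Prefix t (Y ^ s.1 * Γ.delta ^ s.2)

/-- Conjugation of `Y` by `θ Y`: cycling, decycling or sliding for `θ = iota p`, `dec q`, `slide p q`. -/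
def next (θ : G → G) (Y : G) : G := cj Y (θ Y)

/-- The transport of `α : Y → Yᵅ` along the operator `θ`. -/
def transport (θ : G → G) (Y α : G) : G := (θ Y)⁻¹ * α * θ (cj Y α)

/-- The transport closes the square formed by `α : Y → Yᵅ` and the two arrows given by `θ`. -/
theorem cj_transport (θ : G → G) (Y α : G) :
    cj (next θ Y) (transport θ Y α) = next θ (cj Y α) := by
  simp [next, transport, cj, mul_assoc]

theorem mul_transport (θ : G → G) (Y α : G) :
    θ Y * transport θ Y α = α * θ (cj Y α) := by
  simp [transport, mul_assoc]

theorem transport_one (θ : G → G) (Y : G) : transport θ Y 1 = 1 := by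
  simp [transport, cj_one]

theorem isMeet_iota (p : ℤ) : Γ.IsMeet (Γ.iota p) {(1, -p), (0, 1)} := by
  intro Y t
  simp [iota, prefix_gcd_iff]

theorem isMeet_dec (q : ℤ) : Γ.IsMeet (Γ.dec q) {(-1, q - 1), (0, 0)} := by
  intro Y t
  simp [dec, prefix_gcd_iff]

theorem isMeet_kappa (q : ℤ) : Γ.IsMeet (Γ.kappa q) {(-1, q), (0, 1)} := by
  intro Y t
  simp [kappa, prefix_gcd_iff]

theorem isMeet_slide (p q : ℤ) :
    Γ.IsMeet (Γ.slide p q) {(1, -p), (-1, q), (0, 1)} := by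
  intro Y t
  simp only [slide, iota, kappa, prefix_gcd_iff, Set.mem_insert_iff, Set.mem_singleton_iff,
    forall_eq_or_imp, forall_eq, zpow_one, zpow_neg, zpow_zero, one_mul]
  tauto

namespace IsMeet

variable {θ θ' : G → G} {S S' : Set (ℤ × ℤ)}

theorem prefix_mul_iff (hθ : Γ.IsMeet θ S) (Y α t : G) :
    Γ.Prefix t (α * θ (cj Y α)) ↔ ∀ s ∈ S, Γ.Prefix t (Y ^ s.1 * α * Γ.delta ^ s.2) := by
  rw [← prefix_inv_mul_iff, hθ]
  refine forall₂_congr fun s _ => ?_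
  rw [prefix_inv_mul_iff, ← mul_assoc, mul_cj_zpow]

theorem prefix_zpow_mul_iff (hθ : Γ.IsMeet θ S) (h : Γ.IsTame) (Y t : G) (e m : ℤ) :
    Γ.Prefix t (Y ^ e * θ Y * Γ.delta ^ m) ↔
      ∀ s ∈ S, Γ.Prefix t (Y ^ (e + s.1) * Γ.delta ^ (s.2 + m)) := by
  have e1 : ∀ c : G, Γ.Prefix t (Y ^ e * c * Γ.delta ^ m) ↔
      Γ.Prefix ((Y ^ e)⁻¹ * (t * Γ.delta ^ (-m))) c := fun c => by
    rw [prefix_inv_mul_iff, ← h.prefix_mul_zpow_iff m (b := Y ^ e * c)]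
    simp
  rw [e1, hθ]
  refine forall₂_congr fun s _ => ?_
  rw [← e1, zpow_add, zpow_add]
  simp only [mul_assoc]

theorem gcd_mul (hθ : Γ.IsMeet θ S) (h : Γ.IsTame) (Y α β : G) :
    Γ.gcd α β * θ (cj Y (Γ.gcd α β)) = Γ.gcd (α * θ (cj Y α)) (β * θ (cj Y β)) := by
  refine eq_gcd_of_forall fun t => ?_
  rw [hθ.prefix_mul_iff, hθ.prefix_mul_iff, hθ.prefix_mul_iff, ← forall₂_and]
  refine forall₂_congr fun s _ => ?_
  rw [mul_gcd, h.gcd_mul_zpow, prefix_gcd_iff]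

theorem transport_gcd (hθ : Γ.IsMeet θ S) (h : Γ.IsTame) (Y α β : G) :
    transport θ Y (Γ.gcd α β) = Γ.gcd (transport θ Y α) (transport θ Y β) := by
  rw [transport, mul_assoc, hθ.gcd_mul h, mul_gcd]
  simp only [transport, mul_assoc]

theorem transport_mono (hθ : Γ.IsMeet θ S) (h : Γ.IsTame) {Y α β : G} (hab : Γ.Prefix α β) :
    Γ.Prefix (transport θ Y α) (transport θ Y β) := by
  rw [← gcd_eq_left_iff] at hab ⊢
  rw [← hθ.transport_gcd h, hab]

theorem transport_mem_pos (hθ : Γ.IsMeet θ S) (h : Γ.IsTame) {Y α : G} (hα : α ∈ Γ.pos) :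
    transport θ Y α ∈ Γ.pos := by
  rw [← one_prefix] at hα ⊢
  simpa [transport_one] using hθ.transport_mono h (Y := Y) hα

theorem conj_zpow (hθ : Γ.IsMeet θ S) (h : Γ.IsTame) (Y : G) (m : ℤ) :
    θ (cj Y (Γ.delta ^ m)) = cj (θ Y) (Γ.delta ^ m) := by
  have : Γ.delta ^ m * θ (cj Y (Γ.delta ^ m)) = θ Y * Γ.delta ^ m := by
    refine eq_of_prefix_iff (Γ := Γ) fun t => ?_
    have e := hθ.prefix_zpow_mul_iff h Y t 0 m
    rw [zpow_zero, one_mul] at e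
    rw [hθ.prefix_mul_iff, e]
    refine forall₂_congr fun s _ => ?_
    rw [zero_add, add_comm, zpow_add, mul_assoc]
  rw [cj.eq_1 (θ Y), mul_assoc, ← this, inv_mul_cancel_left]

theorem next_conj_zpow (hθ : Γ.IsMeet θ S) (h : Γ.IsTame) (Y : G) (m : ℤ) :
    next θ (cj Y (Γ.delta ^ m)) = cj (next θ Y) (Γ.delta ^ m) := by
  rw [next, hθ.conj_zpow h, next]
  simp [cj, mul_assoc]

theorem iterate_next_conj_zpow (hθ : Γ.IsMeet θ S) (h : Γ.IsTame) (Y : G) (m : ℤ) (n : ℕ) :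
    (next θ)^[n] (cj Y (Γ.delta ^ m)) = cj ((next θ)^[n] Y) (Γ.delta ^ m) := by
  induction n generalizing Y with
  | zero => rfl
  | succ n ih => rw [Function.iterate_succ_apply, hθ.next_conj_zpow h, ih,
      Function.iterate_succ_apply]

theorem transport_zpow (hθ : Γ.IsMeet θ S) (h : Γ.IsTame) (Y : G) (m : ℤ) :
    transport θ Y (Γ.delta ^ m) = Γ.delta ^ m := by
  rw [transport, hθ.conj_zpow h, cj]
  simp [mul_assoc]

theorem transport_prefix_zpow (hθ : Γ.IsMeet θ S) (h : Γ.IsTame) {Y α : G} {m : ℤ}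
    (hα : Γ.Prefix α (Γ.delta ^ m)) : Γ.Prefix (transport θ Y α) (Γ.delta ^ m) := by
  simpa [hθ.transport_zpow h] using hθ.transport_mono h (Y := Y) hα

/-- The exponents of a composition of two operators add up. -/
theorem prefix_comp_iff (hθ : Γ.IsMeet θ S) (hθ' : Γ.IsMeet θ' S') (h : Γ.IsTame) (Y t : G) :
    Γ.Prefix t (θ Y * θ' (next θ Y)) ↔
      ∀ s ∈ S, ∀ s' ∈ S', Γ.Prefix t (Y ^ (s.1 + s'.1) * Γ.delta ^ (s.2 + s'.2)) := by
  rw [next, hθ'.prefix_mul_iff]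
  have := fun s' : ℤ × ℤ => hθ.prefix_zpow_mul_iff h Y t s'.1 s'.2
  simp only [this]
  constructor
  · intro H s hs s' hs'
    rw [add_comm s.1]
    exact H s' hs' s hs
  · intro H s' hs' s hs
    rw [add_comm s'.1]
    exact H s hs s' hs'

theorem comp_comm (hθ : Γ.IsMeet θ S) (hθ' : Γ.IsMeet θ' S') (h : Γ.IsTame) (Y : G) :
    θ Y * θ' (next θ Y) = θ' Y * θ (next θ' Y) := by
  refine eq_of_prefix_iff (Γ := Γ) fun t => ?_
  rw [hθ.prefix_comp_iff hθ' h, hθ'.prefix_comp_iff hθ h]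
  constructor
  · intro H s hs s' hs'
    rw [add_comm s.1, add_comm s.2]
    exact H s' hs' s hs
  · intro H s hs s' hs'
    rw [add_comm s.1, add_comm s.2]
    exact H s' hs' s hs

theorem next_comm (hθ : Γ.IsMeet θ S) (hθ' : Γ.IsMeet θ' S') (h : Γ.IsTame) :
    Function.Commute (next θ) (next θ') := by
  intro Y
  have := hθ.comp_comm hθ' h Y
  conv_lhs => rw [next, next.eq_1 θ', cj_cj]
  conv_rhs => rw [next, next.eq_1 θ, cj_cj]
  exact congrArg (cj Y) this.symm

theorem transport_self (hθ : Γ.IsMeet θ S) (hθ' : Γ.IsMeet θ' S') (h : Γ.IsTame) (Y : G) :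
    transport θ Y (θ' Y) = θ' (next θ Y) := by
  have := hθ.comp_comm hθ' h Y
  rw [transport, mul_assoc]
  change _ * (θ' Y * θ (next θ' Y)) = _
  rw [← this, inv_mul_cancel_left]

end IsMeet

theorem next_mem_conjugatesOf {θ : G → G} {X Y : G} (hY : Y ∈ conjugatesOf X) :
    next θ Y ∈ conjugatesOf X := cj_mem_of_mem hY _

/-- Cycling followed by decycling is cyclic sliding. -/
theorem IsTame.iota_mul_dec (h : Γ.IsTame) {p q : ℤ} (hpq : p + 2 ≤ q) (Y : G) :
    Γ.iota p Y * Γ.dec q (next (Γ.iota p) Y) = Γ.slide p q Y := by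
  refine eq_of_prefix_iff (Γ := Γ) fun t => ?_
  rw [(isMeet_iota p).prefix_comp_iff (isMeet_dec q) h, isMeet_slide p q]
  simp only [Set.mem_insert_iff, Set.mem_singleton_iff, forall_eq_or_imp, forall_eq]
  have : Γ.Prefix t Γ.delta → Γ.Prefix t (Γ.delta ^ (-p + (q - 1))) := fun ht =>
    ht.trans (by simpa using zpow_prefix_zpow (Γ := Γ) (m := 1) (n := -p + (q - 1)) (by omega))
  simp only [add_neg_cancel, zpow_zero, one_mul, add_zero, zero_add, zpow_one,
    add_sub_cancel]
  tauto

theorem IsTame.dec_mul_iota (h : Γ.IsTame) {p q : ℤ} (hpq : p + 2 ≤ q) (Y : G) :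
    Γ.dec q Y * Γ.iota p (next (Γ.dec q) Y) = Γ.slide p q Y := by
  rw [(isMeet_dec q).comp_comm (isMeet_iota p) h, h.iota_mul_dec hpq]

theorem IsTame.next_dec_iota (h : Γ.IsTame) {p q : ℤ} (hpq : p + 2 ≤ q) (Y : G) :
    next (Γ.dec q) (next (Γ.iota p) Y) = next (Γ.slide p q) Y := by
  conv_lhs => rw [next, next, cj_cj]
  change cj Y (_ * Γ.dec q (next (Γ.iota p) Y)) = _
  rw [h.iota_mul_dec hpq, next]

theorem IsTame.next_iota_dec (h : Γ.IsTame) {p q : ℤ} (hpq : p + 2 ≤ q) (Y : G) :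
    next (Γ.iota p) (next (Γ.dec q) Y) = next (Γ.slide p q) Y := by
  rw [((isMeet_iota p).next_comm (isMeet_dec q) h).eq, h.next_dec_iota hpq]

/-! ### Behaviour of infimum and supremum -/

/-- The elements `Y` with `δᵖ ≼ Y ≼ δ^q`. -/
def band (Γ : GarsideStructure G) (p q : ℤ) : Set G :=
  {Y | Γ.Prefix (Γ.delta ^ p) Y ∧ Γ.Prefix Y (Γ.delta ^ q)}

theorem IsTame.inv_mem_band (h : Γ.IsTame) {p q : ℤ} {Y : G} (hY : Y ∈ Γ.band p q) :
    Y⁻¹ ∈ Γ.band (-q) (-p) := by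
  refine ⟨h.prefix_zpow_iff.mp hY.2, ?_⟩
  rw [h.prefix_zpow_iff]
  simpa using hY.1

/-- Inversion exchanges infimum and supremum, and preserves sliding. -/
theorem slide_inv (p q : ℤ) (Y : G) : Γ.slide (-q) (-p) Y⁻¹ = Γ.slide p q Y := by
  rw [slide, slide, gcd_comm, iota, iota, kappa, kappa]
  simp

theorem next_slide_inv (p q : ℤ) (Y : G) :
    next (Γ.slide (-q) (-p)) Y⁻¹ = (next (Γ.slide p q) Y)⁻¹ := by
  rw [next, slide_inv, next, cj_inv]

theorem iterate_next_slide_inv (p q : ℤ) (Y : G) (n : ℕ) :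
    (next (Γ.slide (-q) (-p)))^[n] Y⁻¹ = ((next (Γ.slide p q))^[n] Y)⁻¹ := by
  induction n generalizing Y with
  | zero => rfl
  | succ n ih => rw [Function.iterate_succ_apply, next_slide_inv, ih, Function.iterate_succ_apply]

theorem slide_prefix_iota (p q : ℤ) (Y : G) : Γ.Prefix (Γ.slide p q Y) (Γ.iota p Y) :=
  gcd_prefix_left _ _

theorem iota_prefix_delta (p : ℤ) (Y : G) : Γ.Prefix (Γ.iota p Y) Γ.delta :=
  gcd_prefix_right _ _

theorem slide_prefix_delta (p q : ℤ) (Y : G) : Γ.Prefix (Γ.slide p q Y) Γ.delta :=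
  (slide_prefix_iota p q Y).trans (iota_prefix_delta p Y)

theorem IsTame.iota_mem_pos (h : Γ.IsTame) {p : ℤ} {Y : G} (hY : Γ.Prefix (Γ.delta ^ p) Y) :
    Γ.iota p Y ∈ Γ.pos :=
  gcd_mem_pos (h.zpow_prefix_iff.mp hY) Γ.delta_mem

theorem kappa_mem_pos {q : ℤ} {Y : G} (hY : Γ.Prefix Y (Γ.delta ^ q)) :
    Γ.kappa q Y ∈ Γ.pos :=
  gcd_mem_pos hY Γ.delta_mem

theorem IsTame.slide_mem_pos (h : Γ.IsTame) {p q : ℤ} {Y : G} (hY : Y ∈ Γ.band p q) :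
    Γ.slide p q Y ∈ Γ.pos :=
  gcd_mem_pos (h.iota_mem_pos hY.1) (kappa_mem_pos hY.2)

theorem zpow_prefix_cj_iff {m : ℤ} {Y a : G} :
    Γ.Prefix (Γ.delta ^ m) (cj Y a) ↔ Γ.Prefix (a * Γ.delta ^ m) (Y * a) := by
  rw [cj, mul_assoc, ← prefix_iff_mul]

theorem IsTame.zpow_prefix_next_slide (h : Γ.IsTame) {p q : ℤ} {Y : G} (hpq : p < q)
    (hY : Γ.Prefix (Γ.delta ^ p) Y) : Γ.Prefix (Γ.delta ^ p) (next (Γ.slide p q) Y) := by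
  rw [next, zpow_prefix_cj_iff]
  have e := (isMeet_slide (Γ := Γ) p q).prefix_zpow_mul_iff h Y
    (Γ.slide p q Y * Γ.delta ^ p) 1 0
  simp only [zpow_one, zpow_zero, mul_one] at e
  rw [e]
  have h1 : Γ.Prefix (Γ.slide p q Y * Γ.delta ^ p) Y := by
    rw [h.zpow_prefix_iff_prefix]
    exact (slide_prefix_iota p q Y).trans (gcd_prefix_left _ _)
  have h2 : Γ.Prefix (Γ.slide p q Y * Γ.delta ^ p) (Γ.delta ^ (p + 1)) := by
    rw [h.zpow_prefix_iff_prefix, ← zpow_add]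
    simpa using slide_prefix_delta p q Y
  simp only [Set.mem_insert_iff, Set.mem_singleton_iff, forall_eq_or_imp, forall_eq]
  refine ⟨h1.trans ?_, ?_, h1.trans ?_⟩
  · have := prefix_mul_right (a := Y) (h.zpow_prefix_iff.mp hY)
    rw [zpow_add, zpow_one]
    simpa [mul_assoc] using this
  · have := h2.trans (zpow_prefix_zpow (Γ := Γ) (show p + 1 ≤ q by omega))
    simpa using this
  · simpa using prefix_mul_right (a := Y) Γ.delta_mem

theorem eq_of_mem_band_self {p : ℤ} {Y : G} (hY : Y ∈ Γ.band p p) :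
    Y = Γ.delta ^ p := (hY.1.antisymm hY.2).symm

theorem IsTame.next_slide_mem_band (h : Γ.IsTame) {p q : ℤ} (hpq : p ≤ q) {Y : G}
    (hY : Y ∈ Γ.band p q) : next (Γ.slide p q) Y ∈ Γ.band p q := by
  rcases hpq.lt_or_eq with hlt | rfl
  · refine ⟨h.zpow_prefix_next_slide hlt hY.1, ?_⟩
    have := h.zpow_prefix_next_slide (neg_lt_neg hlt) (h.inv_mem_band hY).1
    rw [next_slide_inv] at this
    exact h.prefix_zpow_iff.mpr this
  · have h1 : Γ.slide p p Y = 1 := by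
      refine eq_one_of_prefix_one (h.slide_mem_pos hY) ?_
      refine (slide_prefix_iota p p Y).trans ((gcd_prefix_left _ _).trans ?_)
      rw [eq_of_mem_band_self hY, ← zpow_add]
      simp [prefix_refl]
    rwa [next, h1, cj_one]

theorem IsTame.next_iota_mem_band (h : Γ.IsTame) {p q : ℤ} (hpq : p < q) {Y : G}
    (hY : Y ∈ Γ.band p q) : next (Γ.iota p) Y ∈ Γ.band p q := by
  constructor
  · rw [next, zpow_prefix_cj_iff]
    have e := (isMeet_iota (Γ := Γ) p).prefix_zpow_mul_iff h Y
      (Γ.iota p Y * Γ.delta ^ p) 1 0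
    simp only [zpow_one, zpow_zero, mul_one] at e
    rw [e]
    have h1 : Γ.Prefix (Γ.iota p Y * Γ.delta ^ p) Y := by
      rw [h.zpow_prefix_iff_prefix]
      exact gcd_prefix_left _ _
    simp only [Set.mem_insert_iff, Set.mem_singleton_iff, forall_eq_or_imp, forall_eq]
    refine ⟨h1.trans ?_, h1.trans ?_⟩
    · have := prefix_mul_right (a := Y) (h.zpow_prefix_iff.mp hY.1)
      rw [zpow_add, zpow_one]
      simpa [mul_assoc] using this
    · simpa using prefix_mul_right (a := Y) Γ.delta_mem
  · have e := (isMeet_iota (Γ := Γ) p).prefix_zpow_mul_iff h Y (Y * Γ.iota p Y) 0 q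
    simp only [zpow_zero, one_mul] at e
    rw [next, cj, mul_assoc, prefix_inv_mul_iff, e]
    have h1 : Γ.Prefix (Y * Γ.iota p Y) (Y * Γ.delta) := (iota_prefix_delta p Y).mul_left Y
    simp only [Set.mem_insert_iff, Set.mem_singleton_iff, forall_eq_or_imp, forall_eq]
    refine ⟨h1.trans ?_, h1.trans ?_⟩
    · simpa using (zpow_prefix_zpow (Γ := Γ) (show 1 ≤ -p + q by omega)).mul_left Y
    · have := (h.prefix_mul_zpow_iff 1).mpr hY.2
      rw [← zpow_add] at this
      simpa [add_comm] using this

theorem IsTame.cj_zpow_mem_band (h : Γ.IsTame) {p q : ℤ} {Y : G} (hY : Y ∈ Γ.band p q) (m : ℤ) :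
    cj Y (Γ.delta ^ m) ∈ Γ.band p q := by
  have e : ∀ n : ℤ, Γ.delta ^ n = (Γ.delta ^ m)⁻¹ * (Γ.delta ^ n * Γ.delta ^ m) := by
    intro n; group
  constructor
  · rw [cj, mul_assoc, e, prefix_mul_left_iff, h.prefix_mul_zpow_iff]
    exact hY.1
  · rw [cj, mul_assoc, e q, prefix_mul_left_iff, h.prefix_mul_zpow_iff]
    exact hY.2

theorem IsTame.next_dec_mem_band (h : Γ.IsTame) {p q : ℤ} (hpq : p < q) {Y : G}
    (hY : Y ∈ Γ.band p q) : next (Γ.dec q) Y ∈ Γ.band p q := by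
  have h1 := h.inv_mem_band (h.next_iota_mem_band (neg_lt_neg hpq) (h.inv_mem_band hY))
  simp only [neg_neg] at h1
  have e : Γ.iota (-q) Y⁻¹ = Γ.kappa q Y := by simp [iota, kappa]
  rw [next, e, ← cj_inv, inv_inv, ← h.dec_mul_delta, ← cj_cj] at h1
  have h2 := h.cj_zpow_mem_band h1 (-1)
  rw [cj_cj] at h2
  simpa [next, cj_one] using h2

/-- If cycling increases the infimum, so does cyclic sliding. -/
theorem IsTame.zpow_prefix_slide_of_iota (h : Γ.IsTame) {p q : ℤ} (hpq : p + 2 ≤ q) {Y : G}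
    (hY : Γ.Prefix (Γ.delta ^ (p + 1)) (next (Γ.iota p) Y)) :
    Γ.Prefix (Γ.delta ^ (p + 1)) (next (Γ.slide p q) Y) := by
  rw [next, zpow_prefix_cj_iff] at hY ⊢
  have h1 : Γ.Prefix (Γ.slide p q Y * Γ.delta ^ (p + 1)) (Y * Γ.iota p Y) :=
    ((h.prefix_mul_zpow_iff _).mpr (slide_prefix_iota p q Y)).trans hY
  have h2 : Γ.Prefix (Γ.slide p q Y * Γ.delta ^ (p + 1)) (Γ.delta ^ q) := by
    have := (h.prefix_mul_zpow_iff (p + 1)).mpr (slide_prefix_delta p q Y)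
    rw [← zpow_one_add] at this
    exact this.trans (zpow_prefix_zpow (by omega))
  have e := fun t => (isMeet_slide (Γ := Γ) p q).prefix_zpow_mul_iff h Y t 1 0
  have e' := fun t => (isMeet_iota (Γ := Γ) p).prefix_zpow_mul_iff h Y t 1 0
  simp only [zpow_one, zpow_zero, mul_one, Set.mem_insert_iff, Set.mem_singleton_iff,
    forall_eq_or_imp, forall_eq] at e e'
  rw [e]
  rw [e'] at h1
  exact ⟨h1.1, by simpa using h2, h1.2⟩

theorem IsTame.zpow_prefix_iterate_slide (h : Γ.IsTame) {p q : ℤ} (hpq : p + 2 ≤ q) (i : ℕ)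
    {Y : G} (hY : Γ.Prefix (Γ.delta ^ (p + 1)) ((next (Γ.iota p))^[i] Y)) :
    Γ.Prefix (Γ.delta ^ (p + 1)) ((next (Γ.slide p q))^[i] Y) := by
  induction i generalizing Y with
  | zero => exact hY
  | succ i ih =>
    rw [Function.iterate_succ_apply] at hY
    have h1 := ih hY
    have hc := ((isMeet_slide (Γ := Γ) p q).next_comm (isMeet_iota p) h).iterate_left i
    rw [hc.eq] at h1
    rw [Function.iterate_succ_apply']
    exact h.zpow_prefix_slide_of_iota hpq h1

/-- If some conjugate of `Y` has larger infimum, iterated cycling of `Y` increases the infimum: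
the positive element conjugating it to `Y` gets shorter with each cycling. -/
theorem IsTame.exists_iterate_cycling (h : Γ.IsTame) {p : ℤ} {Y W γ : G} (hγ : γ ∈ Γ.pos)
    (hY : Γ.Prefix (Γ.delta ^ p) Y) (hW : Γ.Prefix (Γ.delta ^ (p + 1)) W) (hWY : Y = cj W γ) :
    ∃ i : ℕ, Γ.Prefix (Γ.delta ^ (p + 1)) ((next (Γ.iota p))^[i] Y) := by
  induction hn : Γ.norm γ using Nat.strong_induction_on generalizing γ Y W with
  | _ n ih =>
  by_cases hY1 : Γ.Prefix (Γ.delta ^ (p + 1)) Y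
  · exact ⟨0, hY1⟩
  -- the join of `1` and `γ⁻¹ δ` is a prefix of the initial factor of `Y`
  obtain ⟨t, ht1, ht2, ht3⟩ := Γ.exists_lcm 1 (γ⁻¹ * Γ.delta)
  have htp : t ∈ Γ.pos := one_prefix.mp ht1
  have htι : Γ.Prefix t (Γ.iota p Y) := by
    refine ht3 _ (one_prefix.mpr (h.iota_mem_pos hY)) ?_
    change Γ.Prefix (γ⁻¹ * Γ.delta) (Γ.iota p Y)
    rw [iota, prefix_gcd_iff]
    constructor
    · rw [← h.zpow_prefix_iff_prefix, mul_assoc, ← zpow_one_add, prefix_inv_mul_iff, hWY, cj,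
        ← mul_assoc, mul_inv_cancel_left, add_comm]
      exact hW.trans (prefix_mul_right hγ)
    · have := Γ.conj_delta_mem γ hγ
      simpa [Prefix, mul_assoc] using this
  obtain ⟨t', ht', hιt⟩ := htι.exists_mul
  -- `γ t = δ γ₁` with `γ₁` positive
  have hγ₁ : Γ.delta⁻¹ * (γ * t) ∈ Γ.pos := by simpa [mul_assoc] using ht2
  have hγt : γ * t = Γ.delta * (Γ.delta⁻¹ * (γ * t)) := by simp
  -- the initial factor is shorter than `δ`, so `γ₁ t'` is shorter than `γ`
  have hne : Γ.iota p Y ≠ Γ.delta := by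
    intro hι
    apply hY1
    have h1 : Γ.Prefix (Γ.iota p Y) (Y * Γ.delta ^ (-p)) := gcd_prefix_left _ _
    rw [hι] at h1
    rwa [add_comm, zpow_one_add, h.zpow_prefix_iff_prefix]
  have hlt := h.norm_lt (h.iota_mem_pos hY) (iota_prefix_delta p Y) hne
  have n1 := h.homog _ hγ _ htp
  have n2 := h.homog _ Γ.delta_mem _ hγ₁
  have n3 := h.homog _ htp _ ht'
  have n4 := h.homog _ hγ₁ _ ht'
  rw [← hγt] at n2
  rw [← hιt] at n3
  have hW' : Γ.Prefix (Γ.delta ^ (p + 1)) (cj W Γ.delta) := by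
    have e : Γ.delta ^ (p + 1) = Γ.delta⁻¹ * (Γ.delta ^ (p + 1) * Γ.delta) := by group
    rw [cj, mul_assoc, e, prefix_mul_left_iff, h.prefix_mul_delta_iff]
    exact hW
  have hY' : Γ.Prefix (Γ.delta ^ p) (next (Γ.iota p) Y) := by
    obtain ⟨m, -, hm⟩ := h.exists_bounds Y
    have hb : Y ∈ Γ.band p (max m (p + 1)) := ⟨hY, hm.trans (zpow_prefix_zpow (le_max_left _ _))⟩
    exact (h.next_iota_mem_band (by omega) hb).1
  obtain ⟨i, hi⟩ := ih (Γ.norm (Γ.delta⁻¹ * (γ * t) * t')) (by omega)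
    (Γ.pos.mul_mem hγ₁ ht') hY' hW' (by
      rw [next, hιt, hWY, cj_cj, cj_cj]
      congr 1
      group) rfl
  exact ⟨i + 1, hi⟩

/-- If `Y` does not attain the maximal infimum in its conjugacy class, iterated sliding increases
the infimum. -/
theorem IsTame.exists_iterate_slide (h : Γ.IsTame) {p q : ℤ} (hpq : p + 2 ≤ q) {X Y W : G}
    (hYX : Y ∈ conjugatesOf X) (hWX : W ∈ conjugatesOf X) (hY : Γ.Prefix (Γ.delta ^ p) Y)
    (hW : Γ.Prefix (Γ.delta ^ (p + 1)) W) :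
    ∃ i : ℕ, Γ.Prefix (Γ.delta ^ (p + 1)) ((next (Γ.slide p q))^[i] Y) := by
  obtain ⟨a, rfl⟩ := mem_conjugatesOf_iff_cj.mp hWX
  obtain ⟨b, rfl⟩ := mem_conjugatesOf_iff_cj.mp hYX
  obtain ⟨γ, hγ, he⟩ := h.exists_pos_cj (X := cj X a) (Y := cj X b)
    (mem_conjugatesOf_iff_cj.mpr ⟨a⁻¹ * b, by rw [cj_cj]; simp⟩)
  obtain ⟨i, hi⟩ := h.exists_iterate_cycling hγ hY hW he
  exact ⟨i, h.zpow_prefix_iterate_slide hpq i hi⟩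

/-- If `Y` does not attain the minimal supremum in its conjugacy class, iterated sliding decreases
the supremum. -/
theorem IsTame.exists_iterate_slide' (h : Γ.IsTame) {p q : ℤ} (hpq : p + 2 ≤ q) {X Y W : G}
    (hYX : Y ∈ conjugatesOf X) (hWX : W ∈ conjugatesOf X) (hY : Γ.Prefix Y (Γ.delta ^ q))
    (hW : Γ.Prefix W (Γ.delta ^ (q - 1))) :
    ∃ i : ℕ, Γ.Prefix ((next (Γ.slide p q))^[i] Y) (Γ.delta ^ (q - 1)) := by
  have hinv : ∀ {V : G}, V ∈ conjugatesOf X → V⁻¹ ∈ conjugatesOf X⁻¹ := by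
    intro V hV
    obtain ⟨a, rfl⟩ := mem_conjugatesOf_iff_cj.mp hV
    rw [cj_inv]
    exact cj_mem_conjugatesOf _ _
  obtain ⟨i, hi⟩ := h.exists_iterate_slide (p := -q) (q := -p) (by omega) (hinv hYX) (hinv hWX)
    (h.prefix_zpow_iff.mp hY)
    (by rw [h.prefix_zpow_iff] at hW; convert hW using 2; ring)
  refine ⟨i, ?_⟩
  rw [iterate_next_slide_inv] at hi
  rw [h.prefix_zpow_iff]
  convert hi using 2
  ring

/-! ### Sliding circuits -/

theorem IsTame.cyclicSliding_eq (h : Γ.IsTame) (hδ : Γ.delta ≠ 1) (Y : G) :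
    Γ.cyclicSliding Y = next (Γ.slide (Γ.inf Y) (Γ.sup Y)) Y := by
  rw [cyclicSliding, h.preferredPrefix_eq hδ, next, cj]

theorem IsTame.cycling_eq (h : Γ.IsTame) (hδ : Γ.delta ≠ 1) (Y : G) :
    Γ.cycling Y = next (Γ.iota (Γ.inf Y)) Y := by
  rw [cycling, h.initialFactor_eq hδ, next, cj]

theorem IsTame.decycling_eq (h : Γ.IsTame) (hδ : Γ.delta ≠ 1) (Y : G) :
    Γ.decycling Y = next (Γ.dec (Γ.sup Y)) Y := by
  rw [decycling, h.finalFactor_eq hδ, next, cj, inv_inv]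

theorem IsTame.mem_band_iff (h : Γ.IsTame) (hδ : Γ.delta ≠ 1) {p q : ℤ} {Y : G} :
    Y ∈ Γ.band p q ↔ p ≤ Γ.inf Y ∧ Γ.sup Y ≤ q := by
  rw [h.le_inf_iff hδ, h.sup_le_iff hδ]
  rfl

theorem IsTame.cyclicSliding_mem_band (h : Γ.IsTame) (hδ : Γ.delta ≠ 1) (Y : G) :
    Γ.cyclicSliding Y ∈ Γ.band (Γ.inf Y) (Γ.sup Y) := by
  rw [h.cyclicSliding_eq hδ]
  exact h.next_slide_mem_band (inf_le_sup Y) ((h.mem_band_iff hδ).mpr ⟨le_rfl, le_rfl⟩)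

theorem IsTame.inf_le_inf_iterate (h : Γ.IsTame) (hδ : Γ.delta ≠ 1) (Y : G) (n : ℕ) :
    Γ.inf Y ≤ Γ.inf (Γ.cyclicSliding^[n] Y) ∧ Γ.sup (Γ.cyclicSliding^[n] Y) ≤ Γ.sup Y := by
  induction n with
  | zero => exact ⟨le_rfl, le_rfl⟩
  | succ n ih =>
    rw [Function.iterate_succ_apply']
    have := (h.mem_band_iff hδ).mp (h.cyclicSliding_mem_band hδ (Γ.cyclicSliding^[n] Y))
    omega

theorem iterate_mem_of_mul {α : Type*} {f : α → α} {x : α} {m : ℕ} (hm : f^[m] x = x) (n : ℕ) :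
    f^[m * n] x = x := by
  induction n with
  | zero => rfl
  | succ n ih => rw [Nat.mul_succ, Function.iterate_add_apply, hm, ih]

theorem IsTame.inf_iterate_eq (h : Γ.IsTame) (hδ : Γ.delta ≠ 1) {Y : G} {m : ℕ} (hm : 0 < m)
    (hY : Γ.cyclicSliding^[m] Y = Y) (n : ℕ) :
    Γ.inf (Γ.cyclicSliding^[n] Y) = Γ.inf Y ∧ Γ.sup (Γ.cyclicSliding^[n] Y) = Γ.sup Y := by
  have h1 := h.inf_le_inf_iterate hδ Y n
  have h2 := h.inf_le_inf_iterate hδ (Γ.cyclicSliding^[n] Y) (m * n - n)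
  rw [← Function.iterate_add_apply, Nat.sub_add_cancel (Nat.le_mul_of_pos_left n hm),
    iterate_mem_of_mul hY] at h2
  omega

theorem IsTame.iterate_cyclicSliding_eq (h : Γ.IsTame) (hδ : Γ.delta ≠ 1) {Y : G} {m : ℕ}
    (hm : 0 < m) (hY : Γ.cyclicSliding^[m] Y = Y) (n : ℕ) :
    Γ.cyclicSliding^[n] Y = (next (Γ.slide (Γ.inf Y) (Γ.sup Y)))^[n] Y := by
  induction n with
  | zero => rfl
  | succ n ih =>
    obtain ⟨h1, h2⟩ := h.inf_iterate_eq hδ hm hY n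
    rw [Function.iterate_succ_apply', h.cyclicSliding_eq hδ, h1, h2, ih,
      Function.iterate_succ_apply']

theorem cyclicSliding_mem_conjugatesOf {X Y : G} (hY : Y ∈ conjugatesOf X) :
    Γ.cyclicSliding Y ∈ conjugatesOf X := cj_mem_of_mem hY _

theorem IsTame.finite_band (h : Γ.IsTame) (p q : ℤ) : (Γ.band p q).Finite := by
  refine ((h.finite_interval (q - p).toNat).image (fun W => Γ.delta ^ p * W)).subset ?_
  rintro Y ⟨h1, h2⟩
  obtain ⟨W, hW, rfl⟩ := h1.exists_mul
  refine ⟨W, ⟨hW, ?_⟩, rfl⟩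
  rw [prefix_iff_mul, ← zpow_neg, ← zpow_add] at h2
  exact h2.trans (zpow_prefix_zpow (by omega))

/-- Iterates that stay in a finite set are eventually periodic. -/
theorem exists_iterate_periodic {α : Type*} {f : α → α} {s : Set α} (hs : s.Finite) {x : α}
    (hx : ∀ n, f^[n] x ∈ s) : ∃ n m, 0 < m ∧ f^[m] (f^[n] x) = f^[n] x := by
  obtain ⟨a, b, hab, he⟩ : ∃ a b : ℕ, a < b ∧ f^[a] x = f^[b] x := by
    have hnot : ¬ Function.Injective fun n : ℕ => (⟨f^[n] x, hx n⟩ : s) := by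
      have : Finite s := hs
      exact not_injective_infinite_finite _
    simp only [Function.Injective, Subtype.mk.injEq, not_forall] at hnot
    obtain ⟨a, b, he, hne⟩ := hnot
    rcases Nat.lt_or_gt_of_ne hne with hlt | hlt
    · exact ⟨a, b, hlt, he⟩
    · exact ⟨b, a, hlt, he.symm⟩
  refine ⟨a, b - a, by omega, ?_⟩
  rw [← Function.iterate_add_apply, Nat.sub_add_cancel hab.le, he]

theorem IsTame.slidingCircuits_nonempty (h : Γ.IsTame) (hδ : Γ.delta ≠ 1) (X : G) :
    (Γ.slidingCircuits X).Nonempty := by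
  obtain ⟨n, m, hm, he⟩ := exists_iterate_periodic (f := Γ.cyclicSliding) (x := X)
    (h.finite_band (Γ.inf X) (Γ.sup X))
    (fun n => (h.mem_band_iff hδ).mpr (h.inf_le_inf_iterate hδ X n))
  refine ⟨_, ?_, m, hm, he⟩
  clear he
  induction n with
  | zero => exact mem_conjugatesOf_iff_cj.mpr ⟨1, (cj_one X).symm⟩
  | succ n ih => rw [Function.iterate_succ_apply']; exact cyclicSliding_mem_conjugatesOf ih

/-- `p` and `q` are the infimum and supremum of the elements of the super summit set of `X`, and they
differ by at least two, so that cycling followed by decycling is sliding. -/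
structure IsSummit (Γ : GarsideStructure G) (X : G) (p q : ℤ) : Prop where
  two_le : p + 2 ≤ q
  delta_ne_one : Γ.delta ≠ 1
  not_zpow_prefix : ∀ W ∈ conjugatesOf X, ¬ Γ.Prefix (Γ.delta ^ (p + 1)) W
  not_prefix_zpow : ∀ W ∈ conjugatesOf X, ¬ Γ.Prefix W (Γ.delta ^ (q - 1))
  exists_mem : ∃ W ∈ conjugatesOf X, W ∈ Γ.band p q

theorem IsSummit.inf_le (h : Γ.IsTame) {X W : G} {p q : ℤ} (hs : Γ.IsSummit X p q)
    (hW : W ∈ conjugatesOf X) : Γ.inf W ≤ p ∧ q ≤ Γ.sup W := by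
  constructor
  · by_contra hlt
    exact hs.not_zpow_prefix W hW ((h.le_inf_iff hs.delta_ne_one).mp (by omega))
  · by_contra hlt
    exact hs.not_prefix_zpow W hW ((h.sup_le_iff hs.delta_ne_one).mp (by omega))

theorem IsSummit.inf_eq (h : Γ.IsTame) {X W : G} {p q : ℤ} (hs : Γ.IsSummit X p q)
    (hW : W ∈ conjugatesOf X) (hb : W ∈ Γ.band p q) : Γ.inf W = p ∧ Γ.sup W = q := by
  have h1 := hs.inf_le h hW
  have h2 := (h.mem_band_iff hs.delta_ne_one).mp hb
  omega

/-- Sliding circuits lie in the super summit set. -/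
theorem IsSummit.mem_band_of_mem_slidingCircuits (h : Γ.IsTame) {X Y : G} {p q : ℤ}
    (hs : Γ.IsSummit X p q) (hY : Y ∈ Γ.slidingCircuits X) : Y ∈ Γ.band p q := by
  obtain ⟨hYX, m, hm, he⟩ := hY
  have hδ := hs.delta_ne_one
  obtain ⟨W, hW, hWb⟩ := hs.exists_mem
  obtain ⟨h1, h2⟩ := hs.inf_le h hYX
  have h3 := hs.two_le
  rw [h.mem_band_iff hδ]
  constructor
  · by_contra hlt
    obtain ⟨i, hi⟩ := h.exists_iterate_slide (p := Γ.inf Y) (q := Γ.sup Y) (by omega) hYX hW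
      ((h.le_inf_iff hδ).mp le_rfl) ((zpow_prefix_zpow (by omega)).trans hWb.1)
    rw [← h.iterate_cyclicSliding_eq hδ hm he, ← h.le_inf_iff hδ,
      (h.inf_iterate_eq hδ hm he i).1] at hi
    omega
  · by_contra hlt
    obtain ⟨i, hi⟩ := h.exists_iterate_slide' (p := Γ.inf Y) (q := Γ.sup Y) (by omega) hYX hW
      ((h.sup_le_iff hδ).mp le_rfl) (hWb.2.trans (zpow_prefix_zpow (by omega)))
    rw [← h.iterate_cyclicSliding_eq hδ hm he, ← h.sup_le_iff hδ,
      (h.inf_iterate_eq hδ hm he i).2] at hi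
    omega

/-! ### The set of sliding circuits -/

/-- The conjugates of `X` between `δᵖ` and `δ^q` that are periodic under cyclic sliding. For the
summit values of `p` and `q` this is the set of sliding circuits of `X`. -/
def circuits (Γ : GarsideStructure G) (X : G) (p q : ℤ) : Set G :=
  {Y | Y ∈ conjugatesOf X ∧ Y ∈ Γ.band p q ∧ ∃ m : ℕ, 0 < m ∧ (next (Γ.slide p q))^[m] Y = Y}

theorem IsTame.finite_circuits (h : Γ.IsTame) (X : G) (p q : ℤ) : (Γ.circuits X p q).Finite :=
  (h.finite_band p q).subset fun _ hY => hY.2.1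

theorem IsSummit.mem_circuits (h : Γ.IsTame) {X Y : G} {p q : ℤ} (hs : Γ.IsSummit X p q)
    (hY : Y ∈ Γ.slidingCircuits X) : Y ∈ Γ.circuits X p q := by
  have hb := hs.mem_band_of_mem_slidingCircuits h hY
  obtain ⟨hYX, m, hm, he⟩ := hY
  obtain ⟨h1, h2⟩ := hs.inf_eq h hYX hb
  refine ⟨hYX, hb, m, hm, ?_⟩
  rw [h.iterate_cyclicSliding_eq hs.delta_ne_one hm he, h1, h2] at he
  exact he

/-- The operators that act injectively on the set of sliding circuits. -/
structure ActsOn (Γ : GarsideStructure G) (θ : G → G) (C : Set G) : Prop where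
  isMeet : ∃ S, Γ.IsMeet θ S
  mapsTo : Set.MapsTo (next θ) C C
  injOn : Set.InjOn (next θ) C

theorem mapsTo_circuits (h : Γ.IsTame) {θ : G → G} {S : Set (ℤ × ℤ)} {X : G} {p q : ℤ}
    (hθ : Γ.IsMeet θ S) (hb : ∀ Y ∈ Γ.band p q, next θ Y ∈ Γ.band p q) :
    Set.MapsTo (next θ) (Γ.circuits X p q) (Γ.circuits X p q) := by
  rintro Y ⟨h1, h2, m, hm, he⟩
  refine ⟨next_mem_conjugatesOf h1, hb Y h2, m, hm, ?_⟩
  have := ((isMeet_slide (Γ := Γ) p q).next_comm hθ h).iterate_left m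
  rw [this.eq, he]

theorem IsTame.actsOn_slide (h : Γ.IsTame) {X : G} {p q : ℤ} (hpq : p + 2 ≤ q) :
    Γ.ActsOn (Γ.slide p q) (Γ.circuits X p q) := by
  refine ⟨⟨_, isMeet_slide p q⟩, mapsTo_circuits h (isMeet_slide p q)
    (fun Y hY => h.next_slide_mem_band (by omega) hY), ?_⟩
  rintro Y ⟨-, -, m, hm, he⟩ Y' ⟨-, -, m', hm', he'⟩ hYY'
  have h1 := iterate_mem_of_mul he m'
  have h2 := iterate_mem_of_mul he' m
  rw [mul_comm] at h2
  obtain ⟨n, hn⟩ : ∃ n, m * m' = n + 1 := ⟨m * m' - 1, by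
    have := Nat.mul_pos hm hm'
    omega⟩
  rw [hn, Function.iterate_succ_apply] at h1 h2
  rw [← h1, ← h2, hYY']

theorem IsTame.actsOn_iota (h : Γ.IsTame) {X : G} {p q : ℤ} (hpq : p + 2 ≤ q) :
    Γ.ActsOn (Γ.iota p) (Γ.circuits X p q) := by
  refine ⟨⟨_, isMeet_iota p⟩, mapsTo_circuits h (isMeet_iota p)
    (fun Y hY => h.next_iota_mem_band (by omega) hY), ?_⟩
  intro Y hY Y' hY' he
  apply (h.actsOn_slide hpq).injOn hY hY'
  rw [← h.next_dec_iota hpq, ← h.next_dec_iota hpq, he]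

theorem IsTame.actsOn_dec (h : Γ.IsTame) {X : G} {p q : ℤ} (hpq : p + 2 ≤ q) :
    Γ.ActsOn (Γ.dec q) (Γ.circuits X p q) := by
  refine ⟨⟨_, isMeet_dec q⟩, mapsTo_circuits h (isMeet_dec q)
    (fun Y hY => h.next_dec_mem_band (by omega) hY), ?_⟩
  intro Y hY Y' hY' he
  apply (h.actsOn_slide hpq).injOn hY hY'
  rw [← h.next_iota_dec hpq, ← h.next_iota_dec hpq, he]

theorem IsTame.cj_zpow_mem_circuits (h : Γ.IsTame) {X Y : G} {p q : ℤ}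
    (hY : Y ∈ Γ.circuits X p q) (j : ℤ) : cj Y (Γ.delta ^ j) ∈ Γ.circuits X p q := by
  obtain ⟨h1, h2, m, hm, he⟩ := hY
  refine ⟨cj_mem_of_mem h1 _, h.cj_zpow_mem_band h2 j, m, hm, ?_⟩
  rw [(isMeet_slide p q).iterate_next_conj_zpow h, he]

/-! ### Iterated transport -/

/-- The operator `θ` acting on pairs `(Y, α)`, regarded as arrows `Y → Yᵅ`. -/
def nextPair (θ : G → G) (w : G × G) : G × G := (next θ w.1, transport θ w.1 w.2)

theorem iterate_nextPair_fst (θ : G → G) (w : G × G) (n : ℕ) :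
    ((nextPair θ)^[n] w).1 = (next θ)^[n] w.1 := by
  induction n generalizing w with
  | zero => rfl
  | succ n ih => rw [Function.iterate_succ_apply, ih]; rfl

theorem cj_iterate_nextPair (θ : G → G) (w : G × G) (n : ℕ) :
    cj ((next θ)^[n] w.1) ((nextPair θ)^[n] w).2 = (next θ)^[n] (cj w.1 w.2) := by
  induction n generalizing w with
  | zero => rfl
  | succ n ih =>
    have := ih (nextPair θ w)
    rw [Function.iterate_succ_apply, Function.iterate_succ_apply, Function.iterate_succ_apply,
      ← cj_transport]
    exact this

theorem IsMeet.iterate_nextPair_gcd {θ : G → G} {S : Set (ℤ × ℤ)} (hθ : Γ.IsMeet θ S)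
    (h : Γ.IsTame) (Y α β : G) (n : ℕ) :
    ((nextPair θ)^[n] (Y, Γ.gcd α β)).2 =
      Γ.gcd ((nextPair θ)^[n] (Y, α)).2 ((nextPair θ)^[n] (Y, β)).2 := by
  induction n generalizing Y α β with
  | zero => rfl
  | succ n ih =>
    simp only [Function.iterate_succ_apply, nextPair]
    rw [hθ.transport_gcd h]
    exact ih _ _ _

theorem IsMeet.iterate_nextPair_mono {θ : G → G} {S : Set (ℤ × ℤ)} (hθ : Γ.IsMeet θ S)
    (h : Γ.IsTame) {Y α β : G} (hab : Γ.Prefix α β) (n : ℕ) :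
    Γ.Prefix ((nextPair θ)^[n] (Y, α)).2 ((nextPair θ)^[n] (Y, β)).2 := by
  rw [← gcd_eq_left_iff] at hab ⊢
  rw [← hθ.iterate_nextPair_gcd h, hab]

theorem iterate_nextPair_one (θ : G → G) (Y : G) (n : ℕ) :
    ((nextPair θ)^[n] (Y, 1)).2 = 1 := by
  induction n generalizing Y with
  | zero => rfl
  | succ n ih =>
    rw [Function.iterate_succ_apply, nextPair, transport_one]
    exact ih _

/-- The arrows `Y → Yᵅ` of `C` with `1 ≼ α ≼ δʳ`. -/
def arrows (Γ : GarsideStructure G) (C : Set G) (r : ℕ) : Set (G × G) :=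
  {w | w.1 ∈ C ∧ cj w.1 w.2 ∈ C ∧ w.2 ∈ Γ.pos ∧ Γ.Prefix w.2 (Γ.delta ^ (r : ℤ))}

theorem IsTame.finite_arrows (h : Γ.IsTame) {C : Set G} (hC : C.Finite) (r : ℕ) :
    (Γ.arrows C r).Finite :=
  (hC.prod (h.finite_interval r)).subset fun _ hw => ⟨hw.1, hw.2.2⟩

namespace ActsOn

variable {θ : G → G} {C : Set G}

theorem mapsTo_arrows (hθ : Γ.ActsOn θ C) (h : Γ.IsTame) (r : ℕ) :
    Set.MapsTo (nextPair θ) (Γ.arrows C r) (Γ.arrows C r) := by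
  rintro ⟨Y, α⟩ ⟨h1, h2, h3, h4⟩
  obtain ⟨S, hS⟩ := hθ.isMeet
  refine ⟨hθ.mapsTo h1, ?_, hS.transport_mem_pos h h3, hS.transport_prefix_zpow h h4⟩
  simp only [nextPair]
  rw [cj_transport]
  exact hθ.mapsTo h2

theorem injOn_arrows (hθ : Γ.ActsOn θ C) (r : ℕ) :
    Set.InjOn (nextPair θ) (Γ.arrows C r) := by
  rintro ⟨Y, α⟩ ⟨h1, h2, -, -⟩ ⟨Y', α'⟩ ⟨h1', h2', -, -⟩ he
  simp only [nextPair, Prod.mk.injEq] at he h1 h2 h1' h2'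
  obtain ⟨e1, e2⟩ := he
  obtain rfl := hθ.injOn h1 h1' e1
  have e3 : cj Y α = cj Y α' := by
    apply hθ.injOn h2 h2'
    rw [← cj_transport, ← cj_transport, e2]
  have e4 := congrArg (θ Y * ·) e2
  simp only [mul_transport] at e4
  rw [e3] at e4
  rw [mul_right_cancel e4]

/-- Iterated transport permutes the finitely many arrows, so every arrow returns to itself. -/
theorem exists_period (hθ : Γ.ActsOn θ C) (h : Γ.IsTame) (hC : C.Finite) {r : ℕ} {w : G × G}
    (hw : w ∈ Γ.arrows C r) : ∃ m : ℕ, 0 < m ∧ (nextPair θ)^[m] w = w := by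
  have : Finite (Γ.arrows C r) := h.finite_arrows hC r
  let f : Γ.arrows C r → Γ.arrows C r := (hθ.mapsTo_arrows h r).restrict
  have hf : Function.Injective f := by
    intro a b hab
    exact Subtype.ext (hθ.injOn_arrows r a.2 b.2 (congrArg Subtype.val hab))
  obtain ⟨m, hm, he⟩ := Function.Injective.mem_periodicPts hf ⟨w, hw⟩
  refine ⟨m, hm, ?_⟩
  have key : ∀ (n : ℕ) (a : Γ.arrows C r), ((f^[n] a : Γ.arrows C r) : G × G) =
      (nextPair θ)^[n] a := by
    intro n
    induction n with
    | zero => exact fun a => rfl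
    | succ n ih => exact fun a => by rw [Function.iterate_succ_apply, ih,
        Function.iterate_succ_apply]; rfl
  rw [← key m ⟨w, hw⟩, he.eq]

theorem iterate_mem_arrows (hθ : Γ.ActsOn θ C) (h : Γ.IsTame) {r : ℕ} {w : G × G}
    (hw : w ∈ Γ.arrows C r) (n : ℕ) : (nextPair θ)^[n] w ∈ Γ.arrows C r :=
  (hθ.mapsTo_arrows h r).iterate n hw

theorem iterate_injOn_arrows (hθ : Γ.ActsOn θ C) (h : Γ.IsTame) (r n : ℕ) :
    Set.InjOn ((nextPair θ)^[n]) (Γ.arrows C r) :=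
  (hθ.injOn_arrows r).iterate (hθ.mapsTo_arrows h r) n

end ActsOn

theorem IsTame.exists_mem_arrows (h : Γ.IsTame) {C : Set G} {Y α : G} (hY : Y ∈ C)
    (hα : cj Y α ∈ C) (hp : α ∈ Γ.pos) : ∃ r, (Y, α) ∈ Γ.arrows C r := by
  obtain ⟨r, -, hr⟩ := h.exists_bounds α
  exact ⟨r, hY, hα, hp, hr⟩

/-- The conjugating elements between sliding circuits are closed under meets. -/
theorem IsTame.cj_gcd_mem_circuits (h : Γ.IsTame) {X Y α β : G} {p q : ℤ} (hpq : p + 2 ≤ q)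
    (hY : Y ∈ Γ.circuits X p q) (hα : α ∈ Γ.pos) (hβ : β ∈ Γ.pos)
    (hYα : cj Y α ∈ Γ.circuits X p q) (hYβ : cj Y β ∈ Γ.circuits X p q) :
    cj Y (Γ.gcd α β) ∈ Γ.circuits X p q := by
  have hθ := h.actsOn_slide (X := X) hpq
  obtain ⟨r, hr⟩ := h.exists_mem_arrows hY hYα hα
  obtain ⟨r', hr'⟩ := h.exists_mem_arrows hY hYβ hβ
  obtain ⟨m, hm, he⟩ := hθ.exists_period h (h.finite_circuits X p q) hr
  obtain ⟨m', hm', he'⟩ := hθ.exists_period h (h.finite_circuits X p q) hr'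
  have h1 := iterate_mem_of_mul he m'
  have h2 := iterate_mem_of_mul he' m
  rw [mul_comm] at h2
  refine ⟨cj_mem_of_mem hY.1 _, ⟨?_, ?_⟩, m * m', Nat.mul_pos hm hm', ?_⟩
  · have b1 := hYα.2.1.1
    have b2 := hYβ.2.1.1
    rw [zpow_prefix_cj_iff] at *
    rw [mul_gcd, h.gcd_mul_zpow, prefix_gcd_iff]
    exact ⟨(gcd_prefix_left _ _).trans b1, (gcd_prefix_right _ _).trans b2⟩
  · have b1 := hYα.2.1.2
    have b2 := hYβ.2.1.2
    rw [cj, mul_assoc, prefix_inv_mul_iff] at *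
    rw [mul_gcd, h.gcd_mul_zpow, prefix_gcd_iff]
    exact ⟨(gcd_prefix_left _ _).trans b1, (gcd_prefix_right _ _).trans b2⟩
  · have e := cj_iterate_nextPair (Γ.slide p q) (Y, Γ.gcd α β) (m * m')
    rw [(isMeet_slide p q).iterate_nextPair_gcd h, h1, h2,
      ← iterate_nextPair_fst (Γ.slide p q) (Y, α), h1] at e
    exact e.symm

/-! ### Minimal conjugating elements -/

/-- `s` is a minimal non-trivial positive element conjugating `Y` into `C`. -/
structure IsMinimalStep (Γ : GarsideStructure G) (C : Set G) (Y s : G) : Prop where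
  mem : Y ∈ C
  cj_mem : cj Y s ∈ C
  pos : s ∈ Γ.pos
  ne_one : s ≠ 1
  minimal : ∀ u ∈ Γ.pos, Γ.Prefix u s → cj Y u ∈ C → u = 1 ∨ u = s

theorem ActsOn.transport_ne_one {θ : G → G} {C : Set G} (hθ : Γ.ActsOn θ C) {Y s : G}
    (hY : Y ∈ C) (hs : cj Y s ∈ C) (h1 : s ≠ 1) : transport θ Y s ≠ 1 := by
  intro he
  apply h1
  have e3 : cj Y s = Y := by
    apply hθ.injOn hs hY
    rw [← cj_transport, he, cj_one]
  have := mul_transport θ Y s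
  rw [e3, he, mul_one] at this
  exact mul_eq_right.mp this.symm

/-- Transport preserves minimality of conjugating elements. -/
theorem ActsOn.isMinimalStep_next {θ : G → G} {C : Set G} (hθ : Γ.ActsOn θ C) (h : Γ.IsTame)
    (hC : C.Finite) {Y s : G} (hs : Γ.IsMinimalStep C Y s) :
    Γ.IsMinimalStep C (next θ Y) (transport θ Y s) := by
  obtain ⟨S, hS⟩ := hθ.isMeet
  obtain ⟨r, hr⟩ := h.exists_mem_arrows hs.mem hs.cj_mem hs.pos
  refine ⟨hθ.mapsTo hs.mem, by rw [cj_transport]; exact hθ.mapsTo hs.cj_mem,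
    hS.transport_mem_pos h hs.pos, hθ.transport_ne_one hs.mem hs.cj_mem hs.ne_one, ?_⟩
  intro u hu hus hYu
  -- transport `u` further until it is back at `Y`
  obtain ⟨m, hm, he⟩ := hθ.exists_period h hC hr
  obtain ⟨n, rfl⟩ : ∃ n, m = n + 1 := ⟨m - 1, by omega⟩
  have hr1 : (next θ Y, transport θ Y s) ∈ Γ.arrows C r := hθ.mapsTo_arrows h r hr
  have hr2 : (next θ Y, u) ∈ Γ.arrows C r := ⟨hθ.mapsTo hs.mem, hYu, hu, hus.trans hr1.2.2.2⟩
  have hr3 : (next θ Y, (1 : G)) ∈ Γ.arrows C r :=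
    ⟨hθ.mapsTo hs.mem, by rw [cj_one]; exact hθ.mapsTo hs.mem, Γ.pos.one_mem,
      (one_prefix.mpr hu).trans hr2.2.2.2⟩
  have he1 : (nextPair θ)^[n] (next θ Y, transport θ Y s) = (Y, s) := he
  have hfst : ∀ v, ((nextPair θ)^[n] (next θ Y, v)).1 = Y := by
    intro v
    rw [iterate_nextPair_fst]
    have e1 := congrArg Prod.fst he1
    rwa [iterate_nextPair_fst] at e1
  have hmem := hθ.iterate_mem_arrows h hr2 n
  have hle := hS.iterate_nextPair_mono h (Y := next θ Y) hus n
  rw [he1] at hle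
  have hinj := hθ.iterate_injOn_arrows h r n
  have hcj := hmem.2.1
  rw [hfst] at hcj
  rcases hs.minimal _ hmem.2.2.1 hle hcj with h1 | h1
  · left
    have : (nextPair θ)^[n] (next θ Y, u) = (nextPair θ)^[n] (next θ Y, 1) :=
      Prod.ext (by rw [hfst, hfst]) (by rw [h1, iterate_nextPair_one])
    exact congrArg Prod.snd (hinj hr2 hr3 this)
  · right
    have : (nextPair θ)^[n] (next θ Y, u) = (nextPair θ)^[n] (next θ Y, transport θ Y s) :=
      Prod.ext (by rw [hfst, hfst]) (by rw [h1, he1])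
    exact congrArg Prod.snd (hinj hr2 hr1 this)

theorem ActsOn.isMinimalStep_iterate {θ : G → G} {C : Set G} (hθ : Γ.ActsOn θ C) (h : Γ.IsTame)
    (hC : C.Finite) {Y s : G} (hs : Γ.IsMinimalStep C Y s) (n : ℕ) :
    Γ.IsMinimalStep C ((next θ)^[n] Y) ((nextPair θ)^[n] (Y, s)).2 := by
  induction n generalizing Y s with
  | zero => exact hs
  | succ n ih => exact ih (hθ.isMinimalStep_next h hC hs)

/-- A subset of `C` closed under minimal steps contains every element of `C` conjugate to one of
its elements. -/
theorem IsTame.mem_of_minimalStep_closed (h : Γ.IsTame) {C D : Set G} (hDC : D ⊆ C)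
    (hD : ∀ Y ∈ D, ∀ s, Γ.IsMinimalStep C Y s → cj Y s ∈ D) {Z α : G} (hZ : Z ∈ D)
    (hα : α ∈ Γ.pos) (hY : cj Z α ∈ C) : cj Z α ∈ D := by
  induction hn : Γ.norm α using Nat.strong_induction_on generalizing Z α with
  | _ n ih =>
  by_cases h1 : α = 1
  · rwa [h1, cj_one]
  let P : ℕ → Prop := fun j => ∃ u ∈ Γ.pos, Γ.Prefix u α ∧ u ≠ 1 ∧ cj Z u ∈ C ∧ Γ.norm u = j
  have hP : ∃ j, P j := ⟨_, α, hα, prefix_refl α, h1, hY, rfl⟩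
  classical
  obtain ⟨u, hu, huα, hu1, hZu, hj⟩ := Nat.find_spec hP
  have hmin : Γ.IsMinimalStep C Z u := by
    refine ⟨hDC hZ, hZu, hu, hu1, fun v hv hvu hZv => ?_⟩
    by_contra! hne
    have hlt := h.norm_lt hv hvu hne.2
    exact Nat.find_min hP (m := Γ.norm v) (by omega) ⟨v, hv, hvu.trans huα, hne.1, hZv, rfl⟩
  obtain ⟨β, hβ, rfl⟩ := huα.exists_mul
  have := h.homog _ hu _ hβ
  have := norm_pos_of_ne_one hu hu1
  rw [← cj_cj] at hY ⊢
  exact ih (Γ.norm β) (by omega) (hD Z hZ u hmin) hβ hY rfl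

theorem IsMinimalStep.gcd_eq (h : Γ.IsTame) {X Y s a : G} {p q : ℤ} (hpq : p + 2 ≤ q)
    (hs : Γ.IsMinimalStep (Γ.circuits X p q) Y s) (ha : a ∈ Γ.pos)
    (hYa : cj Y a ∈ Γ.circuits X p q) : Γ.gcd s a = 1 ∨ Γ.Prefix s a := by
  rcases hs.minimal _ (gcd_mem_pos hs.pos ha) (gcd_prefix_left _ _)
    (h.cj_gcd_mem_circuits hpq hs.mem hs.pos ha hs.cj_mem hYa) with h1 | h1
  · exact Or.inl h1
  · exact Or.inr (gcd_eq_left_iff.mp h1)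

theorem IsMinimalStep.prefix_delta (h : Γ.IsTame) {X Y s : G} {p q : ℤ} (hpq : p + 2 ≤ q)
    (hs : Γ.IsMinimalStep (Γ.circuits X p q) Y s) : Γ.Prefix s Γ.delta := by
  have hd : cj Y Γ.delta ∈ Γ.circuits X p q := by
    simpa using h.cj_zpow_mem_circuits hs.mem 1
  rcases hs.gcd_eq h hpq Γ.delta_mem hd with h1 | h1
  · exact absurd h1 (h.gcd_delta_ne_one hs.pos hs.ne_one)
  · exact h1

theorem IsTame.cj_kappa_mem_circuits (h : Γ.IsTame) {X Y : G} {p q : ℤ} (hpq : p + 2 ≤ q)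
    (hY : Y ∈ Γ.circuits X p q) : cj Y (Γ.kappa q Y) ∈ Γ.circuits X p q := by
  have := h.cj_zpow_mem_circuits ((h.actsOn_dec hpq).mapsTo hY) 1
  rwa [next, cj_cj, zpow_one, h.dec_mul_delta] at this

/-- A simple element coprime to both the initial factor and the complement of the final factor of
an element of the super summit set does not keep the infimum. -/
theorem IsTame.eq_one_of_coprime (h : Γ.IsTame) {Z s : G} {p : ℤ} {L : List G}
    (hZ : Γ.IsLeftNormalForm Z p L) (hL : L ≠ []) (hs : s ∈ Γ.simples)
    (hp : Γ.Prefix (Γ.delta ^ p) (cj Z s)) (hι : Γ.gcd s (Γ.iota p Z) = 1)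
    (hκ : Γ.gcd s (Γ.kappa (p + L.length) Z) = 1) : s = 1 := by
  rw [← h.dec_mul_delta, h.dec_of_isLeftNormalForm hZ] at hκ
  rw [h.iota_of_isLeftNormalForm hZ] at hι
  obtain ⟨hZ1, hZ2, hZ3⟩ := hZ
  have hc : (L ++ [s]).IsChain Γ.LeftWeighted := by
    refine List.isChain_append.mpr ⟨hZ3, by simp, ?_⟩
    intro a ha b hb
    simp only [List.head?_cons, Option.mem_def, Option.some.injEq] at hb
    subst hb
    rw [leftWeighted_iff]
    rw [List.getLastD_eq_getLast?, Option.mem_def.mp ha] at hκ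
    simpa using hκ
  obtain ⟨A, L', rfl⟩ := List.exists_cons_of_ne_nil hL
  have h1 := h.gcd_prod_delta A (L' ++ [s]) (by
    intro B hB
    rw [← List.cons_append, List.mem_append, List.mem_singleton] at hB
    rcases hB with hB | rfl
    · exact (hZ2 B hB).1
    · exact hs) hc
  rw [← List.cons_append, List.prod_append, List.prod_singleton] at h1
  have h2 : Γ.Prefix (Γ.delta ^ (-p) * s * Γ.delta ^ p) ((A :: L').prod * s) := by
    rw [zpow_prefix_cj_iff, hZ1] at hp
    rw [mul_assoc, prefix_iff_mul]
    simpa [mul_assoc] using hp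
  have h3 : Γ.Prefix (Γ.delta ^ (-p) * s * Γ.delta ^ p) Γ.delta := by
    have e : Γ.delta = Γ.delta ^ (-p) * (Γ.delta * Γ.delta ^ p) := by group
    conv_rhs => rw [e]
    rw [mul_assoc, prefix_mul_left_iff, h.prefix_mul_zpow_iff]
    exact (mem_simples_iff.mp hs).2
  have h4 := prefix_gcd_iff.mpr ⟨h2, h3⟩
  rw [h1] at h4
  rw [← hι, eq_comm, gcd_eq_left_iff, ← h.prefix_mul_zpow_iff p, ← prefix_mul_left_iff
    (g := Γ.delta ^ (-p))]
  simpa [mul_assoc] using h4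

/-! ### Reduced conjugators of atoms -/

/-- The positive element `R` is reduced with respect to the atom `x`: it does not begin with `x`,
nor with a non-trivial `z` such that `x z` is simple. In either case `x` conjugated by the prefix
would again be an atom, and `R⁻¹ x R` would have a shorter expression of the same form. -/
structure IsReduced (Γ : GarsideStructure G) (x R : G) : Prop where
  atom : x ∈ Γ.atoms
  pos : R ∈ Γ.pos
  not_prefix : ¬ Γ.Prefix x R
  eq_one : ∀ z ∈ Γ.pos, Γ.Prefix z R → Γ.Prefix (x * z) Γ.delta → z = 1

theorem IsTame.suffix_prefix_zpow (h : Γ.IsTame) {a s : G} {m : ℤ} (ha : a ∈ Γ.pos)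
    (has : Γ.Prefix (a * s) (Γ.delta ^ m)) : Γ.Prefix s (Γ.delta ^ m) := by
  rw [prefix_iff_mul] at has
  refine has.trans ?_
  rw [prefix_inv_mul_iff]
  exact h.delta_prefix_mul_delta ha m

/-- Stripping prefixes from `R`, every `R⁻¹ x R` is written with a reduced conjugating element. -/
theorem IsTame.exists_isReduced (h : Γ.IsTame) {x R : G} {n : ℤ} (hx : x ∈ Γ.atoms)
    (hR : R ∈ Γ.pos) (hn : Γ.Prefix R (Γ.delta ^ n)) :
    ∃ x₁ ∈ conjugatesOf x ∩ Γ.atoms, ∃ R₁, Γ.Prefix R₁ (Γ.delta ^ n) ∧ cj x R = cj x₁ R₁ ∧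
      Γ.IsReduced x₁ R₁ := by
  induction hm : Γ.norm R using Nat.strong_induction_on generalizing x R with
  | _ m ih =>
  have step : ∀ z ∈ Γ.pos, z ≠ 1 → Γ.Prefix z R → cj x z ∈ Γ.atoms →
      ∃ x₁ ∈ conjugatesOf x ∩ Γ.atoms, ∃ R₁, Γ.Prefix R₁ (Γ.delta ^ n) ∧ cj x R = cj x₁ R₁ ∧
        Γ.IsReduced x₁ R₁ := by
    intro z hz hz1 hzR hxz
    obtain ⟨R', hR', rfl⟩ := hzR.exists_mul
    have := h.homog _ hz _ hR'
    have := norm_pos_of_ne_one hz hz1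
    obtain ⟨x₁, hx₁, R₁, h1, h2, h3⟩ := ih _ (by omega) hxz hR' (h.suffix_prefix_zpow hz hn) rfl
    refine ⟨x₁, ⟨?_, hx₁.2⟩, R₁, h1, by rw [← cj_cj, h2], h3⟩
    obtain ⟨g, rfl⟩ := mem_conjugatesOf_iff_cj.mp hx₁.1
    rw [cj_cj]
    exact cj_mem_conjugatesOf _ _
  by_cases hxR : Γ.Prefix x R
  · exact step x hx.1 hx.2.1 hxR (by simpa [cj] using hx)
  by_cases hz : ∃ z ∈ Γ.pos, z ≠ 1 ∧ Γ.Prefix z R ∧ Γ.Prefix (x * z) Γ.delta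
  · obtain ⟨z, hz, hz1, hzR, hxz⟩ := hz
    exact step z hz hz1 hzR (h.conj_atom hx hz hxz)
  · push Not at hz
    refine ⟨x, ⟨mem_conjugatesOf_iff_cj.mpr ⟨1, (cj_one x).symm⟩, hx⟩, R, hn, rfl, hx, hR, hxR,
      fun z hz0 hz1 hz2 => ?_⟩
    by_contra hne
    exact hz z hz0 hne hz1 hz2

theorem IsReduced.not_delta_prefix (h : Γ.IsTame) {x R : G} (hR : Γ.IsReduced x R) :
    ¬ Γ.Prefix Γ.delta R := fun hd =>
  hR.not_prefix ((mem_simples_iff.mp (h.atom_mem_simples hR.atom)).2.trans hd)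

/-! ### Words of the form `Aₙ ⋯ A₁ xᵏ B₁ ⋯ Bₙ` -/

/-- Complementarity means that `δ⁻ⁿ Aₙ ⋯ A₁` is the inverse of `B₁ ⋯ Bₙ`. -/
theorem Complementary.prod_eq {n : ℕ} {A B : Fin n → G} (hAB : Γ.Complementary A B) :
    Γ.delta ^ (-(n : ℤ)) * (List.ofFn A).reverse.prod = (List.ofFn B).prod⁻¹ := by
  induction n with
  | zero => simp
  | succ n ih =>
    have h1 := ih (A := fun i => A i.castSucc) (B := fun i => B i.castSucc)
      (fun i => hAB i.castSucc)
    have h2 := (hAB (Fin.last n)).2.2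
    rw [List.ofFn_succ', List.ofFn_succ', List.concat_eq_append, List.concat_eq_append,
      List.reverse_append, List.prod_append, List.prod_append, List.reverse_singleton,
      List.prod_singleton, List.prod_singleton, mul_inv_rev, ← h1]
    simp only [Fin.val_last] at h2
    have h3 : Γ.delta ^ (-((n + 1 : ℕ) : ℤ)) * A (Fin.last n) =
        (B (Fin.last n))⁻¹ * Γ.delta ^ (-(n : ℤ)) := by
      rw [zpow_neg, zpow_natCast, zpow_neg, zpow_natCast, inv_mul_eq_iff_eq_mul, ← h2]
      group
    rw [← mul_assoc, h3, mul_assoc]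

/-- The elements `Aᵢ` complementary to given `Bᵢ`. -/
def complement (Γ : GarsideStructure G) {n : ℕ} (B : Fin n → G) (i : Fin n) : G :=
  Γ.delta ^ ((i : ℤ) + 1) * (B i)⁻¹ * Γ.delta ^ (-(i : ℤ))

theorem complement_eq_cj {n : ℕ} (B : Fin n → G) (i : Fin n) :
    Γ.complement B i = cj ((B i)⁻¹ * Γ.delta) (Γ.delta ^ (-((i : ℤ) + 1))) := by
  rw [complement, cj]
  group

theorem IsTame.cj_zpow_mem_simples (h : Γ.IsTame) {a : G} (ha : a ∈ Γ.simples) (m : ℤ) :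
    cj a (Γ.delta ^ m) ∈ Γ.simples := by
  rw [mem_simples_iff] at *
  refine ⟨h.conj_zpow_mem m ha.1, ?_⟩
  have : Γ.delta = (Γ.delta ^ m)⁻¹ * (Γ.delta * Γ.delta ^ m) := by group
  conv_rhs => rw [this]
  rw [cj, mul_assoc, prefix_mul_left_iff, h.prefix_mul_zpow_iff]
  exact ha.2

theorem IsTame.complement_mem_simples (h : Γ.IsTame) {a : G} (ha : a ∈ Γ.simples) :
    a⁻¹ * Γ.delta ∈ Γ.simples := by
  rw [mem_simples_iff] at *
  refine ⟨ha.2, ?_⟩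
  rw [prefix_inv_mul_iff]
  simpa using h.delta_prefix_mul_delta ha.1 1

theorem IsTame.gcd_cj_zpow (h : Γ.IsTame) (a b : G) (m : ℤ) :
    Γ.gcd (cj a (Γ.delta ^ m)) (cj b (Γ.delta ^ m)) = cj (Γ.gcd a b) (Γ.delta ^ m) := by
  simp only [cj]
  rw [mul_gcd, h.gcd_mul_zpow]

theorem IsTame.complementary_complement (h : Γ.IsTame) {n : ℕ} {B : Fin n → G}
    (hB : ∀ i, B i ∈ Γ.simples) : Γ.Complementary (Γ.complement B) B := by
  refine fun i => ⟨?_, hB i, ?_⟩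
  · rw [complement_eq_cj]
    exact h.cj_zpow_mem_simples (h.complement_mem_simples (hB i)) _
  · rw [complement, ← zpow_natCast, ← zpow_natCast]
    push_cast
    group

theorem complement_ne {n : ℕ} {B : Fin n → G} {i : Fin n} (h1 : B i ≠ 1)
    (hd : B i ≠ Γ.delta) : Γ.complement B i ≠ 1 ∧ Γ.complement B i ≠ Γ.delta := by
  have e : ∀ c, Γ.complement B i = c → (B i)⁻¹ = Γ.delta ^ (-((i : ℤ) + 1)) * c * Γ.delta ^ (i : ℤ) := by
    rintro c rfl
    rw [complement]
    group
  constructor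
  · intro hc
    apply hd
    rw [← inv_inj, e _ hc]
    group
  · intro hc
    apply h1
    rw [← inv_inj, e _ hc]
    group

theorem IsTame.isChain_complement (h : Γ.IsTame) {n : ℕ} {B : Fin n → G}
    (hc : (List.ofFn B).IsChain Γ.LeftWeighted) :
    (List.ofFn (Γ.complement B)).reverse.IsChain Γ.LeftWeighted := by
  rw [List.isChain_reverse, List.isChain_ofFn]
  rw [List.isChain_ofFn] at hc
  intro i hi
  have h1 := leftWeighted_iff.mp (hc i hi)
  change Γ.LeftWeighted _ _
  rw [leftWeighted_iff]
  have e1 : (Γ.complement B ⟨i + 1, hi⟩)⁻¹ * Γ.delta =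
      cj (B ⟨i + 1, hi⟩) (Γ.delta ^ (-((i : ℤ) + 1))) := by
    rw [complement, cj]
    push_cast
    group
  rw [e1, complement_eq_cj, h.gcd_cj_zpow, gcd_comm, h1]
  simp [cj]

theorem leftWeighted_self (hsq : Γ.IsSquareFree) {x : G} (hx : x ∈ Γ.atoms) (h : Γ.IsTame) :
    Γ.LeftWeighted x x := by
  rw [leftWeighted_iff, gcd_comm]
  refine gcd_atom_eq_one hx (mem_simples_iff.mp (h.atom_mem_simples hx)).2 fun hp => ?_
  rw [← prefix_iff_mul] at hp
  exact hsq (x * x) (mem_simples_iff.mpr ⟨Γ.pos.mul_mem hx.1 hx.1, hp⟩)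
    ⟨1, Γ.pos.one_mem, 1, Γ.pos.one_mem, x, hx, by simp [sq]⟩

theorem isChain_replicate_atom (h : Γ.IsTame) {x : G} (hx : x ∈ Γ.atoms) {k : ℕ}
    (hsq : 2 ≤ k → Γ.IsSquareFree) : (List.replicate k x).IsChain Γ.LeftWeighted := by
  rcases Nat.lt_or_ge k 2 with hk | hk
  · interval_cases k <;> simp
  · exact List.isChain_replicate_of_rel k (leftWeighted_self (hsq hk) hx h)

theorem IsReduced.leftWeighted_head (h : Γ.IsTame) {x B : G} {L : List G}
    (hR : Γ.IsReduced x L.prod) (hB : B ∈ L.head?) (hL : ∀ A ∈ L, A ∈ Γ.simples) :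
    Γ.LeftWeighted x B ∧ ¬ Γ.Prefix x B := by
  obtain ⟨L', rfl⟩ : ∃ L', L = B :: L' := by
    cases L with
    | nil => simp at hB
    | cons C L => exact ⟨L, by simp at hB; rw [hB]⟩
  have hBR : Γ.Prefix B (B :: L').prod := by
    rw [List.prod_cons]
    exact prefix_mul_right (list_prod_mem_pos fun C hC =>
      (mem_simples_iff.mp (hL C (by simp [hC]))).1)
  have hBs := mem_simples_iff.mp (hL B (by simp))
  have hx := mem_simples_iff.mp (h.atom_mem_simples hR.atom)
  refine ⟨?_, fun hp => hR.not_prefix (hp.trans hBR)⟩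
  rw [leftWeighted_iff, gcd_eq_one_iff hBs.1 hx.2]
  intro t ht h1 h2
  exact hR.eq_one t ht (h1.trans hBR) (prefix_iff_mul.mpr h2)

theorem IsReduced.isChain_replicate_append (h : Γ.IsTame) {x : G} {L : List G} {k : ℕ}
    (hR : Γ.IsReduced x L.prod) (hL : ∀ A ∈ L, A ∈ Γ.simples)
    (hc : L.IsChain Γ.LeftWeighted) (hsq : 2 ≤ k → Γ.IsSquareFree) :
    (List.replicate k x ++ L).IsChain Γ.LeftWeighted := by
  refine List.isChain_append.mpr ⟨isChain_replicate_atom h hR.atom hsq, hc, ?_⟩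
  intro a ha B hB
  rw [Option.mem_def, List.getLast?_replicate] at ha
  split_ifs at ha
  obtain rfl : x = a := by simpa using ha
  exact (hR.leftWeighted_head h hB hL).1

theorem IsReduced.leftWeighted_complement {x : G} {n : ℕ} {B : Fin n → G}
    (h : Γ.IsTame) (hR : Γ.IsReduced x (List.ofFn B).prod) (hB : ∀ i, B i ∈ Γ.simples)
    {A : G} (hA : A ∈ (List.ofFn (Γ.complement B)).reverse.getLast?) :
    Γ.LeftWeighted A x := by
  cases n with
  | zero => simp at hA
  | succ n =>
    rw [List.getLast?_reverse, List.ofFn_succ] at hA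
    obtain rfl : Γ.complement B 0 = A := by simpa using hA
    have e : (Γ.complement B 0)⁻¹ * Γ.delta = B 0 := by
      rw [complement]
      simp
    have hB' : ∀ A ∈ List.ofFn B, A ∈ Γ.simples := by
      intro A hA
      obtain ⟨i, rfl⟩ := (List.mem_ofFn' B A).mp hA
      exact hB i
    rw [leftWeighted_iff, e, gcd_comm]
    refine gcd_atom_eq_one hR.atom (mem_simples_iff.mp (hB 0)).1
      (hR.leftWeighted_head h ?_ hB').2
    simp [List.ofFn_succ]

/-- The word `Aₙ ⋯ A₁ · xᵏ · B₁ ⋯ Bₙ · M` is a left normal form if `xᵏ · B₁ ⋯ Bₙ · M` is. -/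
theorem IsReduced.isLeftNormalForm (h : Γ.IsTame) {x : G} {n k : ℕ} {B : Fin n → G} {M : List G}
    (hk : 0 < k) (hxδ : x ≠ Γ.delta) (hR : Γ.IsReduced x (List.ofFn B).prod)
    (hB : ∀ i, B i ∈ Γ.simples ∧ B i ≠ 1 ∧ B i ≠ Γ.delta)
    (hc : (List.replicate k x ++ List.ofFn B ++ M).IsChain Γ.LeftWeighted)
    (hM : ∀ A ∈ M, A ∈ Γ.simples ∧ A ≠ 1 ∧ A ≠ Γ.delta) :
    Γ.IsLeftNormalForm (cj (x ^ k) (List.ofFn B).prod * M.prod) (-(n : ℤ))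
      ((List.ofFn (Γ.complement B)).reverse ++ List.replicate k x ++ List.ofFn B ++ M) := by
  have hAB := h.complementary_complement fun i => (hB i).1
  refine ⟨?_, ?_, ?_⟩
  · rw [List.prod_append, List.prod_append, List.prod_append, ← mul_assoc, ← mul_assoc,
      ← mul_assoc, hAB.prod_eq, List.prod_replicate, cj]
  · intro A hA
    simp only [List.mem_append, List.mem_reverse] at hA
    rcases hA with ((hA | hA) | hA) | hA
    · obtain ⟨i, rfl⟩ := (List.mem_ofFn' _ A).mp hA
      exact ⟨(hAB i).1, complement_ne (hB i).2.1 (hB i).2.2⟩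
    · obtain rfl := List.eq_of_mem_replicate hA
      exact ⟨h.atom_mem_simples hR.atom, hR.atom.2.1, hxδ⟩
    · obtain ⟨i, rfl⟩ := (List.mem_ofFn' _ A).mp hA
      exact hB i
    · exact hM A hA
  · rw [List.append_assoc, List.append_assoc, ← List.append_assoc (List.replicate k x)]
    have hcB : (List.ofFn B).IsChain Γ.LeftWeighted :=
      (List.isChain_append.mp (List.isChain_append.mp hc).1).2.1
    refine List.isChain_append.mpr ⟨h.isChain_complement hcB, hc, ?_⟩
    intro A hA C hC
    obtain ⟨k, rfl⟩ : ∃ j, k = j + 1 := ⟨k - 1, by omega⟩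
    obtain rfl : x = C := by simpa [List.replicate_succ] using hC
    exact hR.leftWeighted_complement h (fun i => (hB i).1) hA

/-! ### Conjugates of powers of atoms -/

theorem HasConjugateForm.mem_conjugatesOf {x X : G} {k : ℕ} (hX : Γ.HasConjugateForm x k X) :
    X ∈ conjugatesOf (x ^ k) := by
  obtain ⟨n, A, B, x₁, ⟨hx₁, -⟩, hAB, hX, -⟩ := hX
  obtain ⟨g, rfl⟩ := mem_conjugatesOf_iff_cj.mp hx₁
  rw [List.prod_append, List.prod_append, ← mul_assoc, ← mul_assoc, hAB.prod_eq,
    List.prod_replicate] at hX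
  refine mem_conjugatesOf_iff_cj.mpr ⟨g * (List.ofFn B).prod, ?_⟩
  rw [hX, ← cj_cj, cj_pow, cj.eq_1 (cj x g ^ k)]

/-- If `δ` is an atom, it is the only one. -/
theorem eq_delta_of_delta_mem_atoms (h : Γ.IsTame) {x : G} (hx : x ∈ Γ.atoms)
    (hδ : Γ.delta ∈ Γ.atoms) : x = Γ.delta :=
  (prefix_atom hδ hx.1 (mem_simples_iff.mp (h.atom_mem_simples hx)).2).resolve_left hx.2.1

theorem IsTame.hasConjugateForm (h : Γ.IsTame) {x X : G} {k : ℕ} (hk : 0 < k) (hx : x ∈ Γ.atoms)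
    (hsq : 2 ≤ k → Γ.IsSquareFree) (hxδ : x ≠ Γ.delta) (hX : X ∈ conjugatesOf (x ^ k)) :
    Γ.HasConjugateForm x k X := by
  obtain ⟨R, hR, rfl⟩ := h.exists_pos_cj hX
  obtain ⟨n, -, hn⟩ := h.exists_bounds R
  obtain ⟨x₁, hx₁, R₁, -, he, hred⟩ := h.exists_isReduced hx hR hn
  obtain ⟨L, hL, hc, rfl⟩ := h.exists_chain_ne_delta hred.pos (hred.not_delta_prefix h)
  have hx₁δ : x₁ ≠ Γ.delta := by
    rintro rfl
    exact hxδ (eq_delta_of_delta_mem_atoms h hx hx₁.2)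
  have hLe : List.ofFn L.get = L := List.ofFn_get L
  have hB : ∀ i, L.get i ∈ Γ.simples ∧ L.get i ≠ 1 ∧ L.get i ≠ Γ.delta :=
    fun i => hL _ (List.get_mem L i)
  refine ⟨L.length, Γ.complement L.get, L.get, x₁, hx₁,
    h.complementary_complement fun i => (hB i).1, ?_⟩
  have h1 := IsReduced.isLeftNormalForm (M := []) h hk hx₁δ (hLe.symm ▸ hred) hB (by
    rw [hLe, List.append_nil]
    exact hred.isChain_replicate_append h (fun A hA => (hL A hA).1) hc hsq) (by simp)
  rw [List.prod_nil, mul_one, List.append_nil, cj_pow] at h1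
  rw [cj_pow, he]
  rwa [hLe] at h1 ⊢

/-! ### Products of powers of conjugates of two atoms -/

/-- The element `a` is of the form `R⁻¹ x₁ R` for an atom `x₁` conjugate to `x` and a positive
prefix `R` of `δⁿ`. -/
def Near (Γ : GarsideStructure G) (n : ℕ) (x a : G) : Prop :=
  ∃ x₁ ∈ conjugatesOf x ∩ Γ.atoms, ∃ R ∈ Γ.pos, Γ.Prefix R (Γ.delta ^ (n : ℤ)) ∧ a = cj x₁ R

/-- `X` is conjugate to some `aᵏ vˡ` with `Near n x a` and an atom `v` conjugate to `y`. Level `0`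
means that `X` is conjugate to `x₁ᵏ y₁ˡ` for atoms `x₁`, `y₁`. -/
def HasLevel (Γ : GarsideStructure G) (X x y : G) (k l n : ℕ) : Prop :=
  ∃ a v, Γ.Near n x a ∧ v ∈ conjugatesOf y ∩ Γ.atoms ∧ a ^ k * v ^ l ∈ conjugatesOf X

/-- `N ≥ 1` is the least level of `X`. -/
structure IsLeastLevel (Γ : GarsideStructure G) (X x y : G) (k l N : ℕ) : Prop where
  tame : Γ.IsTame
  hk : 0 < k
  hl : 0 < l
  squareFree : 2 ≤ max k l → Γ.IsSquareFree
  pos : 0 < N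
  hasLevel : Γ.HasLevel X x y k l N
  minimal : ∀ n < N, ¬ Γ.HasLevel X x y k l n

/-- The elements `aᵏ vˡ` of the conjugacy class of `X` at level `N`. -/
def good (Γ : GarsideStructure G) (X x y : G) (k l N : ℕ) : Set G :=
  {Z | Z ∈ conjugatesOf X ∧
    ∃ a v, Γ.Near N x a ∧ v ∈ conjugatesOf y ∩ Γ.atoms ∧ Z = a ^ k * v ^ l}

/-- A presentation `aᵏ vˡ`, `a = R⁻¹ x₁ R`, of an element of the conjugacy class of `X`, where
`R` is reduced with respect to `x₁` and has left normal form `L · B` with `N` factors. -/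
structure IsPresentation (Γ : GarsideStructure G) (X x y : G) (k l N : ℕ)
    (x₁ : G) (L : List G) (B v : G) : Prop where
  left_mem : x₁ ∈ conjugatesOf x ∩ Γ.atoms
  right_mem : v ∈ conjugatesOf y ∩ Γ.atoms
  reduced : Γ.IsReduced x₁ (L ++ [B]).prod
  simples : ∀ A ∈ L ++ [B], A ∈ Γ.simples ∧ A ≠ 1 ∧ A ≠ Γ.delta
  chain : (L ++ [B]).IsChain Γ.LeftWeighted
  length_eq : L.length + 1 = N
  mem : cj (x₁ ^ k) (L ++ [B]).prod * v ^ l ∈ conjugatesOf X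

theorem Near.cj (h : Γ.IsTame) {x a : G} {n : ℕ} (ha : Γ.Near n x a) (m : ℤ) :
    Γ.Near n x (cj a (Γ.delta ^ m)) := by
  obtain ⟨x₁, ⟨hx1, hx2⟩, R, hR, hRn, rfl⟩ := ha
  refine ⟨GarsideStructure.cj x₁ (Γ.delta ^ m), ⟨cj_mem_of_mem hx1 _, h.conj_atom_zpow hx2 m⟩,
    GarsideStructure.cj R (Γ.delta ^ m), h.conj_zpow_mem m hR, ?_, ?_⟩
  · have e : Γ.delta ^ (n : ℤ) = (Γ.delta ^ m)⁻¹ * (Γ.delta ^ (n : ℤ) * Γ.delta ^ m) := by group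
    rw [e, GarsideStructure.cj, mul_assoc, prefix_mul_left_iff, h.prefix_mul_zpow_iff]
    exact hRn
  · rw [cj_cj, cj_cj]
    congr 1
    simp [GarsideStructure.cj, mul_assoc]

theorem cj_mem_conj_atoms (h : Γ.IsTame) {y v g : G} (hv : v ∈ conjugatesOf y ∩ Γ.atoms)
    (hg : g ∈ Γ.pos) (hvg : Γ.Prefix (v * g) Γ.delta) : cj v g ∈ conjugatesOf y ∩ Γ.atoms :=
  ⟨cj_mem_of_mem hv.1 _, h.conj_atom hv.2 hg hvg⟩

theorem prefix_delta_zpow_of_append (h : Γ.IsTame) {L : List G} {C : G}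
    (hL : ∀ A ∈ L, A ∈ Γ.simples) (hC : C ∈ Γ.simples) :
    Γ.Prefix (L.prod * C) (Γ.delta ^ ((L.length + 1 : ℕ) : ℤ)) := by
  have := prod_prefix_delta_pow h (L := L ++ [C]) (by
    intro A hA
    rw [List.mem_append, List.mem_singleton] at hA
    rcases hA with hA | rfl
    · exact hL A hA
    · exact hC)
  simpa using this

namespace IsPresentation

variable {X x y : G} {k l N : ℕ} {x₁ : G} {L : List G} {B v : G}

section
variable (P : Γ.IsPresentation X x y k l N x₁ L B v)
include P

theorem simple_last : B ∈ Γ.simples ∧ B ≠ 1 ∧ B ≠ Γ.delta := P.simples B (by simp)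

theorem simple_init {A : G} (hA : A ∈ L) : A ∈ Γ.simples := (P.simples A (by simp [hA])).1

theorem simple_right (M : Γ.IsLeastLevel X x y k l N) : v ∈ Γ.simples :=
  M.tame.atom_mem_simples P.right_mem.2

theorem delta_notMem_atoms : Γ.delta ∉ Γ.atoms := by
  intro hd
  obtain ⟨h1, h2, h3⟩ := P.simple_last
  rw [mem_simples_iff] at h1
  rcases prefix_atom hd h1.1 h1.2 with h4 | h4
  · exact h2 h4
  · exact h3 h4

theorem prod_prefix (M : Γ.IsLeastLevel X x y k l N) :
    Γ.Prefix (L ++ [B]).prod (Γ.delta ^ (N : ℤ)) := by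
  have := prod_prefix_delta_pow M.tame fun A hA => (P.simples A hA).1
  rwa [List.length_append, List.length_singleton, P.length_eq] at this

/-- If `v g` is simple, then not only `R` but also `R g` does not begin with `x₁`: otherwise
conjugation by a prefix of `g` would lower the level. -/
theorem not_prefix_mul (M : Γ.IsLeastLevel X x y k l N) {g : G} (hg : g ∈ Γ.pos)
    (hvg : Γ.Prefix (v * g) Γ.delta) : ¬ Γ.Prefix x₁ ((L ++ [B]).prod * g) := by
  have h := M.tame
  intro hx
  set R := (L ++ [B]).prod with hR
  have hN := M.pos
  have hx₁ := mem_simples_iff.mp (h.atom_mem_simples P.left_mem.2)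
  have hRN := P.prod_prefix M
  -- shorten `g` so that `R g` becomes a prefix of `δᴺ`
  obtain ⟨g', hg', he⟩ : ∃ g' ∈ Γ.pos, Γ.gcd (R * g) (Γ.delta ^ (N : ℤ)) = R * g' :=
    (prefix_gcd_iff.mpr ⟨prefix_mul_right hg, hRN⟩).exists_mul
  have hgg : Γ.Prefix g' g := by
    rw [← prefix_mul_left_iff (g := R), ← he]
    exact gcd_prefix_left _ _
  have hvg' : Γ.Prefix (v * g') Γ.delta := (hgg.mul_left v).trans hvg
  have hRg' : Γ.Prefix (R * g') (Γ.delta ^ (N : ℤ)) := by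
    rw [← he]
    exact gcd_prefix_right _ _
  have hx' : Γ.Prefix x₁ (R * g') := by
    rw [← he]
    refine prefix_gcd_iff.mpr ⟨hx, hx₁.2.trans ?_⟩
    simpa using zpow_prefix_zpow (Γ := Γ) (m := 1) (n := N) (by omega)
  obtain ⟨w, hw, hwe⟩ : ∃ w ∈ Γ.pos, Γ.gcd (R * g') Γ.delta = x₁ * w :=
    (prefix_gcd_iff.mpr ⟨hx', hx₁.2⟩).exists_mul
  have hxw : Γ.Prefix (x₁ * w) Γ.delta := by
    rw [← hwe]
    exact gcd_prefix_right _ _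
  -- `x₁` commutes with itself, so `x₁ w` conjugates it to the same atom as `w`
  refine M.minimal (N - 1) (by omega) ⟨cj (cj x₁ R) g', cj v g',
    ⟨cj x₁ w, cj_mem_conj_atoms h P.left_mem hw hxw,
      (x₁ * w)⁻¹ * (R * g'), ?_, ?_, ?_⟩, cj_mem_conj_atoms h P.right_mem hg' hvg', ?_⟩
  · rw [← hwe]
    exact gcd_prefix_left _ _
  · have := h.gcd_inv_mul_prefix (by omega) hRg'
    rw [hwe] at this
    rwa [Nat.cast_sub (by omega), Nat.cast_one]
  · rw [cj_cj, cj_cj]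
    simp [cj, mul_assoc]
  · rw [← cj_pow, ← cj_pow, ← cj_pow, ← cj_mul]
    exact cj_mem_of_mem P.mem _

/-- The product `B v` is not simple, as otherwise the level could be lowered. -/
theorem not_prefix_delta (M : Γ.IsLeastLevel X x y k l N) : ¬ Γ.Prefix (B * v) Γ.delta := by
  have h := M.tame
  intro hBv
  have hN := P.length_eq
  refine M.minimal (N - 1) (by omega) ⟨cj x₁ L.prod, cj v B⁻¹,
    ⟨x₁, P.left_mem, L.prod, list_prod_mem_pos fun A hA =>
      (mem_simples_iff.mp (P.simple_init hA)).1, ?_, rfl⟩, ⟨cj_mem_of_mem P.right_mem.1 _, ?_⟩, ?_⟩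
  · have := prod_prefix_delta_pow h fun A hA => P.simple_init hA
    rwa [← hN, Nat.add_sub_cancel]
  · simpa [cj] using h.conj_atom_left P.right_mem.2 (mem_simples_iff.mp P.simple_last.1).1 hBv
  · have := cj_mem_of_mem P.mem B⁻¹
    rwa [cj_mul, cj_cj, List.prod_append, List.prod_singleton, mul_inv_cancel_right, cj_pow,
      cj_pow] at this

theorem not_prefix_complement (M : Γ.IsLeastLevel X x y k l N) :
    ¬ Γ.Prefix v (B⁻¹ * Γ.delta) := fun hp => P.not_prefix_delta M (prefix_iff_mul.mpr hp)

theorem isChain (M : Γ.IsLeastLevel X x y k l N) (i : ℕ) (hi : i ≤ l) :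
    (List.replicate k x₁ ++ (L ++ [B]) ++ List.replicate i v).IsChain Γ.LeftWeighted := by
  have h := M.tame
  refine List.isChain_append.mpr ⟨P.reduced.isChain_replicate_append h
    (fun A hA => (P.simples A hA).1) P.chain fun h2 => M.squareFree (by omega),
    isChain_replicate_atom h P.right_mem.2 fun h2 => M.squareFree (by omega), ?_⟩
  intro A hA C hC
  obtain rfl : B = A := by
    rw [← List.append_assoc, List.getLast?_append] at hA
    simpa using hA
  obtain rfl : v = C := by
    rw [Option.mem_def, List.head?_replicate] at hC
    split_ifs at hC
    simpa using hC
  rw [leftWeighted_iff, gcd_comm]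
  exact gcd_atom_eq_one P.right_mem.2
    (mem_simples_iff.mp (M.tame.complement_mem_simples P.simple_last.1)).1
    (P.not_prefix_complement M)

/-- The left normal form of `aᵏ vˡ`, of which only the first factor `δᴺ B⁻¹ δ¹⁻ᴺ` and the length are
recorded besides its shape. -/
theorem exists_isLeftNormalForm (M : Γ.IsLeastLevel X x y k l N) :
    ∃ L' : List G, L'.length = 2 * N + k + l - 1 ∧
      Γ.IsLeftNormalForm (cj (x₁ ^ k) (L ++ [B]).prod * v ^ l) (-(N : ℤ))
        ((Γ.delta ^ (N : ℤ) * B⁻¹ * Γ.delta ^ (1 - (N : ℤ))) :: L') ∧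
      Γ.HasProductForm x k y l (cj (x₁ ^ k) (L ++ [B]).prod * v ^ l) := by
  have h := M.tame
  have hδ := P.delta_notMem_atoms
  have hl := M.hl
  obtain ⟨D, hD⟩ : ∃ D : Fin N → G, List.ofFn D = L ++ [B] := by
    obtain rfl : (L ++ [B]).length = N := by simpa using P.length_eq
    exact ⟨_, List.ofFn_get _⟩
  have hDs : ∀ i, D i ∈ Γ.simples ∧ D i ≠ 1 ∧ D i ≠ Γ.delta := by
    intro i
    apply P.simples
    rw [← hD]
    exact (List.mem_ofFn' _ _).mpr ⟨i, rfl⟩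
  have hlast : ∀ n (e : N = n + 1), D (Fin.cast e.symm (Fin.last n)) = B := by
    rintro n rfl
    rw [List.ofFn_succ', List.concat_eq_append] at hD
    have := List.append_inj_right' hD rfl
    simpa using this
  have hX := IsReduced.isLeftNormalForm (M := List.replicate l v) h M.hk
    (by rintro rfl; exact hδ P.left_mem.2) (hD.symm ▸ P.reduced) hDs
    (by rw [hD]; exact P.isChain M l le_rfl)
    (by
      intro A hA
      obtain rfl := List.eq_of_mem_replicate hA
      exact ⟨P.simple_right M, P.right_mem.2.2.1, by rintro rfl; exact hδ P.right_mem.2⟩)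
  rw [List.prod_replicate, hD] at hX
  have hform : Γ.HasProductForm x k y l (cj (x₁ ^ k) (L ++ [B]).prod * v ^ l) :=
    ⟨N, Γ.complement D, D, x₁, v, M.pos, P.left_mem, P.right_mem,
      h.complementary_complement fun i => (hDs i).1, by rw [hD]; exact hX⟩
  obtain ⟨n, rfl⟩ : ∃ n, N = n + 1 := ⟨N - 1, by have := M.pos; omega⟩
  have e : (List.ofFn (Γ.complement D)).reverse =
      (Γ.delta ^ ((n + 1 : ℕ) : ℤ) * B⁻¹ * Γ.delta ^ (1 - ((n + 1 : ℕ) : ℤ))) ::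
        (List.ofFn fun i : Fin n => Γ.complement D i.castSucc).reverse := by
    rw [List.ofFn_succ', List.concat_eq_append, List.reverse_append, List.reverse_singleton,
      List.singleton_append]
    congr 1
    rw [complement, ← hlast n rfl]
    simp
  rw [e] at hX
  refine ⟨_, ?_, by simpa using hX, hform⟩
  have := P.length_eq
  simp
  omega

theorem iota_eq (M : Γ.IsLeastLevel X x y k l N) :
    Γ.iota (-(N : ℤ)) (cj (x₁ ^ k) (L ++ [B]).prod * v ^ l) = B⁻¹ * Γ.delta := by
  obtain ⟨L', -, hX, -⟩ := P.exists_isLeftNormalForm M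
  rw [M.tame.iota_of_isLeftNormalForm hX, List.headD_cons]
  group

theorem delta_ne_one : Γ.delta ≠ 1 := by
  intro hδ
  have h1 := mem_simples_iff.mp P.simple_last.1
  rw [hδ] at h1
  exact P.simple_last.2.1 (eq_one_of_prefix_one h1.1 h1.2)

theorem mem_band (M : Γ.IsLeastLevel X x y k l N) :
    cj (x₁ ^ k) (L ++ [B]).prod * v ^ l ∈ Γ.band (-(N : ℤ)) (N + k + l : ℕ) := by
  obtain ⟨L', hL', hX, -⟩ := P.exists_isLeftNormalForm M
  have hδ := P.delta_ne_one
  refine ⟨(M.tame.prefix_lnf_iff hδ hX).mpr le_rfl, (M.tame.lnf_prefix_iff hX hδ).mpr ?_⟩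
  rw [List.length_cons, hL']
  have := M.hk
  omega

end

end IsPresentation

/-! ### Cycling, decycling and sliding of products of powers of atoms -/

theorem IsTame.gcd_delta_replicate (h : Γ.IsTame) {v : G} (hv : v ∈ Γ.atoms) {i : ℕ}
    (hsq : 2 ≤ i → Γ.IsSquareFree) (hi : 0 < i) :
    Γ.gcd ((v ^ i)⁻¹ * Γ.delta ^ (i : ℤ)) Γ.delta = v⁻¹ * Γ.delta := by
  obtain ⟨n, rfl⟩ : ∃ n, i = n + 1 := ⟨i - 1, by omega⟩
  have := h.gcd_complement v (List.replicate n v)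
    (by
      intro A hA
      rw [← List.replicate_succ] at hA
      obtain rfl := List.eq_of_mem_replicate hA
      exact h.atom_mem_simples hv)
    (by rw [← List.replicate_succ]; exact isChain_replicate_atom h hv hsq)
    Γ.pos.one_mem (gcd_eq_left_iff.mpr (one_prefix.mpr hv.1))
  simpa [← List.replicate_succ, List.prod_replicate, -List.prod_cons] using this

theorem IsTame.inv_pow_mul_mem_pos (h : Γ.IsTame) {v : G} (hv : v ∈ Γ.atoms) (i : ℕ) :
    (v ^ i)⁻¹ * Γ.delta ^ (i : ℤ) ∈ Γ.pos := by
  have := prod_prefix_delta_pow h (L := List.replicate i v) (by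
    intro A hA
    obtain rfl := List.eq_of_mem_replicate hA
    exact h.atom_mem_simples hv)
  simpa [List.prod_replicate, Prefix] using this

theorem delta_ne_one_of_mem_atoms (h : Γ.IsTame) {x : G} (hx : x ∈ Γ.atoms) : Γ.delta ≠ 1 := by
  intro hd
  have := mem_simples_iff.mp (h.atom_mem_simples hx)
  rw [hd] at this
  exact hx.2.1 (eq_one_of_prefix_one this.1 this.2)

namespace IsPresentation

variable {X x y : G} {k l N : ℕ} {x₁ : G} {L : List G} {B v : G}

section
variable (P : Γ.IsPresentation X x y k l N x₁ L B v)
include P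

theorem prod_mem_pos : (L ++ [B]).prod ∈ Γ.pos := P.reduced.pos

/-- Conjugating by `g` with `v g` and `B g` simple preserves goodness. -/
theorem cj_mem_good (M : Γ.IsLeastLevel X x y k l N) {g : G} (hg : g ∈ Γ.pos)
    (hv : Γ.Prefix (v * g) Γ.delta) (hB : Γ.Prefix (B * g) Γ.delta) :
    cj (cj (x₁ ^ k) (L ++ [B]).prod * v ^ l) g ∈ Γ.good X x y k l N := by
  refine ⟨cj_mem_of_mem P.mem _, cj x₁ (L.prod * (B * g)), cj v g,
    ⟨x₁, P.left_mem, L.prod * (B * g), ?_, ?_, rfl⟩, cj_mem_conj_atoms M.tame P.right_mem hg hv, ?_⟩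
  · have := Γ.pos.mul_mem P.prod_mem_pos hg
    simpa [mul_assoc] using this
  · rw [← P.length_eq]
    exact prefix_delta_zpow_of_append M.tame (fun A hA => P.simple_init hA)
      (mem_simples_iff.mpr ⟨Γ.pos.mul_mem (mem_simples_iff.mp P.simple_last.1).1 hg, hB⟩)
  · rw [cj_mul, cj_cj, cj_pow, cj_pow, List.prod_append, List.prod_singleton, mul_assoc]

/-- The element `R v⁻ⁱ δⁱ` does not begin with `x₁`; its simple part is that of `R` or `R ∂v`. -/
theorem gcd_eq_one (M : Γ.IsLeastLevel X x y k l N) {i : ℕ} (hi : i ≤ l) :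
    Γ.gcd ((L ++ [B]).prod * ((v ^ i)⁻¹ * Γ.delta ^ (i : ℤ))) x₁ = 1 := by
  have h := M.tame
  have hT := Γ.pos.mul_mem P.prod_mem_pos (h.inv_pow_mul_mem_pos P.right_mem.2 i)
  have hvs := mem_simples_iff.mp (P.simple_right M)
  refine gcd_atom_eq_one P.left_mem.2 hT fun hp => ?_
  rcases Nat.eq_zero_or_pos i with rfl | hi0
  · refine P.not_prefix_mul M (Γ.pos.one_mem) (by simpa using hvs.2) ?_
    simpa using hp
  · have h1 := prefix_gcd_iff.mpr ⟨hp, (mem_simples_iff.mp (h.atom_mem_simples P.left_mem.2)).2⟩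
    rw [← h.gcd_mul_gcd_delta P.prod_mem_pos, h.gcd_delta_replicate P.right_mem.2
      (fun h2 => M.squareFree (by omega)) hi0] at h1
    exact P.not_prefix_mul M hvs.2 (by simp [prefix_refl]) (h1.trans (gcd_prefix_left _ _))

/-- The complement of the final factor of `vⁱ aᵏ vʲ`, for `i + j = l`, is the complement of the last
letter of the word `x₁ᵏ · L · B · vʲ`: the remaining part `R v⁻ⁱ δⁱ` does not interfere. -/
theorem kappa_eq_of_getLast (M : Γ.IsLeastLevel X x y k l N) {i j : ℕ} (hij : i + j = l) {C : G}
    (hC : C ∈ (List.replicate k x₁ ++ (L ++ [B]) ++ List.replicate j v).getLast?) :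
    Γ.kappa (N + k + l : ℕ) (v ^ i * cj (x₁ ^ k) (L ++ [B]).prod * v ^ j) = C⁻¹ * Γ.delta := by
  have h := M.tame
  have hk := M.hk
  have hch := P.isChain M j (by omega)
  have hmem : ∀ A ∈ List.replicate k x₁ ++ (L ++ [B]) ++ List.replicate j v, A ∈ Γ.simples := by
    intro A hA
    rw [List.mem_append, List.mem_append] at hA
    rcases hA with (hA | hA) | hA
    · obtain rfl := List.eq_of_mem_replicate hA
      exact h.atom_mem_simples P.left_mem.2
    · exact (P.simples A hA).1
    · obtain rfl := List.eq_of_mem_replicate hA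
      exact P.simple_right M
  have hlen : (List.replicate k x₁ ++ (L ++ [B]) ++ List.replicate j v).length = N + k + j := by
    have := P.length_eq
    simp
    omega
  have hprod : (List.replicate k x₁ ++ (L ++ [B]) ++ List.replicate j v).prod =
      x₁ ^ k * (L ++ [B]).prod * v ^ j := by
    rw [List.prod_append, List.prod_append, List.prod_replicate, List.prod_replicate]
  obtain ⟨S, hS⟩ : ∃ S, List.replicate k x₁ ++ (L ++ [B]) ++ List.replicate j v = x₁ :: S := by
    obtain ⟨n, rfl⟩ : ∃ n, k = n + 1 := ⟨k - 1, by omega⟩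
    exact ⟨_, rfl⟩
  rw [hS] at hch hmem hlen hprod hC
  have key := h.gcd_complement x₁ S hmem hch
    (Γ.pos.mul_mem P.prod_mem_pos (h.inv_pow_mul_mem_pos P.right_mem.2 i))
    (P.gcd_eq_one M (i := i) (by omega))
  rw [List.getLast?_eq_getLast_of_ne_nil (by simp), Option.mem_some_iff] at hC
  rw [hC, hprod, hlen] at key
  rw [← key, kappa]
  congr 1
  have e : Γ.delta ^ ((N + k + l : ℕ) : ℤ) = Γ.delta ^ (i : ℤ) * Γ.delta ^ ((N + k + j : ℕ) : ℤ) := by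
    rw [← zpow_add, ← hij]
    congr 1
    push_cast
    ring
  rw [e, cj]
  group

theorem kappa_eq_left (M : Γ.IsLeastLevel X x y k l N) {i j : ℕ} (hij : i + j = l) (hj : 0 < j) :
    Γ.kappa (N + k + l : ℕ) (v ^ i * cj (x₁ ^ k) (L ++ [B]).prod * v ^ j) = v⁻¹ * Γ.delta := by
  refine P.kappa_eq_of_getLast M hij ?_
  rw [List.getLast?_append, List.getLast?_replicate, if_neg (by omega)]
  simp

theorem kappa_eq_right (M : Γ.IsLeastLevel X x y k l N) :
    Γ.kappa (N + k + l : ℕ) (v ^ l * cj (x₁ ^ k) (L ++ [B]).prod) = B⁻¹ * Γ.delta := by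
  have := P.kappa_eq_of_getLast M (i := l) (j := 0) (C := B) rfl (by
    rw [← List.append_assoc]
    simp)
  simpa using this

theorem kappa_eq (M : Γ.IsLeastLevel X x y k l N) :
    Γ.kappa (N + k + l : ℕ) (cj (x₁ ^ k) (L ++ [B]).prod * v ^ l) = v⁻¹ * Γ.delta := by
  simpa using P.kappa_eq_left M (i := 0) (j := l) (by omega) M.hl

theorem slide_eq (M : Γ.IsLeastLevel X x y k l N) :
    Γ.slide (-(N : ℤ)) (N + k + l : ℕ) (cj (x₁ ^ k) (L ++ [B]).prod * v ^ l) =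
      Γ.gcd (B⁻¹ * Γ.delta) (v⁻¹ * Γ.delta) := by
  rw [slide, P.iota_eq M, P.kappa_eq M]

theorem cj_mem_good_of_prefix (M : Γ.IsLeastLevel X x y k l N) {g : G} (hg : g ∈ Γ.pos)
    (hgs : Γ.Prefix g (Γ.slide (-(N : ℤ)) (N + k + l : ℕ)
      (cj (x₁ ^ k) (L ++ [B]).prod * v ^ l))) :
    cj (cj (x₁ ^ k) (L ++ [B]).prod * v ^ l) g ∈ Γ.good X x y k l N := by
  rw [P.slide_eq M, prefix_gcd_iff] at hgs
  exact P.cj_mem_good M hg (prefix_iff_mul.mpr hgs.2) (prefix_iff_mul.mpr hgs.1)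

end

end IsPresentation

namespace IsLeastLevel

variable {X x y : G} {k l N : ℕ}

theorem exists_isPresentation_of_near (M : Γ.IsLeastLevel X x y k l N) {a v : G}
    (ha : Γ.Near N x a) (hv : v ∈ conjugatesOf y ∩ Γ.atoms) (hZX : a ^ k * v ^ l ∈ conjugatesOf X) :
    ∃ x₁ L B, Γ.IsPresentation X x y k l N x₁ L B v ∧ a ^ k = cj (x₁ ^ k) (L ++ [B]).prod := by
  have h := M.tame
  obtain ⟨x₀, hx₀, R₀, hR₀, hRN₀, rfl⟩ := ha
  obtain ⟨x₁, hx₁, R, hRN, he, hred⟩ := h.exists_isReduced hx₀.2 hR₀ hRN₀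
  have hx₁' : x₁ ∈ conjugatesOf x ∩ Γ.atoms := by
    refine ⟨?_, hx₁.2⟩
    obtain ⟨g, rfl⟩ := mem_conjugatesOf_iff_cj.mp hx₁.1
    exact cj_mem_of_mem hx₀.1 g
  rw [he] at hZX ⊢
  obtain ⟨L, hL, hc, rfl⟩ := h.exists_chain_ne_delta hred.pos (hred.not_delta_prefix h)
  have hδ : Γ.delta ≠ 1 := delta_ne_one_of_mem_atoms h hx₁.2
  have hle : L.length ≤ N := by
    have := (h.lnf_prefix_iff (X := L.prod) (p := 0) ⟨by simp, hL, hc⟩ hδ).mp hRN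
    omega
  have hlen : L.length = N := by
    by_contra hne
    exact M.minimal L.length (by omega) ⟨_, v, ⟨x₁, hx₁', L.prod, hred.pos,
      prod_prefix_delta_pow h fun A hA => (hL A hA).1, rfl⟩, hv, hZX⟩
  have hpos := M.pos
  obtain ⟨L', B, rfl⟩ : ∃ L' B, L = L' ++ [B] := by
    rcases List.eq_nil_or_concat L with rfl | ⟨L', B, hB⟩
    · simp at hlen
      omega
    · exact ⟨L', B, by simpa using hB⟩
  refine ⟨x₁, L', B, ⟨hx₁', hv, hred, hL, hc, by simpa using hlen, ?_⟩, ?_⟩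
  · rwa [cj_pow]
  · rw [cj_pow]

theorem exists_isPresentation (M : Γ.IsLeastLevel X x y k l N) {Z : G}
    (hZ : Z ∈ Γ.good X x y k l N) : ∃ x₁ L B v, Γ.IsPresentation X x y k l N x₁ L B v ∧
      Z = cj (x₁ ^ k) (L ++ [B]).prod * v ^ l := by
  obtain ⟨hZX, a, v, ha, hv, rfl⟩ := hZ
  obtain ⟨x₁, L, B, P, he⟩ := M.exists_isPresentation_of_near ha hv hZX
  exact ⟨x₁, L, B, v, P, by rw [he]⟩

theorem exists_good (M : Γ.IsLeastLevel X x y k l N) : (Γ.good X x y k l N).Nonempty := by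
  obtain ⟨a, v, ha, hv, hX⟩ := M.hasLevel
  exact ⟨_, hX, a, v, ha, hv, rfl⟩

theorem good_subset_band (M : Γ.IsLeastLevel X x y k l N) :
    Γ.good X x y k l N ⊆ Γ.band (-(N : ℤ)) (N + k + l : ℕ) := by
  intro Z hZ
  obtain ⟨x₁, L, B, v, P, rfl⟩ := M.exists_isPresentation hZ
  exact P.mem_band M

theorem hasProductForm (M : Γ.IsLeastLevel X x y k l N) {Z : G} (hZ : Z ∈ Γ.good X x y k l N) :
    Γ.HasProductForm x k y l Z := by
  obtain ⟨x₁, L, B, v, P, rfl⟩ := M.exists_isPresentation hZ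
  exact (P.exists_isLeftNormalForm M).choose_spec.2.2

theorem delta_ne_one (M : Γ.IsLeastLevel X x y k l N) : Γ.delta ≠ 1 := by
  obtain ⟨Z, hZ⟩ := M.exists_good
  obtain ⟨x₁, L, B, v, P, rfl⟩ := M.exists_isPresentation hZ
  exact P.delta_ne_one

theorem two_le (M : Γ.IsLeastLevel X x y k l N) : -(N : ℤ) + 2 ≤ (N + k + l : ℕ) := by
  have := M.hk
  have := M.hl
  have := M.pos
  omega

/-- Sliding preserves goodness. -/
theorem mapsTo_slide (M : Γ.IsLeastLevel X x y k l N) :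
    Set.MapsTo (next (Γ.slide (-(N : ℤ)) (N + k + l : ℕ))) (Γ.good X x y k l N)
      (Γ.good X x y k l N) := by
  intro Z hZ
  have hb := M.good_subset_band hZ
  obtain ⟨x₁, L, B, v, P, rfl⟩ := M.exists_isPresentation hZ
  exact P.cj_mem_good_of_prefix M (M.tame.slide_mem_pos hb) (prefix_refl _)

/-- Since sliding preserves goodness, it cannot improve the infimum `-N` and the supremum `N + k + l`
of a good element, which are therefore optimal in the conjugacy class. -/
theorem isSummit (M : Γ.IsLeastLevel X x y k l N) :
    Γ.IsSummit X (-(N : ℤ)) (N + k + l : ℕ) := by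
  obtain ⟨Z, hZ⟩ := M.exists_good
  have h := M.tame
  have hδ := M.delta_ne_one
  have key : ∀ i, (next (Γ.slide (-(N : ℤ)) (N + k + l : ℕ)))^[i] Z ∈ Γ.good X x y k l N :=
    fun i => M.mapsTo_slide.iterate i hZ
  refine ⟨M.two_le, hδ, fun W hW hp => ?_, fun W hW hp => ?_, Z, hZ.1, M.good_subset_band hZ⟩
  · obtain ⟨i, hi⟩ := h.exists_iterate_slide M.two_le hZ.1 hW (M.good_subset_band hZ).1 hp
    obtain ⟨x₁, L, B, v, P, he⟩ := M.exists_isPresentation (key i)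
    obtain ⟨L', -, hX, -⟩ := P.exists_isLeftNormalForm M
    rw [he, h.prefix_lnf_iff hδ hX] at hi
    omega
  · obtain ⟨i, hi⟩ := h.exists_iterate_slide' M.two_le hZ.1 hW (M.good_subset_band hZ).2 hp
    obtain ⟨x₁, L, B, v, P, he⟩ := M.exists_isPresentation (key i)
    obtain ⟨L', hL', hX, -⟩ := P.exists_isLeftNormalForm M
    rw [he, h.lnf_prefix_iff hX hδ, List.length_cons, hL'] at hi
    have := M.hk
    omega

theorem exists_good_mem_circuits (M : Γ.IsLeastLevel X x y k l N) :
    ∃ Z ∈ Γ.good X x y k l N, Z ∈ Γ.circuits X (-(N : ℤ)) (N + k + l : ℕ) := by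
  obtain ⟨Z, hZ⟩ := M.exists_good
  have key : ∀ i, (next (Γ.slide (-(N : ℤ)) (N + k + l : ℕ)))^[i] Z ∈ Γ.good X x y k l N :=
    fun i => M.mapsTo_slide.iterate i hZ
  obtain ⟨n, m, hm, he⟩ := exists_iterate_periodic (M.tame.finite_band (-(N : ℤ)) (N + k + l : ℕ))
    fun i => M.good_subset_band (key i)
  exact ⟨_, key n, (key n).1, M.good_subset_band (key n), m, hm, he⟩

theorem mapsTo_cj_zpow (M : Γ.IsLeastLevel X x y k l N) {Z : G} (hZ : Z ∈ Γ.good X x y k l N)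
    (m : ℤ) : cj Z (Γ.delta ^ m) ∈ Γ.good X x y k l N := by
  obtain ⟨h1, a, v, ha, hv, rfl⟩ := hZ
  refine ⟨cj_mem_of_mem h1 _, cj a (Γ.delta ^ m), cj v (Γ.delta ^ m), ha.cj M.tame m,
    ⟨cj_mem_of_mem hv.1 _, M.tame.conj_atom_zpow hv.2 m⟩, ?_⟩
  rw [cj_mul, cj_pow, cj_pow]

end IsLeastLevel

theorem ActsOn.exists_iterate_eq {θ : G → G} {C : Set G} (hθ : Γ.ActsOn θ C) (h : Γ.IsTame)
    (hC : C.Finite) {Y : G} (hY : Y ∈ C) : ∃ m : ℕ, 0 < m ∧ (next θ)^[m] Y = Y := by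
  have hw : (Y, (1 : G)) ∈ Γ.arrows C 0 :=
    ⟨hY, by rwa [cj_one], Γ.pos.one_mem, by simp [prefix_refl]⟩
  obtain ⟨m, hm, he⟩ := hθ.exists_period h hC hw
  refine ⟨m, hm, ?_⟩
  have := iterate_nextPair_fst θ (Y, (1 : G)) m
  rw [he] at this
  exact this.symm

/-- Iterated transport along `θ` of the arrow given by a commuting operator `θ'`. -/
theorem IsMeet.iterate_nextPair_self {θ θ' : G → G} {S S' : Set (ℤ × ℤ)} (hθ : Γ.IsMeet θ S)
    (hθ' : Γ.IsMeet θ' S') (h : Γ.IsTame) (Y : G) (n : ℕ) :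
    ((nextPair θ)^[n] (Y, θ' Y)).2 = θ' ((next θ)^[n] Y) := by
  induction n generalizing Y with
  | zero => rfl
  | succ n ih =>
    rw [Function.iterate_succ_apply, Function.iterate_succ_apply, ← ih]
    simp only [nextPair]
    rw [hθ.transport_self hθ' h]

theorem mul_eq_mul_cj (v b : G) : v * b = b * cj v b := by simp [cj, mul_assoc]

theorem mul_gcd_prefix_delta (B v : G) :
    Γ.Prefix (v * Γ.gcd (B⁻¹ * Γ.delta) (v⁻¹ * Γ.delta)) Γ.delta :=
  prefix_iff_mul.mpr (gcd_prefix_right _ _)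

theorem cj_prod_inv_mul (x₁ B g : G) (L : List G) (k : ℕ) : cj (cj (x₁ ^ k) (L ++ [B]).prod) (B⁻¹ * g) =
      cj x₁ (L.prod * g) ^ k := by
  rw [cj_cj, cj_pow, List.prod_append, List.prod_singleton]
  simp [mul_assoc]

namespace IsPresentation

variable {X x y : G} {k l N : ℕ} {x₁ : G} {L : List G} {B v : G}

section
variable (P : Γ.IsPresentation X x y k l N x₁ L B v)
include P

theorem dec_eq_left (M : Γ.IsLeastLevel X x y k l N) {i j : ℕ} (hij : i + j = l) (hj : 0 < j) :
    Γ.dec (N + k + l : ℕ) (v ^ i * cj (x₁ ^ k) (L ++ [B]).prod * v ^ j) = v⁻¹ := by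
  rw [← mul_left_inj Γ.delta, M.tame.dec_mul_delta, P.kappa_eq_left M hij hj]

theorem dec_eq_right (M : Γ.IsLeastLevel X x y k l N) :
    Γ.dec (N + k + l : ℕ) (v ^ l * cj (x₁ ^ k) (L ++ [B]).prod) = B⁻¹ := by
  rw [← mul_left_inj Γ.delta, M.tame.dec_mul_delta, P.kappa_eq_right M]

theorem next_dec (M : Γ.IsLeastLevel X x y k l N) {i j : ℕ} (hij : i + (j + 1) = l) :
    next (Γ.dec (N + k + l : ℕ)) (v ^ i * cj (x₁ ^ k) (L ++ [B]).prod * v ^ (j + 1)) =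
      v ^ (i + 1) * cj (x₁ ^ k) (L ++ [B]).prod * v ^ j := by
  rw [next, P.dec_eq_left M hij (by omega), cj.eq_1 _ v⁻¹, pow_succ v j, pow_succ' v i]
  group

/-- Decycling `aᵏ vˡ` moves the factors `v` one by one to the left. -/
theorem iterate_next_dec (M : Γ.IsLeastLevel X x y k l N) {i j : ℕ} (hij : i + j = l) :
    (next (Γ.dec (N + k + l : ℕ)))^[i] (cj (x₁ ^ k) (L ++ [B]).prod * v ^ l) =
      v ^ i * cj (x₁ ^ k) (L ++ [B]).prod * v ^ j := by
  induction i generalizing j with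
  | zero => simp [← hij]
  | succ i ih =>
    rw [Function.iterate_succ_apply', ih (j := j + 1) (by omega), P.next_dec M (by omega)]

theorem iterate_next_dec_last (M : Γ.IsLeastLevel X x y k l N) :
    (next (Γ.dec (N + k + l : ℕ)))^[l] (cj (x₁ ^ k) (L ++ [B]).prod * v ^ l) =
      v ^ l * cj (x₁ ^ k) (L ++ [B]).prod := by
  simpa using P.iterate_next_dec M (i := l) (j := 0) rfl

theorem gcd_complement_mem_pos (M : Γ.IsLeastLevel X x y k l N) :
    Γ.gcd (B⁻¹ * Γ.delta) (v⁻¹ * Γ.delta) ∈ Γ.pos :=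
  gcd_mem_pos (mem_simples_iff.mp (M.tame.complement_mem_simples P.simple_last.1)).1
    (mem_simples_iff.mp (M.tame.complement_mem_simples (P.simple_right M))).1

theorem cj_mem_atoms (M : Γ.IsLeastLevel X x y k l N) :
    cj v (Γ.gcd (B⁻¹ * Γ.delta) (v⁻¹ * Γ.delta)) ∈ Γ.atoms :=
  M.tame.conj_atom P.right_mem.2 (P.gcd_complement_mem_pos M) (mul_gcd_prefix_delta B v)

theorem prefix_mul_gcd (M : Γ.IsLeastLevel X x y k l N) :
    Γ.Prefix (Γ.gcd (B⁻¹ * Γ.delta) (v⁻¹ * Γ.delta))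
      (v * Γ.gcd (B⁻¹ * Γ.delta) (v⁻¹ * Γ.delta)) := by
  rw [mul_eq_mul_cj v]
  exact prefix_mul_right (P.cj_mem_atoms M).1

/-- Nothing lies strictly between `b` and `v b = b v'`, as `v'` is an atom. -/
theorem gcd_mul_eq (M : Γ.IsLeastLevel X x y k l N) {c : G}
    (hbc : Γ.Prefix (Γ.gcd (B⁻¹ * Γ.delta) (v⁻¹ * Γ.delta)) c)
    (hc : ¬ Γ.Prefix (v * Γ.gcd (B⁻¹ * Γ.delta) (v⁻¹ * Γ.delta)) c) :
    Γ.gcd (v * Γ.gcd (B⁻¹ * Γ.delta) (v⁻¹ * Γ.delta)) c =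
      Γ.gcd (B⁻¹ * Γ.delta) (v⁻¹ * Γ.delta) := by
  obtain ⟨e, he, heq⟩ := (prefix_gcd_iff.mpr ⟨P.prefix_mul_gcd M, hbc⟩).exists_mul
  have h2 : Γ.Prefix e (cj v (Γ.gcd (B⁻¹ * Γ.delta) (v⁻¹ * Γ.delta))) := by
    rw [← prefix_mul_left_iff (g := Γ.gcd (B⁻¹ * Γ.delta) (v⁻¹ * Γ.delta)), ← heq, ← mul_eq_mul_cj]
    exact gcd_prefix_left _ _
  rcases prefix_atom (P.cj_mem_atoms M) he h2 with rfl | rfl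
  · rw [heq, mul_one]
  · rw [← mul_eq_mul_cj] at heq
    exact absurd (gcd_eq_left_iff.mp heq) hc

/-- By square freeness, `v² g` is not simple. -/
theorem not_sq_prefix (M : Γ.IsLeastLevel X x y k l N) (hl : 2 ≤ l) {g : G} (hg : g ∈ Γ.pos) :
    ¬ Γ.Prefix (v * g) (v⁻¹ * Γ.delta) := by
  intro hp
  rw [← prefix_iff_mul, ← mul_assoc] at hp
  refine M.squareFree (by omega) _ (mem_simples_iff.mpr
    ⟨Γ.pos.mul_mem (Γ.pos.mul_mem P.right_mem.2.1 P.right_mem.2.1) hg, hp⟩)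
    ⟨1, Γ.pos.one_mem, g, hg, v, P.right_mem.2, by rw [one_mul, sq]⟩

/-- The elements `vⁱ aᵏ vʲ` with `i + j = l`, `j > 0`, all have the same preferred prefix
`b = ∂B ∧ ∂v`. -/
theorem slide_eq_of_add (M : Γ.IsLeastLevel X x y k l N) {i j : ℕ} (hij : i + j = l) (hj : 0 < j) :
    Γ.slide (-(N : ℤ)) (N + k + l : ℕ) (v ^ i * cj (x₁ ^ k) (L ++ [B]).prod * v ^ j) =
      Γ.gcd (B⁻¹ * Γ.delta) (v⁻¹ * Γ.delta) := by
  induction i generalizing j with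
  | zero =>
    obtain rfl : j = l := by omega
    simpa using P.slide_eq M
  | succ i ih =>
    have h1 := ih (j := j + 1) (by omega) (by omega)
    have h2 := M.tame.dec_mul_iota M.two_le (v ^ i * cj (x₁ ^ k) (L ++ [B]).prod * v ^ (j + 1))
    rw [P.next_dec M (by omega), P.dec_eq_left M (by omega) (by omega), h1, inv_mul_eq_iff_eq_mul]
      at h2
    rw [slide, h2, P.kappa_eq_left M hij hj]
    exact P.gcd_mul_eq M (gcd_prefix_right _ _)
      (P.not_sq_prefix M (by omega) (P.gcd_complement_mem_pos M))

/-- The initial factor of `vˡ aᵏ` is `v b`. -/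
theorem iota_eq_right (M : Γ.IsLeastLevel X x y k l N) :
    Γ.iota (-(N : ℤ)) (v ^ l * cj (x₁ ^ k) (L ++ [B]).prod) =
      v * Γ.gcd (B⁻¹ * Γ.delta) (v⁻¹ * Γ.delta) := by
  obtain ⟨n, rfl⟩ : ∃ n, l = n + 1 := ⟨l - 1, by have := M.hl; omega⟩
  have h2 := M.tame.dec_mul_iota M.two_le (v ^ n * cj (x₁ ^ k) (L ++ [B]).prod * v ^ (0 + 1))
  rw [P.next_dec M rfl, P.dec_eq_left M rfl (by omega), P.slide_eq_of_add M rfl (by omega),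
    inv_mul_eq_iff_eq_mul] at h2
  simpa using h2

theorem slide_eq_right (M : Γ.IsLeastLevel X x y k l N) :
    Γ.slide (-(N : ℤ)) (N + k + l : ℕ) (v ^ l * cj (x₁ ^ k) (L ++ [B]).prod) =
      Γ.gcd (B⁻¹ * Γ.delta) (v⁻¹ * Γ.delta) := by
  rw [slide, P.iota_eq_right M, P.kappa_eq_right M]
  exact P.gcd_mul_eq M (gcd_prefix_left _ _) fun hp => P.not_prefix_complement M
    ((prefix_mul_right (P.gcd_complement_mem_pos M)).trans hp)

/-- Conjugating by `B⁻¹ g` with `g ≼ B b` replaces the last factor `B` of `R` by `g`, and maps `v` to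
an atom if moreover `v b ≼ B⁻¹ g δ`. -/
theorem near_and_mem (M : Γ.IsLeastLevel X x y k l N) {g : G} (hg : g ∈ Γ.pos)
    (hgB : Γ.Prefix g (B * Γ.gcd (B⁻¹ * Γ.delta) (v⁻¹ * Γ.delta)))
    (hv : Γ.Prefix (v * Γ.gcd (B⁻¹ * Γ.delta) (v⁻¹ * Γ.delta)) (B⁻¹ * g * Γ.delta)) :
    Γ.Near N x (cj x₁ (L.prod * g)) ∧ cj v (B⁻¹ * g) ∈ conjugatesOf y ∩ Γ.atoms := by
  have h := M.tame
  obtain ⟨r, hr, he⟩ := hgB.exists_mul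
  refine ⟨⟨x₁, P.left_mem, L.prod * g, Γ.pos.mul_mem (list_prod_mem_pos fun A hA =>
    (mem_simples_iff.mp (P.simple_init hA)).1) hg, ?_, rfl⟩, cj_mem_of_mem P.right_mem.1 _, ?_⟩
  · rw [← P.length_eq]
    exact prefix_delta_zpow_of_append h (fun A hA => P.simple_init hA)
      (mem_simples_iff.mpr ⟨hg, hgB.trans (prefix_iff_mul.mpr (gcd_prefix_left _ _))⟩)
  · have h1 : Γ.Prefix (r * cj v (Γ.gcd (B⁻¹ * Γ.delta) (v⁻¹ * Γ.delta))) Γ.delta := by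
      rw [mul_eq_mul_cj, mul_assoc, ← prefix_mul_left_iff (g := B), ← mul_assoc, he] at hv
      rw [← prefix_mul_left_iff (g := g)]
      simpa [mul_assoc] using hv
    have h2 := h.conj_atom_left (P.cj_mem_atoms M) hr h1
    have h3 : B⁻¹ * g = Γ.gcd (B⁻¹ * Γ.delta) (v⁻¹ * Γ.delta) * r⁻¹ := by
      rw [inv_mul_eq_iff_eq_mul, ← mul_assoc, he, mul_inv_cancel_right]
    rw [h3, ← cj_cj]
    simpa [cj] using h2

end

end IsPresentation

/-! ### Minimal conjugating elements at products of powers of atoms -/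

theorem IsTame.iterate_next_slide (h : Γ.IsTame) {p q : ℤ} (hpq : p + 2 ≤ q) (n : ℕ) (Y : G) :
    (next (Γ.slide p q))^[n] Y = (next (Γ.iota p))^[n] ((next (Γ.dec q))^[n] Y) := by
  have hc := ((isMeet_iota p).next_comm (isMeet_dec q) h).comp_iterate n
  rw [← Function.comp_apply (f := (next (Γ.iota p))^[n]), ← hc]
  exact congrArg (fun f => f^[n] Y) (funext fun V => (h.next_iota_dec hpq V).symm)

/-- If `v s` is simple for an atom `v`, then `v s` covers `s`, so `v s` is the join of `s` and any
other element below it. -/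
theorem IsTame.mul_prefix_of_cover (h : Γ.IsTame) {v s q c : G} (hv : v ∈ Γ.atoms) (hs : s ∈ Γ.pos)
    (hvs : Γ.Prefix (v * s) Γ.delta) (hq : Γ.Prefix q (v * s)) (hqs : ¬ Γ.Prefix q s)
    (hsc : Γ.Prefix s c) (hqc : Γ.Prefix q c) : Γ.Prefix (v * s) c := by
  rw [mul_eq_mul_cj v] at hq ⊢
  exact prefix_of_cover (h.conj_atom hv hs hvs) hq hqs hsc hqc

namespace IsPresentation

variable {X x y : G} {k l N : ℕ} {x₁ : G} {L : List G} {B v : G}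

section
variable (P : Γ.IsPresentation X x y k l N x₁ L B v)
include P

/-- The transports of `s ≼ ∂v` along the first decyclings of `aᵏ vˡ` are prefixes of `s`, because
`v² s` is not simple. -/
theorem iterate_transport_prefix (M : Γ.IsLeastLevel X x y k l N) {s : G} (hs : s ∈ Γ.pos)
    (hsv : Γ.Prefix s (v⁻¹ * Γ.delta)) {i j : ℕ} (hij : i + (j + 1) = l) :
    Γ.Prefix ((nextPair (Γ.dec (N + k + l : ℕ)))^[i]
        (cj (x₁ ^ k) (L ++ [B]).prod * v ^ l, s)).2 s ∧
      Γ.Prefix ((nextPair (Γ.dec (N + k + l : ℕ)))^[i + 1]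
        (cj (x₁ ^ k) (L ++ [B]).prod * v ^ l, s)).2
        (v * ((nextPair (Γ.dec (N + k + l : ℕ)))^[i]
          (cj (x₁ ^ k) (L ++ [B]).prod * v ^ l, s)).2) := by
  have h := M.tame
  have hiter := fun {i j : ℕ} (hij : i + j = l) => P.iterate_next_dec M hij
  have hkap := P.kappa_eq M
  have hkapi := fun {i j : ℕ} (hij : i + j = l) (hj : 0 < j) => P.kappa_eq_left M hij hj
  have hdeci := fun {i j : ℕ} (hij : i + j = l) (hj : 0 < j) => P.dec_eq_left M hij hj
  set Z := cj (x₁ ^ k) (L ++ [B]).prod * v ^ l with hZ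
  set q : ℤ := ((N + k + l : ℕ) : ℤ) with hq
  have hpos : ∀ i, ((nextPair (Γ.dec q))^[i] (Z, s)).2 ∈ Γ.pos := by
    intro i
    have := (isMeet_dec q).iterate_nextPair_mono h (Y := Z) (one_prefix.mpr hs) i
    rwa [iterate_nextPair_one, one_prefix] at this
  have hle : ∀ {i j : ℕ}, i + (j + 1) = l →
      Γ.Prefix ((nextPair (Γ.dec q))^[i] (Z, s)).2 (v⁻¹ * Γ.delta) := by
    intro i j hij
    have := (isMeet_dec q).iterate_nextPair_mono h (Y := Z) hsv i
    rwa [← hkap, (isMeet_dec q).iterate_nextPair_self (isMeet_kappa q) h, hiter hij,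
      hkapi hij (by omega)] at this
  have hstep : ∀ {i j : ℕ}, i + (j + 1) = l →
      Γ.Prefix ((nextPair (Γ.dec q))^[i + 1] (Z, s)).2
        (v * ((nextPair (Γ.dec q))^[i] (Z, s)).2) := by
    intro i j hij
    rw [Function.iterate_succ_apply']
    have e := iterate_nextPair_fst (Γ.dec q) (Z, s) i
    simp only [nextPair.eq_1 (Γ.dec q) (_ : G × G), transport]
    rw [e]
    rw [hiter hij, hdeci hij (by omega), inv_inv]
    nth_rw 2 [← mul_one (v * _)]
    rw [prefix_mul_left_iff]
    exact gcd_prefix_right _ _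
  refine ⟨?_, hstep hij⟩
  induction i generalizing j with
  | zero => exact prefix_refl _
  | succ i ih =>
    have h1 := ih (j := j + 1) (by omega)
    by_contra hnot
    have hsi := hle (i := i) (j := j + 1) (by omega)
    exact P.not_sq_prefix M (by omega) (hpos i) (h.mul_prefix_of_cover P.right_mem.2 (hpos i)
      (prefix_iff_mul.mpr hsi) (hstep (j := j + 1) (by omega)) (fun hp => hnot (hp.trans h1)) hsi
      (hle hij))

/-- The case of a minimal conjugating element `s ≼ ∂v` with `s ∧ ∂B = 1`: the cycling of `Z ^ s` is
good. Up to conjugation by `δ` it is `Z ^ (B⁻¹ g)`, where `δ⁻¹ g δ` is the transport of `s` along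
cycling, so that it suffices to show `v b ≼ B⁻¹ g δ`. As `v s'` covers `s'` for the transport `s'` of
`s` along `l - 1` decyclings, the transport along one more decycling, which is a prefix of `∂B` but
not of `s'`, brings in the factor `v`. -/
theorem next_iota_mem_good (M : Γ.IsLeastLevel X x y k l N) {s : G}
    (hs : Γ.IsMinimalStep (Γ.circuits X (-(N : ℤ)) (N + k + l : ℕ))
      (cj (x₁ ^ k) (L ++ [B]).prod * v ^ l) s)
    (hsv : Γ.Prefix s (v⁻¹ * Γ.delta)) (hsB : Γ.gcd s (B⁻¹ * Γ.delta) = 1) :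
    next (Γ.iota (-(N : ℤ))) (cj (cj (x₁ ^ k) (L ++ [B]).prod * v ^ l) s) ∈
      Γ.good X x y k l N := by
  have h := M.tame
  have hbpos := P.gcd_complement_mem_pos M
  have hbB := gcd_prefix_left (Γ := Γ) (B⁻¹ * Γ.delta) (v⁻¹ * Γ.delta)
  have hvb := mul_gcd_prefix_delta (Γ := Γ) B v
  have hslide := P.slide_eq M
  have hiota := P.iota_eq M
  have hkap := P.kappa_eq M
  have hnear := fun g => P.near_and_mem M (g := g)
  have hlast := P.iterate_next_dec_last M
  have hmem := P.mem
  set b := Γ.gcd (B⁻¹ * Γ.delta) (v⁻¹ * Γ.delta) with hb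
  obtain ⟨n, hn⟩ : ∃ n, n + (0 + 1) = l := ⟨l - 1, by have := M.hl; omega⟩
  obtain ⟨hu1, hu2⟩ := P.iterate_transport_prefix M hs.pos hsv hn
  rw [show n + 1 = l by omega] at hu2
  set Z := cj (x₁ ^ k) (L ++ [B]).prod * v ^ l with hZ
  set p : ℤ := -(N : ℤ) with hp
  set q : ℤ := ((N + k + l : ℕ) : ℤ) with hq
  have hactd := h.actsOn_dec (X := X) (p := p) (q := q) M.two_le
  -- the transport of `s` along cycling, conjugated by `δ`
  obtain ⟨t, ht⟩ : ∃ t, t = transport (Γ.iota p) Z s := ⟨_, rfl⟩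
  have htpos : t ∈ Γ.pos := ht ▸ (isMeet_iota p).transport_mem_pos h hs.pos
  have hc0 : s * Γ.iota p (cj Z s) = B⁻¹ * Γ.delta * t := by
    rw [ht, ← hiota, mul_transport]
  obtain ⟨g, hg⟩ : ∃ g, g = Γ.delta * t * Γ.delta⁻¹ := ⟨_, rfl⟩
  have hgt : B⁻¹ * g * Γ.delta = B⁻¹ * Γ.delta * t := by rw [hg]; group
  have hgpos : g ∈ Γ.pos := by
    have := h.conj_zpow_mem (-1) htpos
    rw [hg]
    simpa using this
  have hgB : Γ.Prefix g (B * b) := by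
    have h1 := (isMeet_iota p).transport_mono h (Y := Z) hsv
    rw [← hkap, (isMeet_iota p).transport_self (isMeet_kappa q) h, ← ht, ← h.dec_mul_delta] at h1
    have h2 := h.iota_mul_dec (p := p) (q := q) M.two_le Z
    rw [hslide, hiota] at h2
    have h3 : Γ.dec q (next (Γ.iota p) Z) = Γ.delta⁻¹ * (B * b) := by
      rw [← h2]; group
    rw [h3, ← prefix_mul_left_iff (g := Γ.delta)] at h1
    rw [← h.prefix_mul_delta_iff, hg]
    simpa [mul_assoc] using h1
  have hBc : Γ.Prefix (B⁻¹ * Γ.delta) (B⁻¹ * g * Γ.delta) := by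
    rw [hgt]
    exact prefix_mul_right htpos
  have hsc : Γ.Prefix s (B⁻¹ * g * Γ.delta) := by
    rw [hgt, ← hc0]
    exact prefix_mul_right (h.iota_mem_pos hs.cj_mem.2.1.1)
  -- the transport of `s` along `l` decyclings is a prefix of `∂B`, hence not of `s`
  have hstep := fun i => hactd.isMinimalStep_iterate h (h.finite_circuits X p q) hs i
  have hκ : Γ.Prefix ((nextPair (Γ.dec q))^[l] (Z, s)).2 (B⁻¹ * Γ.delta) := by
    have := (isMeet_dec q).iterate_nextPair_mono h (Y := Z) hsv l
    rwa [← hkap, (isMeet_dec q).iterate_nextPair_self (isMeet_kappa q) h, hlast,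
      P.kappa_eq_right M] at this
  have hvc : Γ.Prefix v (B⁻¹ * g * Γ.delta) := by
    refine (prefix_mul_right (hstep n).pos).trans (h.mul_prefix_of_cover P.right_mem.2
      (hstep n).pos (prefix_iff_mul.mpr (hu1.trans hsv)) hu2 ?_ (hu1.trans hsc) (hκ.trans hBc))
    intro hp
    refine (hstep l).ne_one (eq_one_of_prefix_one (hstep l).pos ?_)
    rw [← hsB]
    exact prefix_gcd_iff.mpr ⟨hp.trans hu1, hκ⟩
  have hvbc := h.mul_prefix_of_cover P.right_mem.2 hbpos hvb (prefix_mul_right hbpos)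
    (fun hp => P.not_prefix_complement M (hp.trans hbB)) (hbB.trans hBc) hvc
  obtain ⟨h1, h2⟩ := hnear g hgpos hgB hvbc
  have key : cj Z (B⁻¹ * g) ∈ Γ.good X x y k l N :=
    ⟨cj_mem_of_mem hmem _, _, _, h1, h2, by rw [hZ, cj_mul, cj_prod_inv_mul, cj_pow v]⟩
  have := M.mapsTo_cj_zpow key 1
  rw [zpow_one, cj_cj, hgt, ← hc0, ← cj_cj] at this
  exact this

/-- The case of a minimal conjugating element `s ≼ ∂B` with `s ∧ ∂v = 1`: some power of sliding
maps the decycling of `Z ^ s` to a good element. Here `W = vˡ aᵏ` is the `l`-th decycling of `Z`, and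
the decycling of `W ^ t`, for the transport `t` of `s`, is the `l`-th decycling of `Z ^ (B⁻¹ g)`. -/
theorem iterate_slide_mem_good (M : Γ.IsLeastLevel X x y k l N) {s : G}
    (hs : Γ.IsMinimalStep (Γ.circuits X (-(N : ℤ)) (N + k + l : ℕ))
      (cj (x₁ ^ k) (L ++ [B]).prod * v ^ l) s)
    (hsB : Γ.Prefix s (B⁻¹ * Γ.delta)) (hsv : Γ.gcd s (v⁻¹ * Γ.delta) = 1) :
    (next (Γ.slide (-(N : ℤ)) (N + k + l : ℕ)))^[l]
      (next (Γ.dec (N + k + l : ℕ)) (cj (cj (x₁ ^ k) (L ++ [B]).prod * v ^ l) s)) ∈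
      Γ.good X x y k l N := by
  have h := M.tame
  have hbpos := P.gcd_complement_mem_pos M
  have hbB := gcd_prefix_left (Γ := Γ) (B⁻¹ * Γ.delta) (v⁻¹ * Γ.delta)
  have hvb := mul_gcd_prefix_delta (Γ := Γ) B v
  have hslide := P.slide_eq_right M
  have hiotar := P.iota_eq_right M
  have hiota := P.iota_eq M
  have hkap := P.kappa_eq M
  have hkapr := P.kappa_eq_right M
  have hdecr := P.dec_eq_right M
  have hnear := fun g => P.near_and_mem M (g := g)
  have hlast := P.iterate_next_dec_last M
  have hmem := P.mem
  set b := Γ.gcd (B⁻¹ * Γ.delta) (v⁻¹ * Γ.delta) with hb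
  set Z := cj (x₁ ^ k) (L ++ [B]).prod * v ^ l with hZ
  set W := v ^ l * cj (x₁ ^ k) (L ++ [B]).prod with hW
  set p : ℤ := -(N : ℤ) with hp
  set q : ℤ := ((N + k + l : ℕ) : ℤ) with hq
  have hactd := h.actsOn_dec (X := X) (p := p) (q := q) M.two_le
  have hstep := hactd.isMinimalStep_iterate h (h.finite_circuits X p q) hs l
  have hcjt := cj_iterate_nextPair (Γ.dec q) (Z, s) l
  -- the transport `t` of `s` along `l` decyclings
  have hti : Γ.Prefix ((nextPair (Γ.dec q))^[l] (Z, s)).2 (v * b) := by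
    have := (isMeet_dec q).iterate_nextPair_mono h (Y := Z) hsB l
    rwa [← hiota, (isMeet_dec q).iterate_nextPair_self (isMeet_iota p) h, hlast, hiotar] at this
  have htB : Γ.gcd ((nextPair (Γ.dec q))^[l] (Z, s)).2 (B⁻¹ * Γ.delta) = 1 := by
    have := (isMeet_dec q).iterate_nextPair_gcd h Z s (v⁻¹ * Γ.delta) l
    rw [hsv, iterate_nextPair_one, ← hkap, (isMeet_dec q).iterate_nextPair_self (isMeet_kappa q) h,
      hlast, hkapr] at this
    exact this.symm
  simp only [hlast] at hstep hcjt
  set t := ((nextPair (Γ.dec q))^[l] (Z, s)).2 with ht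
  have htb : ¬ Γ.Prefix t b := by
    intro hp
    refine hstep.ne_one (eq_one_of_prefix_one hstep.pos ?_)
    rw [← htB]
    exact prefix_gcd_iff.mpr ⟨prefix_refl _, hp.trans hbB⟩
  -- the transport of `t` along one more decycling
  obtain ⟨g, hg⟩ : ∃ g, g = transport (Γ.dec q) W t := ⟨_, rfl⟩
  have hgpos : g ∈ Γ.pos := hg ▸ (isMeet_dec q).transport_mem_pos h hstep.pos
  have hgB : Γ.Prefix g (B * b) := by
    have h1 := (isMeet_dec q).transport_mono h (Y := W) hti
    have h2 := h.dec_mul_iota (p := p) (q := q) M.two_le W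
    rw [hslide, hdecr, inv_mul_eq_iff_eq_mul] at h2
    rwa [← hiotar, (isMeet_dec q).transport_self (isMeet_iota p) h, h2, ← hg] at h1
  have hgt : B⁻¹ * g = t * Γ.dec q (cj W t) := by
    rw [hg, ← hdecr, mul_transport]
  have hBc : Γ.Prefix (B⁻¹ * Γ.delta) (B⁻¹ * g * Γ.delta) := by
    rw [mul_assoc, prefix_mul_left_iff]
    simpa using h.delta_prefix_mul_delta hgpos 1
  have htc : Γ.Prefix t (B⁻¹ * g * Γ.delta) := by
    rw [hgt, mul_assoc, h.dec_mul_delta]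
    exact prefix_mul_right (kappa_mem_pos hstep.cj_mem.2.1.2)
  have hvbc := h.mul_prefix_of_cover P.right_mem.2 hbpos hvb hti htb (hbB.trans hBc) htc
  obtain ⟨h1, h2⟩ := hnear g hgpos hgB hvbc
  -- the good element `a'ᵏ v'ˡ` and its `l`-th decycling `v'ˡ a'ᵏ`
  have hY : cj Z (B⁻¹ * g) = cj x₁ (L.prod * g) ^ k * cj v (B⁻¹ * g) ^ l := by
    rw [hZ, cj_mul, cj_prod_inv_mul, cj_pow v]
  have key : cj Z (B⁻¹ * g) ∈ Γ.good X x y k l N := ⟨cj_mem_of_mem hmem _, _, _, h1, h2, hY⟩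
  obtain ⟨x₂, L₂, B₂, P₂, he⟩ := M.exists_isPresentation_of_near h1 h2 (hY ▸ cj_mem_of_mem hmem _)
  have hl2 := P₂.iterate_next_dec_last M
  rw [← he, ← hY] at hl2
  have e1 : next (Γ.dec q) ((next (Γ.dec q))^[l] (cj Z s)) =
      (next (Γ.dec q))^[l] (cj Z (B⁻¹ * g)) := by
    rw [hl2, ← hcjt, next, cj_cj, ← hgt, hW, cj_mul, cj_prod_inv_mul, cj_pow v]
  rw [h.iterate_next_slide M.two_le, ← Function.iterate_succ_apply, Function.iterate_succ_apply', e1, ← h.iterate_next_slide M.two_le]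
  exact M.mapsTo_slide.iterate l key

end

end IsPresentation

namespace IsLeastLevel

variable {X x y : G} {k l N : ℕ}

/-! ### Cycling and decycling orbits -/

/-- As sliding preserves goodness and is periodic on circuits, goodness can be tested after sliding. -/
theorem mem_good_of_iterate_slide (M : Γ.IsLeastLevel X x y k l N) {Y : G}
    (hY : Y ∈ Γ.circuits X (-(N : ℤ)) (N + k + l : ℕ)) (n : ℕ)
    (hn : (next (Γ.slide (-(N : ℤ)) (N + k + l : ℕ)))^[n] Y ∈ Γ.good X x y k l N) :
    Y ∈ Γ.good X x y k l N := by
  obtain ⟨-, -, m, hm, he⟩ := hY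
  have h1 := iterate_mem_of_mul he n
  have h2 : m * n = (m * n - n) + n := by
    have := Nat.le_mul_of_pos_left n hm
    omega
  rw [h2, Function.iterate_add_apply] at h1
  rw [← h1]
  exact M.mapsTo_slide.iterate _ hn

/-- A minimal conjugating element maps a good element to one with a good iterated cycling. The proof
distinguishes whether `s` is a prefix of, or coprime to, `∂B` and `∂v`. -/
theorem exists_iterate_of_isMinimalStep (M : Γ.IsLeastLevel X x y k l N) {Z s : G}
    (hZ : Z ∈ Γ.good X x y k l N)
    (hs : Γ.IsMinimalStep (Γ.circuits X (-(N : ℤ)) (N + k + l : ℕ)) Z s) :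
    ∃ i, (next (Γ.iota (-(N : ℤ))))^[i] (cj Z s) ∈ Γ.good X x y k l N := by
  have h := M.tame
  obtain ⟨x₁, L, B, v, P, rfl⟩ := M.exists_isPresentation hZ
  have hb := M.good_subset_band hZ
  have hι := hs.gcd_eq h M.two_le (h.iota_mem_pos hb.1) ((h.actsOn_iota M.two_le).mapsTo hs.mem)
  have hκ := hs.gcd_eq h M.two_le (kappa_mem_pos hb.2) (h.cj_kappa_mem_circuits M.two_le hs.mem)
  rcases hι with hι | hι <;> rcases hκ with hκ | hκ
  · obtain ⟨L', hL', hX, -⟩ := P.exists_isLeftNormalForm M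
    refine absurd (h.eq_one_of_coprime hX (by simp)
      (mem_simples_iff.mpr ⟨hs.pos, hs.prefix_delta h M.two_le⟩) hs.cj_mem.2.1.1 hι ?_) hs.ne_one
    rw [← hκ]
    congr 2
    rw [List.length_cons, hL']
    have := M.hk
    omega
  · rw [P.iota_eq M] at hι
    rw [P.kappa_eq M] at hκ
    exact ⟨1, P.next_iota_mem_good M hs hκ hι⟩
  · rw [P.iota_eq M] at hι
    rw [P.kappa_eq M] at hκ
    have h1 := P.iterate_slide_mem_good M hs hι hκ
    have hacti := h.actsOn_iota (X := X) (p := -(N : ℤ)) (q := (N + k + l : ℕ)) M.two_le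
    -- the decycling of a periodic point is the sliding of one of its iterated cyclings
    obtain ⟨m, hm, he⟩ := hacti.exists_iterate_eq h (h.finite_circuits _ _ _) hs.cj_mem
    refine ⟨m - 1, M.mem_good_of_iterate_slide (hacti.mapsTo.iterate _ hs.cj_mem) (l + 1) ?_⟩
    obtain ⟨j, rfl⟩ : ∃ j, m = j + 1 := ⟨m - 1, by omega⟩
    rw [Function.iterate_succ_apply'] at he
    rw [Function.iterate_succ_apply, ← h.next_dec_iota M.two_le, Nat.add_sub_cancel, he]
    exact h1
  · exact ⟨0, P.cj_mem_good_of_prefix M hs.pos (prefix_gcd_iff.mpr ⟨hι, hκ⟩)⟩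

/-- Every cycling orbit of circuits contains a good element, since minimal conjugating elements
connect all circuits. -/
theorem exists_iterate_iota (M : Γ.IsLeastLevel X x y k l N) {Y : G}
    (hY : Y ∈ Γ.circuits X (-(N : ℤ)) (N + k + l : ℕ)) :
    ∃ i, (next (Γ.iota (-(N : ℤ))))^[i] Y ∈ Γ.good X x y k l N := by
  have h := M.tame
  obtain ⟨Z, hZ, hZC⟩ := M.exists_good_mem_circuits
  obtain ⟨a, ha⟩ := mem_conjugatesOf_iff_cj.mp hZ.1
  obtain ⟨b, hb⟩ := mem_conjugatesOf_iff_cj.mp hY.1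
  obtain ⟨α, hα, rfl⟩ := h.exists_pos_cj (X := Z) (Y := Y)
    (mem_conjugatesOf_iff_cj.mpr ⟨a⁻¹ * b, by rw [ha, hb, cj_cj]; simp⟩)
  refine (h.mem_of_minimalStep_closed (C := Γ.circuits X (-(N : ℤ)) (N + k + l : ℕ))
    (D := {Y | Y ∈ Γ.circuits X (-(N : ℤ)) (N + k + l : ℕ) ∧
      ∃ i, (next (Γ.iota (-(N : ℤ))))^[i] Y ∈ Γ.good X x y k l N})
    (fun Y hY => hY.1) ?_ ⟨hZC, 0, hZ⟩ hα hY).2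
  rintro Y ⟨hY, i, hi⟩ s hs
  refine ⟨hs.cj_mem, ?_⟩
  obtain ⟨j, hj⟩ := M.exists_iterate_of_isMinimalStep hi
    ((h.actsOn_iota M.two_le).isMinimalStep_iterate h (h.finite_circuits _ _ _) hs i)
  refine ⟨j + i, ?_⟩
  rw [Function.iterate_add_apply]
  rwa [cj_iterate_nextPair _ (Y, s)] at hj

/-- A decycling orbit consists, up to iterated sliding, of the elements of the cycling orbit. -/
theorem exists_iterate_dec (M : Γ.IsLeastLevel X x y k l N) {Y : G}
    (hY : Y ∈ Γ.circuits X (-(N : ℤ)) (N + k + l : ℕ)) :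
    ∃ i, (next (Γ.dec (N + k + l : ℕ)))^[i] Y ∈ Γ.good X x y k l N := by
  have h := M.tame
  obtain ⟨i, hi⟩ := M.exists_iterate_iota hY
  obtain ⟨m, hm, he⟩ := (h.actsOn_iota M.two_le).exists_iterate_eq h (h.finite_circuits _ _ _) hY
  have h1 := iterate_mem_of_mul he i
  have h2 : m * i = (m * i - i) + i := by
    have := Nat.le_mul_of_pos_left i hm
    omega
  rw [h2, Function.iterate_add_apply] at h1
  refine ⟨m * i - i, ?_⟩
  have hc := ((isMeet_iota (-(N : ℤ))).next_comm (isMeet_dec (Γ := Γ) (N + k + l : ℕ)) h).iterate_iterate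
    (m * i - i) (m * i - i)
  rw [← h1, ← hc.eq, ← h.iterate_next_slide M.two_le]
  exact M.mapsTo_slide.iterate _ hi

theorem exists_mem_cyclingOrbit (M : Γ.IsLeastLevel X x y k l N) {Y : G}
    (hY : Y ∈ Γ.slidingCircuits X) : ∃ Z ∈ Γ.cyclingOrbit Y, Γ.HasProductForm x k y l Z := by
  have h := M.tame
  have hC := M.isSummit.mem_circuits h hY
  have e : ∀ i, Γ.cycling^[i] Y = (next (Γ.iota (-(N : ℤ))))^[i] Y := by
    intro i
    induction i with
    | zero => rfl
    | succ i ih =>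
      have hi := (h.actsOn_iota M.two_le).mapsTo.iterate i hC
      rw [Function.iterate_succ_apply', Function.iterate_succ_apply', ih,
        h.cycling_eq M.delta_ne_one, (M.isSummit.inf_eq h hi.1 hi.2.1).1]
  obtain ⟨i, hi⟩ := M.exists_iterate_iota hC
  exact ⟨_, ⟨i, (e i).symm⟩, M.hasProductForm hi⟩

theorem exists_mem_decyclingOrbit (M : Γ.IsLeastLevel X x y k l N) {Y : G}
    (hY : Y ∈ Γ.slidingCircuits X) : ∃ Z ∈ Γ.decyclingOrbit Y, Γ.HasProductForm x k y l Z := by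
  have h := M.tame
  have hC := M.isSummit.mem_circuits h hY
  have e : ∀ i, Γ.decycling^[i] Y = (next (Γ.dec (N + k + l : ℕ)))^[i] Y := by
    intro i
    induction i with
    | zero => rfl
    | succ i ih =>
      have hi := (h.actsOn_dec M.two_le).mapsTo.iterate i hC
      rw [Function.iterate_succ_apply', Function.iterate_succ_apply', ih,
        h.decycling_eq M.delta_ne_one, (M.isSummit.inf_eq h hi.1 hi.2.1).2]
  obtain ⟨i, hi⟩ := M.exists_iterate_dec hC
  exact ⟨_, ⟨i, (e i).symm⟩, M.hasProductForm hi⟩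

end IsLeastLevel

/-! ### Elements of the product of two conjugacy classes -/

theorem conjugatesOf_mul_of_mem {X Y a b : G} (hY : Y ∈ conjugatesOf X)
    (h : Y ∈ conjugatesOf a * conjugatesOf b) : X ∈ conjugatesOf a * conjugatesOf b := by
  obtain ⟨g, rfl⟩ := mem_conjugatesOf_iff_cj.mp hY
  obtain ⟨u, hu, v, hv, he⟩ := Set.mem_mul.mp h
  refine Set.mem_mul.mpr ⟨cj u g⁻¹, cj_mem_of_mem hu _, cj v g⁻¹, cj_mem_of_mem hv _, ?_⟩
  rw [← cj_mul, he, cj_cj, mul_inv_cancel, cj_one]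

theorem HasProductForm.mem_mul {x y X : G} {k l : ℕ} (hX : Γ.HasProductForm x k y l X) :
    X ∈ conjugatesOf (x ^ k) * conjugatesOf (y ^ l) := by
  obtain ⟨n, A, B, x₁, y₁, -, ⟨hx₁, -⟩, ⟨hy₁, -⟩, hAB, hX, -⟩ := hX
  obtain ⟨g, rfl⟩ := mem_conjugatesOf_iff_cj.mp hx₁
  obtain ⟨g', rfl⟩ := mem_conjugatesOf_iff_cj.mp hy₁
  rw [List.prod_append, List.prod_append, List.prod_append, ← mul_assoc, ← mul_assoc, ← mul_assoc,
    hAB.prod_eq, List.prod_replicate, List.prod_replicate] at hX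
  refine Set.mem_mul.mpr ⟨cj (x ^ k) (g * (List.ofFn B).prod), cj_mem_conjugatesOf _ _,
    cj (y ^ l) g', cj_mem_conjugatesOf _ _, ?_⟩
  rw [hX, ← cj_cj, cj_pow x, cj_pow y, cj.eq_1 (cj x g ^ k)]

theorem mem_mul_of_mem_conjugatesOf {x y x₁ y₁ X : G} {k l : ℕ} (hx₁ : x₁ ∈ conjugatesOf x)
    (hy₁ : y₁ ∈ conjugatesOf y) (hX : X ∈ conjugatesOf (x₁ ^ k * y₁ ^ l)) :
    X ∈ conjugatesOf (x ^ k) * conjugatesOf (y ^ l) := by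
  obtain ⟨c, rfl⟩ := mem_conjugatesOf_iff_cj.mp hX
  obtain ⟨g, rfl⟩ := mem_conjugatesOf_iff_cj.mp hx₁
  obtain ⟨g', rfl⟩ := mem_conjugatesOf_iff_cj.mp hy₁
  rw [cj_mul, ← cj_pow, ← cj_pow, cj_cj, cj_cj]
  exact Set.mul_mem_mul (cj_mem_conjugatesOf _ _) (cj_mem_conjugatesOf _ _)

theorem mem_conjugatesOf_symm {X Y : G} (hY : Y ∈ conjugatesOf X) : X ∈ conjugatesOf Y := by
  obtain ⟨g, rfl⟩ := mem_conjugatesOf_iff_cj.mp hY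
  exact mem_conjugatesOf_iff_cj.mpr ⟨g⁻¹, by rw [cj_cj, mul_inv_cancel, cj_one]⟩

theorem IsTame.exists_hasLevel (h : Γ.IsTame) {X x y : G} {k l : ℕ} (hx : x ∈ Γ.atoms)
    (hy : y ∈ Γ.atoms) (hX : X ∈ conjugatesOf (x ^ k) * conjugatesOf (y ^ l)) :
    ∃ n, Γ.HasLevel X x y k l n := by
  obtain ⟨u, hu, w, hw, rfl⟩ := Set.mem_mul.mp hX
  obtain ⟨g, rfl⟩ := mem_conjugatesOf_iff_cj.mp hu
  obtain ⟨g', rfl⟩ := mem_conjugatesOf_iff_cj.mp hw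
  obtain ⟨R, hR, hRe⟩ := h.exists_pos_cj (cj_mem_conjugatesOf x (g * g'⁻¹))
  obtain ⟨n, -, hn⟩ := h.exists_bounds R
  refine ⟨n, cj x R, y, ⟨x, ⟨mem_conjugatesOf_self, hx⟩, R, hR, hn, rfl⟩,
    ⟨mem_conjugatesOf_self, hy⟩, mem_conjugatesOf_iff_cj.mpr ⟨g'⁻¹, ?_⟩⟩
  rw [← hRe, cj_mul, cj_cj, cj_cj, mul_inv_cancel, cj_one, cj_pow]

end GarsideStructure

open GarsideStructure in
theorem theorem1 {G : Type*} [Group G] (Γ : GarsideStructure G)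
    (hfin : Γ.IsFiniteType) (hsym : Γ.IsSymmetric) (hhom : Γ.IsHomogeneous)
    (k l : ℕ) (hk : 0 < k) (hl : 0 < l) (X x y : G) (hx : x ∈ Γ.atoms) (hy : y ∈ Γ.atoms) :
    ((2 ≤ k → Γ.IsSquareFree) → x ≠ Γ.delta →
      (X ∈ conjugatesOf (x ^ k) ↔ Γ.HasConjugateForm x k X)) ∧
    ((2 ≤ max k l → Γ.IsSquareFree) →
      (X ∈ conjugatesOf (x ^ k) * conjugatesOf (y ^ l) ↔
        ((∃ x₁ ∈ conjugatesOf x ∩ Γ.atoms, ∃ y₁ ∈ conjugatesOf y ∩ Γ.atoms,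
            X ∈ conjugatesOf (x₁ ^ k * y₁ ^ l)) ∨
          ((∀ Y ∈ Γ.slidingCircuits X, ∃ Z ∈ Γ.cyclingOrbit Y, Γ.HasProductForm x k y l Z) ∧
            (∀ Y ∈ Γ.slidingCircuits X,
              ∃ Z ∈ Γ.decyclingOrbit Y, Γ.HasProductForm x k y l Z))))) := by
  have h : Γ.IsTame := ⟨hfin, hsym, hhom⟩
  refine ⟨fun hsq hxδ => ⟨h.hasConjugateForm hk hx hsq hxδ, HasConjugateForm.mem_conjugatesOf⟩,
    fun hsq => ⟨fun hX => ?_, ?_⟩⟩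
  · classical
    have hlev := h.exists_hasLevel hx hy hX
    rcases Nat.eq_zero_or_pos (Nat.find hlev) with h0 | hpos
    · left
      obtain ⟨a, v, ⟨x₁, hx₁, R, hR, hRn, rfl⟩, hv, hm⟩ := (Nat.find_eq_zero hlev).mp h0
      obtain rfl : R = 1 := eq_one_of_prefix_one hR (by simpa using hRn)
      rw [cj_one] at hm
      exact ⟨x₁, hx₁, v, hv, mem_conjugatesOf_symm hm⟩
    · right
      have M : Γ.IsLeastLevel X x y k l (Nat.find hlev) :=
        ⟨h, hk, hl, hsq, hpos, Nat.find_spec hlev, fun n hn => Nat.find_min hlev hn⟩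
      exact ⟨fun Y hY => M.exists_mem_cyclingOrbit hY, fun Y hY => M.exists_mem_decyclingOrbit hY⟩
  · rintro (⟨x₁, hx₁, y₁, hy₁, hX⟩ | ⟨hX, -⟩)
    · exact mem_mul_of_mem_conjugatesOf hx₁.1 hy₁.1 hX
    · obtain ⟨Y, hY⟩ := h.slidingCircuits_nonempty (delta_ne_one_of_mem_atoms h hx) X
      obtain ⟨Z, ⟨m, rfl⟩, hZ⟩ := hX Y hY
      -- one element of the product form suffices, and there is one since circuits exist
      refine conjugatesOf_mul_of_mem ?_ hZ.mem_mul
      clear hZ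
      induction m with
      | zero => exact hY.1
      | succ m ih =>
        rw [Function.iterate_succ_apply']
        exact cj_mem_of_mem ih _
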